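/- Let $Q$ be a quiver of type $A_n$ with arbitrary orientation, i.e. a quiver with finite vertex set $I$, $|I|=n$, whose underlying unoriented graph is the path on $n$ vertices. A representation of $Q$ over $\mathbb F_1$ assigns to every vertex a finite pointed set and to every edge a base-point preserving map that is injective away from the preimage of the base point; morphisms are families of such maps commuting with the edge maps. Let $\mathrm{Iso}(Q)$ be the set of isomorphism classes, let $K_0$ be the Grothendieck group (generators $[M]$, relations $[M]=[L]+[M/L]$ for $L\subseteq M$), and let $S_i$ be the simple representation at the vertex $i$. The Hall algebra $\mathbf H_Q$ is the space of finitely supported functions $\mathrm{Iso}(Q)\to\mathbb C$, with basis the delta functions $[M]$, product $(f\cdot g)(M)=\sum_{L\subseteq M}f(M/L)\,g(L)$ and coproduct $\Delta(f)([M],[N])=f([M\oplus N])$. Put $\mathfrak h_Q=\mathrm{Hom}_{\mathbb Z}(K_0,\mathbb C)$. The extended Hall algebra is $\widetilde{\mathbf H}_Q=\mathrm{Sym}(\mathfrak h_Q)\otimes_{\mathbb C}\mathbf H_Q$ with the relations $[Z,f]=Z(\alpha)f$ for $Z\in\mathfrak h_Q$ and $f\in\mathbf H_Q$ of degree $\alpha\in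 K_0$; its coproduct extends that of $\mathbf H_Q$ multiplicatively, with the elements of $\mathfrak h_Q$ primitive. Let $A=(a_{ij})$ be the Cartan matrix of the underlying graph ($a_{ii}=2$, and $-a_{ij}$ is the number of edges joining $i$ and $j$ for $i\ne j$), let $\mathfrak g$ be the Kac–Moody algebra of $A$, with generators $e_i,f_i,h_i$ ($i\in I$) and the Serre relations, let $\mathfrak n_+\subset\mathfrak g$ be the Lie subalgebra generated by the $e_i$, and $\mathfrak b'=\bigoplus_i\mathbb C h_i\oplus\mathfrak n_+$. Let $Z_i\in\mathfrak h_Q$ be the element with $Z_i([S_j])=a_{ji}$ for all $j$. **Theorem.** There is a unique algebra homomorphism $\rho:U(\mathfrak b')\to\widetilde{\mathbf H}_Q$ with $\rho(e_i)=[S_i]$ and $\rho(h_i)=Z_i$ for all $i\in I$; it is compatible with the coproducts and the counits, and it is an isomorphism. Consequently $\rho$ restricts to an algebra isomorphism $\rho':U(\mathfrak n_+)\to\mathbf H_Q$ with $\rho'(e_i)=[S_i]$, and the elements $b_M=\rho'^{-1}([M])$, $[M]\in\mathrm{Iso}(Q)$, form an integral basis of $U(\mathfrak n_+)$ with positive structure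 constants: they are a $\mathbb C$-basis of $U(\mathfrak n_+)$; every product $b_Mb_N$ is a linear combination of basis elements $b_R$ with coefficients in $\mathbb Z_{\ge0}$; and their $\mathbb Z$-span is the integral form of $U(\mathfrak n_+)$, the subring generated by the divided powers $e_i^k/k!$ ($i\in I$, $k\ge0$). -/

import Mathlib

open CategoryTheory
open scoped TensorProduct

universe u v

/-- A representation of a quiver in the category of vector spaces over `𝔽₁`: a finite pointed set
`V i` (with base point `0`) at every vertex, and for every edge a base point preserving map that is
injective away from the preimage of the base point. -/
structure F1Rep (I : Type u) [Quiver.{v} I] where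
  V : I → Type
  [zero : ∀ i, Zero (V i)]
  [finite : ∀ i, Finite (V i)]
  map : ∀ {i j : I}, (i ⟶ j) → V i → V j
  map_zero : ∀ {i j : I} (h : i ⟶ j), map h 0 = 0
  map_inj : ∀ {i j : I} (h : i ⟶ j) (x y : V i), map h x ≠ 0 → map h x = map h y → x = y

namespace F1Rep

attribute [instance] F1Rep.zero F1Rep.finite

section Basic

variable {I : Type u} [Quiver.{v} I]

/-- Morphisms of representations: families of morphisms of vector spaces over `𝔽₁` that commute
with the edge maps. -/
@[ext]
structure Hom (M N : F1Rep.{u, v} I) where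
  app : ∀ i, M.V i → N.V i
  app_zero : ∀ i, app i 0 = 0
  app_inj : ∀ i (x y : M.V i), app i x ≠ 0 → app i x = app i y → x = y
  comm : ∀ {i j : I} (h : i ⟶ j) (x : M.V i), N.map h (app i x) = app j (M.map h x)

instance : Category (F1Rep.{u, v} I) where
  Hom M N := Hom M N
  id M := ⟨fun _ x => x, fun _ => rfl, fun _ _ _ _ e => e, fun _ _ => rfl⟩
  comp {M N P} f g :=
    { app := fun i x => g.app i (f.app i x)
      app_zero := fun i => by rw [f.app_zero, g.app_zero]
      app_inj := fun i x y hx e => by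
        have h1 := g.app_inj i _ _ hx e
        refine f.app_inj i x y ?_ h1
        intro h0
        rw [h0, g.app_zero] at hx
        exact hx rfl
      comm := fun h x => by rw [g.comm, f.comm] }

/-- An isomorphism of representations from bijections that commute with everything. -/
def mkIso {M N : F1Rep.{u, v} I} (e : ∀ i, M.V i ≃ N.V i) (h0 : ∀ i, e i 0 = 0)
    (hc : ∀ {i j : I} (h : i ⟶ j) (x : M.V i), N.map h (e i x) = e j (M.map h x)) : M ≅ N where
  hom := ⟨fun i => e i, h0, fun i _ _ _ h => (e i).injective h, hc⟩
  inv := ⟨fun i => (e i).symm, fun i => by rw [Equiv.symm_apply_eq, h0],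
    fun i _ _ _ h => (e i).symm.injective h, fun {i j} h x => by
      rw [Equiv.eq_symm_apply, ← hc, Equiv.apply_symm_apply]⟩
  hom_inv_id := Hom.ext (funext fun i => funext fun x => (e i).symm_apply_apply x)
  inv_hom_id := Hom.ext (funext fun i => funext fun x => (e i).apply_symm_apply x)

/-- The bijections underlying an isomorphism. -/
def isoEquiv {M N : F1Rep.{u, v} I} (f : M ≅ N) (i : I) : M.V i ≃ N.V i where
  toFun := Hom.app f.hom i
  invFun := Hom.app f.inv i
  left_inv x := congrFun (congrFun (congrArg Hom.app f.hom_inv_id) i) x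
  right_inv x := congrFun (congrFun (congrArg Hom.app f.inv_hom_id) i) x

theorem isoEquiv_zero {M N : F1Rep.{u, v} I} (f : M ≅ N) (i : I) : isoEquiv f i 0 = 0 :=
  Hom.app_zero f.hom i

theorem isoEquiv_comm {M N : F1Rep.{u, v} I} (f : M ≅ N) {i j : I} (h : i ⟶ j) (x : M.V i) :
    N.map h (isoEquiv f i x) = isoEquiv f j (M.map h x) :=
  Hom.comm f.hom h x

/-- The zero representation. -/
def zeroRep (I : Type u) [Quiver.{v} I] : F1Rep.{u, v} I where
  V _ := PUnit
  map _ _ := 0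
  map_zero _ := rfl
  map_inj _ _ _ _ _ := rfl

/-- The simple representation `S i`: one-dimensional at `i`, zero elsewhere, with zero maps. -/
def simple (i : I) : F1Rep.{u, v} I where
  V j := Option (PLift (j = i))
  zero _ := ⟨none⟩
  map _ _ := none
  map_zero _ := rfl
  map_inj _ _ _ h _ := (h rfl).elim

/-- The direct sum: at every vertex, two pointed sets glued along their base points, realized
inside the product as the union of the two axes. -/
def sum (M N : F1Rep.{u, v} I) : F1Rep.{u, v} I where
  V i := {p : M.V i × N.V i // p.1 = 0 ∨ p.2 = 0}
  zero _ := ⟨⟨0, Or.inl rfl⟩⟩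
  map h p := ⟨(M.map h p.1.1, N.map h p.1.2), p.2.imp
    (fun e => by simp only [e, M.map_zero]) (fun e => by simp only [e, N.map_zero])⟩
  map_zero h := Subtype.ext (Prod.ext (M.map_zero h) (N.map_zero h))
  map_inj {i j} h p q hp e := by
    obtain ⟨⟨a, b⟩, hab⟩ := p
    obtain ⟨⟨c, d⟩, hcd⟩ := q
    have e1 : M.map h a = M.map h c := congrArg (fun z => z.1.1) e
    have e2 : N.map h b = N.map h d := congrArg (fun z => z.1.2) e
    by_cases ha : M.map h a = 0
    · have hb : N.map h b ≠ 0 := fun hb => hp (Subtype.ext (Prod.ext ha hb))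
      have hbd := N.map_inj h b d hb e2
      have hb0 : b ≠ 0 := fun h0 => hb (by rw [h0, N.map_zero])
      have ha0 : a = 0 := hab.resolve_right hb0
      have hc0 : c = 0 := hcd.resolve_right (by rw [← hbd]; exact hb0)
      exact Subtype.ext (Prod.ext (ha0.trans hc0.symm) hbd)
    · have hac := M.map_inj h a c ha e1
      have ha0 : a ≠ 0 := fun h0 => ha (by rw [h0, M.map_zero])
      have hb0 : b = 0 := hab.resolve_left ha0
      have hd0 : d = 0 := hcd.resolve_left (by rw [← hac]; exact ha0)
      exact Subtype.ext (Prod.ext hac (hb0.trans hd0.symm))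

/-- A sub-representation: pointed subsets stable under the edge maps. -/
@[ext]
structure Sub (M : F1Rep.{u, v} I) where
  carrier : ∀ i, Set (M.V i)
  zero_mem : ∀ i, 0 ∈ carrier i
  map_mem : ∀ {i j : I} (h : i ⟶ j) (x : M.V i), x ∈ carrier i → M.map h x ∈ carrier j

/-- A sub-representation as a representation. -/
def Sub.rep {M : F1Rep.{u, v} I} (L : Sub M) : F1Rep.{u, v} I where
  V i := {x : M.V i // x ∈ L.carrier i}
  zero i := ⟨⟨0, L.zero_mem i⟩⟩
  map h x := ⟨M.map h x.1, L.map_mem h x.1 x.2⟩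
  map_zero h := Subtype.ext (M.map_zero h)
  map_inj h x y hx e := Subtype.ext (M.map_inj h x.1 y.1 (fun h0 => hx (Subtype.ext h0))
    (congrArg Subtype.val e))

open Classical in
/-- The quotient `M / L`: at every vertex the subset `L i` is identified to a point. The class of
this point is represented by `0`, the other classes by the elements outside `L i`. -/
noncomputable def Sub.quot {M : F1Rep.{u, v} I} (L : Sub M) : F1Rep.{u, v} I where
  V i := {x : M.V i // x ∈ L.carrier i → x = 0}
  zero i := ⟨⟨0, fun _ => rfl⟩⟩
  map {_ j} h x := if hx : M.map h x.1 ∈ L.carrier j then ⟨0, fun _ => rfl⟩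
    else ⟨M.map h x.1, fun hx' => (hx hx').elim⟩
  map_zero {_ j} h := by
    have : M.map h 0 ∈ L.carrier j := by rw [M.map_zero]; exact L.zero_mem j
    exact dif_pos this
  map_inj {i j} h x y hx e := by
    by_cases h1 : M.map h x.1 ∈ L.carrier j
    · exact (hx (dif_pos h1)).elim
    · by_cases h2 : M.map h y.1 ∈ L.carrier j
      · exact (hx (e.trans (dif_pos h2))).elim
      · simp only [h1, h2, dif_neg, not_false_eq_true] at e
        refine Subtype.ext (M.map_inj h x.1 y.1 (fun h0 => h1 ?_) (congrArg Subtype.val e))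
        rw [h0]; exact L.zero_mem j

theorem Sub.quot_map_pos {M : F1Rep.{u, v} I} (L : Sub M) {i j : I} (h : i ⟶ j) (x : L.quot.V i)
    (hx : M.map h x.1 ∈ L.carrier j) : (L.quot.map h x).1 = 0 :=
  congrArg Subtype.val (dif_pos hx)

theorem Sub.quot_map_neg {M : F1Rep.{u, v} I} (L : Sub M) {i j : I} (h : i ⟶ j) (x : L.quot.V i)
    (hx : M.map h x.1 ∉ L.carrier j) : (L.quot.map h x).1 = M.map h x.1 :=
  congrArg Subtype.val (dif_neg hx)

theorem Sub.quot_ext {M : F1Rep.{u, v} I} (L : Sub M) {i : I} {x y : L.quot.V i}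
    (h : x.1 = y.1) : x = y := Subtype.ext h

/-- The isomorphism on subobjects induced by an isomorphism. -/
noncomputable def subEquiv {M N : F1Rep.{u, v} I} (f : M ≅ N) : Sub M ≃ Sub N where
  toFun L := ⟨fun i => {y | (isoEquiv f i).symm y ∈ L.carrier i}, fun i => by
      have : (isoEquiv f i).symm 0 = 0 := by rw [Equiv.symm_apply_eq, isoEquiv_zero]
      simp only [Set.mem_ofPred_eq, this, L.zero_mem],
    fun {i j} h y hy => by
      have := L.map_mem h _ hy
      have e : (isoEquiv f j).symm (N.map h y) = M.map h ((isoEquiv f i).symm y) := by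
        rw [Equiv.symm_apply_eq, ← isoEquiv_comm, Equiv.apply_symm_apply]
      simpa only [Set.mem_ofPred_eq, e] using this⟩
  invFun L := ⟨fun i => {x | isoEquiv f i x ∈ L.carrier i}, fun i => by
      simp only [Set.mem_ofPred_eq, isoEquiv_zero, L.zero_mem],
    fun {i j} h x hx => by
      have := L.map_mem h _ hx
      simpa only [Set.mem_ofPred_eq, isoEquiv_comm] using this⟩
  left_inv L := by
    ext i x
    simp
  right_inv L := by
    ext i x
    simp

theorem subEquiv_mem {M N : F1Rep.{u, v} I} (f : M ≅ N) (L : Sub M) (i : I) (x : M.V i) :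
    isoEquiv f i x ∈ (subEquiv f L).carrier i ↔ x ∈ L.carrier i := by
  simp [subEquiv]

noncomputable def subEquivRep {M N : F1Rep.{u, v} I} (f : M ≅ N) (L : Sub M) :
    L.rep ≅ (subEquiv f L).rep :=
  mkIso (fun i => (isoEquiv f i).subtypeEquiv fun x => (subEquiv_mem f L i x).symm)
    (fun i => Subtype.ext (isoEquiv_zero f i))
    (fun h x => Subtype.ext (isoEquiv_comm f h x.1))

noncomputable def subEquivQuot {M N : F1Rep.{u, v} I} (f : M ≅ N) (L : Sub M) :
    L.quot ≅ (subEquiv f L).quot :=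
  mkIso (fun i => (isoEquiv f i).subtypeEquiv fun x => by
      rw [subEquiv_mem, ← isoEquiv_zero f i, (isoEquiv f i).injective.eq_iff])
    (fun i => Subtype.ext (isoEquiv_zero f i))
    (fun {i j} h x => Sub.quot_ext _ (by
      change _ = isoEquiv f j (L.quot.map h x).1
      by_cases hx : M.map h x.1 ∈ L.carrier j
      · rw [Sub.quot_map_pos L h x hx]
        refine Eq.trans ?_ (isoEquiv_zero f j).symm
        refine Sub.quot_map_pos _ h _ ?_
        change N.map h (isoEquiv f i x.1) ∈ _
        rwa [isoEquiv_comm, subEquiv_mem]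
      · rw [Sub.quot_map_neg L h x hx, ← isoEquiv_comm]
        refine Sub.quot_map_neg _ h _ ?_
        change N.map h (isoEquiv f i x.1) ∉ _
        rwa [isoEquiv_comm, subEquiv_mem]))

/-- Sub-representations of a quotient `M / L` are the sub-representations of `M` above `L`. -/
def subQuotEquiv {M : F1Rep.{u, v} I} (L : Sub M) :
    Sub L.quot ≃ {L' : Sub M // ∀ i, L.carrier i ⊆ L'.carrier i} where
  toFun K := ⟨⟨fun i => {x | ∀ hx : (x ∈ L.carrier i → x = 0), (⟨x, hx⟩ : L.quot.V i) ∈ K.carrier i},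
      fun i _ => K.zero_mem i, fun {i j} h x hx hx' => by
        by_cases hm : M.map h x ∈ L.carrier j
        · have h0 := hx' hm
          have : (⟨M.map h x, hx'⟩ : L.quot.V j) = (0 : L.quot.V j) := Sub.quot_ext L h0
          exact Set.mem_of_eq_of_mem this (K.zero_mem j)
        · have hxL : x ∉ L.carrier i := fun hxL => hm (L.map_mem h x hxL)
          let y : L.quot.V i := ⟨x, fun hxL' => (hxL hxL').elim⟩
          have e : (⟨M.map h x, hx'⟩ : L.quot.V j) = L.quot.map h y :=
            Sub.quot_ext L (Sub.quot_map_neg L h y hm).symm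
          exact Set.mem_of_eq_of_mem e (K.map_mem h y (hx _))⟩,
    fun i x hxL hx => by
      have : (⟨x, hx⟩ : L.quot.V i) = (0 : L.quot.V i) := Sub.quot_ext L (hx hxL)
      exact Set.mem_of_eq_of_mem this (K.zero_mem i)⟩
  invFun L' := ⟨fun i => {x | x.1 ∈ L'.1.carrier i}, fun i => L'.1.zero_mem i,
    fun {i j} h x hx => by
      change (L.quot.map h x).1 ∈ L'.1.carrier j
      by_cases hL : M.map h x.1 ∈ L.carrier j
      · rw [Sub.quot_map_pos L h x hL]; exact L'.1.zero_mem j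
      · rw [Sub.quot_map_neg L h x hL]; exact L'.1.map_mem h _ hx⟩
  left_inv K := by
    ext i x
    exact ⟨fun h => h x.2, fun h _ => h⟩
  right_inv L' := by
    refine Subtype.ext (Sub.ext (funext fun i => Set.ext fun x => ?_))
    constructor
    · intro h
      by_cases hx : x ∈ L.carrier i
      · exact L'.2 i hx
      · exact h fun hx' => (hx hx').elim
    · exact fun h _ => h

/-- Sub-representations of `L'` are the sub-representations of `M` below `L'`. -/
def subSubEquiv {M : F1Rep.{u, v} I} (L' : Sub M) :
    Sub L'.rep ≃ {L : Sub M // ∀ i, L.carrier i ⊆ L'.carrier i} where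
  toFun J := ⟨⟨fun i => {x | ∃ hx : x ∈ L'.carrier i, (⟨x, hx⟩ : L'.rep.V i) ∈ J.carrier i},
      fun i => ⟨L'.zero_mem i, J.zero_mem i⟩,
      fun h x hx => ⟨L'.map_mem h x hx.1, J.map_mem h ⟨x, hx.1⟩ hx.2⟩⟩,
    fun i x hx => hx.1⟩
  invFun L := ⟨fun i => {x | x.1 ∈ L.1.carrier i}, fun i => L.1.zero_mem i,
    fun h x hx => L.1.map_mem h x.1 hx⟩
  left_inv J := by
    ext i x
    exact ⟨fun h => h.2, fun h => ⟨x.2, h⟩⟩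
  right_inv L := Subtype.ext (Sub.ext (funext fun i => Set.ext fun x =>
    ⟨fun h => h.2, fun h => ⟨L.2 i h, h⟩⟩))

theorem mem_subQuotEquiv {M : F1Rep.{u, v} I} (L : Sub M) (K : Sub L.quot) (i : I)
    (x : L.quot.V i) : x.1 ∈ (subQuotEquiv L K).1.carrier i ↔ x ∈ K.carrier i :=
  ⟨fun h => h x.2, fun h _ => h⟩

/-- `(M / L) / (L' / L) ≅ M / L'`. -/
noncomputable def quotQuotIso {M : F1Rep.{u, v} I} (L : Sub M) (K : Sub L.quot) :
    K.quot ≅ (subQuotEquiv L K).1.quot :=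
  mkIso (fun i =>
      { toFun := fun x => ⟨x.1.1, fun hx => congrArg Subtype.val
          (x.2 ((mem_subQuotEquiv L K i x.1).1 hx))⟩
        invFun := fun x => ⟨⟨x.1, fun hx => x.2 ((subQuotEquiv L K).2 i hx)⟩, fun hx =>
          Subtype.ext (x.2 ((mem_subQuotEquiv L K i ⟨x.1, _⟩).2 hx))⟩
        left_inv := fun _ => rfl
        right_inv := fun _ => rfl })
    (fun _ => rfl)
    (fun {i j} h x => Sub.quot_ext _ (by
      change _ = (K.quot.map h x).1.1
      by_cases hL : M.map h x.1.1 ∈ L.carrier j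
      · have h1 : L.quot.map h x.1 = 0 := Sub.quot_ext L (Sub.quot_map_pos L h x.1 hL)
        rw [Sub.quot_map_pos K h x (by rw [h1]; exact K.zero_mem j)]
        exact Sub.quot_map_pos _ h _ ((subQuotEquiv L K).2 j hL)
      · have h1 : (L.quot.map h x.1).1 = M.map h x.1.1 := Sub.quot_map_neg L h x.1 hL
        by_cases hK : L.quot.map h x.1 ∈ K.carrier j
        · rw [Sub.quot_map_pos K h x hK]
          refine Sub.quot_map_pos _ h _ ?_
          change M.map h x.1.1 ∈ _
          rwa [← h1, mem_subQuotEquiv]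
        · rw [Sub.quot_map_neg K h x hK, h1]
          refine Sub.quot_map_neg _ h _ ?_
          change M.map h x.1.1 ∉ _
          rwa [← h1, mem_subQuotEquiv]))

/-- The third isomorphism: the sub-representation `K` of `M / L` is `L' / L`. -/
noncomputable def quotSubIso {M : F1Rep.{u, v} I} (L L' : Sub M)
    (hL : ∀ i, L.carrier i ⊆ L'.carrier i) :
    ((subQuotEquiv L).symm ⟨L', hL⟩).rep ≅ ((subSubEquiv L').symm ⟨L, hL⟩).quot :=
  mkIso (fun i =>
      { toFun := fun x => ⟨⟨x.1.1, x.2⟩, fun hx => Subtype.ext (x.1.2 hx)⟩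
        invFun := fun x => ⟨⟨x.1.1, fun hx => congrArg Subtype.val (x.2 hx)⟩, x.1.2⟩
        left_inv := fun _ => rfl
        right_inv := fun _ => rfl })
    (fun _ => rfl)
    (fun {i j} h x => Sub.quot_ext _ (Subtype.ext (by
      change _ = (L.quot.map h x.1).1
      by_cases hx : M.map h x.1.1 ∈ L.carrier j
      · rw [Sub.quot_map_pos L h x.1 hx]
        exact congrArg Subtype.val (Sub.quot_map_pos ((subSubEquiv L').symm ⟨L, hL⟩) h
          ⟨⟨x.1.1, x.2⟩, fun hx => Subtype.ext (x.1.2 hx)⟩ hx)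
      · rw [Sub.quot_map_neg L h x.1 hx]
        exact congrArg Subtype.val (Sub.quot_map_neg ((subSubEquiv L').symm ⟨L, hL⟩) h
          ⟨⟨x.1.1, x.2⟩, fun hx => Subtype.ext (x.1.2 hx)⟩ hx))))

/-- The sub-representation `L` of `L'` is `L`. -/
def subSubIso {M : F1Rep.{u, v} I} (L L' : Sub M)
    (hL : ∀ i, L.carrier i ⊆ L'.carrier i) :
    ((subSubEquiv L').symm ⟨L, hL⟩).rep ≅ L.rep :=
  mkIso (fun i =>
      { toFun := fun x => ⟨x.1.1, x.2⟩
        invFun := fun x => ⟨⟨x.1, hL i x.2⟩, x.2⟩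
        left_inv := fun _ => rfl
        right_inv := fun _ => rfl })
    (fun _ => rfl) (fun _ _ => rfl)

instance [Finite I] (M : F1Rep.{u, v} I) : Finite (Sub M) :=
  Finite.of_injective (fun L : Sub M => L.carrier) fun _ _ h => Sub.ext h

noncomputable instance [Finite I] (M : F1Rep.{u, v} I) : Fintype (Sub M) := Fintype.ofFinite _

end Basic

end F1Rep

namespace F1Rep

section Classes

variable (I : Type u) [Quiver.{v} I]

/-- Isomorphism classes of representations. -/
def IsoClass : Type (max 1 u v) := Quotient (isIsomorphicSetoid (F1Rep.{u, v} I))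

variable {I}

/-- The isomorphism class of a representation. -/
def cls (M : F1Rep.{u, v} I) : IsoClass I := Quotient.mk _ M

/-- The chosen representative of an isomorphism class. -/
noncomputable def IsoClass.rep (X : IsoClass I) : F1Rep.{u, v} I := Quotient.out X

theorem cls_rep (X : IsoClass I) : cls X.rep = X := Quotient.out_eq X

theorem cls_eq_iff {M N : F1Rep.{u, v} I} : cls M = cls N ↔ Nonempty (M ≅ N) := Quotient.eq

theorem cls_eq {M N : F1Rep.{u, v} I} (f : M ≅ N) : cls M = cls N := cls_eq_iff.2 ⟨f⟩

/-- The dimension vector: the number of non-base points at every vertex. -/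
noncomputable def dimVec (M : F1Rep.{u, v} I) (i : I) : ℕ := Nat.card {x : M.V i // x ≠ 0}

theorem dimVec_iso {M N : F1Rep.{u, v} I} (f : M ≅ N) : dimVec M = dimVec N := by
  funext i
  exact Nat.card_congr ((isoEquiv f i).subtypeEquiv fun x => by
    rw [not_iff_not, ← (isoEquiv f i).injective.eq_iff, isoEquiv_zero])

open Classical in
theorem dimVec_sub_quot {M : F1Rep.{u, v} I} (L : Sub M) (i : I) :
    dimVec M i = dimVec L.quot i + dimVec L.rep i := by
  rw [add_comm]
  unfold dimVec
  have : Finite {x : L.rep.V i // x ≠ 0} := inferInstance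
  have : Finite {x : L.quot.V i // x ≠ 0} := inferInstance
  rw [← Nat.card_sum]
  refine Nat.card_congr (((Equiv.sumCompl fun x : {x : M.V i // x ≠ 0} =>
    x.1 ∈ L.carrier i).symm).trans (Equiv.sumCongr ?_ ?_))
  · exact
      { toFun := fun x => ⟨⟨x.1.1, x.2⟩, fun h => x.1.2 (congrArg Subtype.val h)⟩
        invFun := fun x => ⟨⟨x.1.1, fun h => x.2 (Subtype.ext h)⟩, x.1.2⟩
        left_inv := fun _ => rfl
        right_inv := fun _ => rfl }
  · exact
      { toFun := fun x => ⟨⟨x.1.1, fun h => (x.2 h).elim⟩, fun h => x.1.2 (congrArg Subtype.val h)⟩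
        invFun := fun x => ⟨⟨x.1.1, fun h => x.2 (Subtype.ext h)⟩, fun h =>
          x.2 (Subtype.ext (x.1.2 h))⟩
        left_inv := fun _ => rfl
        right_inv := fun _ => rfl }

theorem dimVec_le_sum (M N : F1Rep.{u, v} I) :
    dimVec M ≤ dimVec (sum M N) ∧ dimVec N ≤ dimVec (sum M N) := by
  constructor
  · intro i
    refine Nat.card_le_card_of_injective (fun x => ⟨⟨(x.1, 0), Or.inr rfl⟩, fun h =>
      x.2 (congrArg (fun z => z.1.1) h)⟩) ?_
    intro x y h
    exact Subtype.ext (congrArg (fun z => z.1.1.1) h)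
  · intro i
    refine Nat.card_le_card_of_injective (fun x => ⟨⟨(0, x.1), Or.inl rfl⟩, fun h =>
      x.2 (congrArg (fun z => z.1.2) h)⟩) ?_
    intro x y h
    exact Subtype.ext (congrArg (fun z => z.1.1.2) h)

open Classical in
theorem dimVec_simple (i j : I) : dimVec (simple i) j = if j = i then 1 else 0 := by
  unfold dimVec
  split_ifs with h
  · rw [Nat.card_eq_one_iff_unique]
    refine ⟨⟨fun x y => ?_⟩, ⟨⟨some ⟨h⟩, fun e => Option.some_ne_none _ e⟩⟩⟩
    obtain ⟨x, hx⟩ := x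
    obtain ⟨y, hy⟩ := y
    match x, y, hx, hy with
    | some ⟨_⟩, some ⟨_⟩, _, _ => rfl
    | none, _, hx, _ => exact (hx rfl).elim
    | _, none, _, hy => exact (hy rfl).elim
  · have : IsEmpty {x : (simple i : F1Rep.{u, v} I).V j // x ≠ 0} := by
      refine ⟨fun x => ?_⟩
      obtain ⟨x, hx⟩ := x
      match x, hx with
      | some a, _ => exact h a.down
      | none, hx => exact hx rfl
    exact Nat.card_of_isEmpty

/-- The dimension vector of an isomorphism class. -/
noncomputable def IsoClass.dim (X : IsoClass I) : I → ℕ := dimVec X.rep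

theorem dim_cls (M : F1Rep.{u, v} I) : (cls M).dim = dimVec M := by
  obtain ⟨f⟩ := cls_eq_iff.1 (cls_rep (cls M))
  exact dimVec_iso f

open Classical in
theorem finite_dim [Finite I] [∀ i j : I, Finite (i ⟶ j)] (d : I → ℕ) :
    {X : IsoClass I | X.dim = d}.Finite := by
  have e' : ∀ (X : {X : IsoClass I | X.dim = d}) (i : I), Nonempty
      {e : X.1.rep.V i ≃ Option (Fin (d i)) // e 0 = none} := by
    intro X i
    have h : Nat.card {x : X.1.rep.V i // x ≠ 0} = d i := congrFun X.2 i
    refine ⟨⟨(Equiv.optionSubtypeNe (0 : X.1.rep.V i)).symm.trans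
      (Equiv.optionCongr (Finite.equivFinOfCardEq h)), ?_⟩⟩
    simp
  let e := fun X i => Classical.choice (e' X i)
  let F : {X : IsoClass I | X.dim = d} →
      ∀ i j : I, (i ⟶ j) → Option (Fin (d i)) → Option (Fin (d j)) :=
    fun X i j h x => (e X j).1 (X.1.rep.map h ((e X i).1.symm x))
  refine Set.finite_coe_iff.1 (Finite.of_injective F fun X Y hXY => Subtype.ext ?_)
  rw [← cls_rep X.1, ← cls_rep Y.1]
  refine cls_eq (mkIso (fun i => (e X i).1.trans (e Y i).1.symm) (fun i => ?_) ?_)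
  · rw [Equiv.trans_apply, Equiv.symm_apply_eq, (e X i).2, (e Y i).2]
  · intro i j h x
    rw [Equiv.trans_apply, Equiv.trans_apply, Equiv.eq_symm_apply]
    have := congrFun (congrFun (congrFun (congrFun hXY i) j) h) ((e X i).1 x)
    simp only [F, Equiv.symm_apply_apply] at this
    exact this.symm

theorem finite_dim_le [Finite I] [∀ i j : I, Finite (i ⟶ j)] (d : I → ℕ) :
    {X : IsoClass I | X.dim ≤ d}.Finite := by
  classical
  have := Fintype.ofFinite I
  refine ((Set.finite_Iic d).biUnion fun e _ => finite_dim e).subset fun X hX => ?_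
  exact Set.mem_biUnion (x := X.dim) hX rfl

end Classes

section Grothendieck

variable (I : Type u) [Quiver.{v} I]

/-- The relations `[M] = [M / L] + [L]` of the Grothendieck group. -/
def K0Rel : AddSubgroup (FreeAbelianGroup (IsoClass.{u, v} I)) :=
  AddSubgroup.closure {x | ∃ (M : F1Rep.{u, v} I) (L : Sub M), x = FreeAbelianGroup.of (cls M) -
    (FreeAbelianGroup.of (cls L.quot) + FreeAbelianGroup.of (cls L.rep))}

/-- The Grothendieck group `K₀` of the category of representations. -/
abbrev K0 : Type (max 1 u v) := FreeAbelianGroup (IsoClass.{u, v} I) ⧸ K0Rel I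

variable {I}

/-- The class of an isomorphism class of representations in `K₀`. -/
def IsoClass.k0 (X : IsoClass.{u, v} I) : K0 I := QuotientAddGroup.mk (FreeAbelianGroup.of X)

theorem k0_sub_quot {M : F1Rep.{u, v} I} (L : Sub M) :
    (cls M).k0 = (cls L.quot).k0 + (cls L.rep).k0 := by
  have h : (QuotientAddGroup.mk (FreeAbelianGroup.of (cls M) - (FreeAbelianGroup.of (cls L.quot) +
      FreeAbelianGroup.of (cls L.rep))) : K0 I) = 0 :=
    (QuotientAddGroup.eq_zero_iff _).2 (AddSubgroup.subset_closure ⟨M, L, rfl⟩)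
  exact sub_eq_zero.1 h

/-- The homomorphism `K₀ → ℤ` given by the `j`-th entry of the dimension vector. -/
noncomputable def k0Dim (j : I) : K0.{u, v} I →+ ℤ :=
  QuotientAddGroup.lift (K0Rel I) (FreeAbelianGroup.lift fun X => (X.dim j : ℤ)) (by
    rw [K0Rel, AddSubgroup.closure_le]
    rintro _ ⟨M, L, rfl⟩
    rw [SetLike.mem_coe, AddMonoidHom.mem_ker]
    simp [dim_cls, dimVec_sub_quot L j])

theorem k0Dim_k0 (j : I) (X : IsoClass.{u, v} I) : k0Dim j X.k0 = X.dim j := by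
  change FreeAbelianGroup.lift (fun X : IsoClass.{u, v} I => (X.dim j : ℤ))
    (FreeAbelianGroup.of X) = _
  rw [FreeAbelianGroup.lift_apply_of]

end Grothendieck

section Hall

variable {I : Type u} [Quiver.{v} I]

/-- The zero representation is the only one all of whose points are base points. -/
def isoOfSubsingleton {M N : F1Rep.{u, v} I} (hM : ∀ i (x : M.V i), x = 0)
    (hN : ∀ i (x : N.V i), x = 0) : M ≅ N :=
  mkIso (fun _ => ⟨fun _ => 0, fun _ => 0, fun x => (hM _ x).symm, fun x => (hN _ x).symm⟩)
    (fun _ => rfl) (fun h _ => N.map_zero h)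

theorem cls_eq_zero {M : F1Rep.{u, v} I} :
    cls M = cls (zeroRep I) ↔ ∀ i (x : M.V i), x = 0 := by
  constructor
  · intro h i x
    obtain ⟨f⟩ := cls_eq_iff.1 h
    refine (isoEquiv f i).injective ?_
    rfl
  · exact fun h => cls_eq (isoOfSubsingleton h fun _ _ => rfl)

theorem k0_zero : (cls (zeroRep.{u, v} I)).k0 = 0 := by
  let L : Sub (zeroRep.{u, v} I) := ⟨fun _ => Set.univ, fun _ => trivial, fun _ _ _ => trivial⟩
  have h := k0_sub_quot L
  have h1 : cls L.quot = cls (zeroRep I) := cls_eq_zero.2 fun _ _ => rfl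
  have h2 : cls L.rep = cls (zeroRep I) := cls_eq_zero.2 fun _ _ => rfl
  rw [h1, h2] at h
  exact left_eq_add.1 h

def Sub.bot (M : F1Rep.{u, v} I) : Sub M :=
  ⟨fun _ => {0}, fun _ => rfl, fun h x hx => by
    rw [Set.mem_singleton_iff] at hx ⊢
    rw [hx, M.map_zero]⟩

def Sub.top (M : F1Rep.{u, v} I) : Sub M :=
  ⟨fun _ => Set.univ, fun _ => trivial, fun _ _ _ => trivial⟩

theorem Sub.eq_bot_iff {M : F1Rep.{u, v} I} (L : Sub M) :
    L = Sub.bot M ↔ cls L.rep = cls (zeroRep I) := by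
  rw [cls_eq_zero]
  constructor
  · rintro rfl i x
    exact Subtype.ext x.2
  · intro h
    refine Sub.ext (funext fun i => Set.ext fun x => ⟨fun hx => ?_, ?_⟩)
    · exact congrArg Subtype.val (h i ⟨x, hx⟩)
    · rintro rfl
      exact L.zero_mem i

theorem Sub.eq_top_iff {M : F1Rep.{u, v} I} (L : Sub M) :
    L = Sub.top M ↔ cls L.quot = cls (zeroRep I) := by
  rw [cls_eq_zero]
  constructor
  · rintro rfl i x
    exact Subtype.ext (x.2 trivial)
  · intro h
    refine Sub.ext (funext fun i => Set.ext fun x => ⟨fun _ => trivial, fun _ => ?_⟩)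
    by_contra hx
    have := congrArg Subtype.val (h i ⟨x, fun h => (hx h).elim⟩)
    change x = 0 at this
    rw [this] at hx
    exact hx (L.zero_mem i)

theorem cls_bot_quot (M : F1Rep.{u, v} I) : cls (Sub.bot M).quot = cls M :=
  cls_eq (mkIso (fun _ => ⟨fun x => x.1, fun x => ⟨x, fun h => h⟩, fun _ => rfl, fun _ => rfl⟩)
    (fun _ => rfl) (fun {_ j} h x => by
      change M.map h x.1 = ((Sub.bot M).quot.map h x).1
      by_cases hx : M.map h x.1 ∈ (Sub.bot M).carrier j
      · rw [Sub.quot_map_pos _ h x hx]; exact hx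
      · rw [Sub.quot_map_neg _ h x hx]))

theorem cls_top_rep (M : F1Rep.{u, v} I) : cls (Sub.top M).rep = cls M :=
  cls_eq (mkIso (fun _ => ⟨fun x => x.1, fun x => ⟨x, trivial⟩, fun _ => rfl, fun _ => rfl⟩)
    (fun _ => rfl) (fun _ _ => rfl))

variable [Finite I]

theorem sum_sub_rep {A : Type*} [AddCommMonoid A] (φ : IsoClass I → IsoClass I → A)
    (M : F1Rep.{u, v} I) :
    ∑ L : Sub (cls M).rep, φ (cls L.quot) (cls L.rep) =
      ∑ L : Sub M, φ (cls L.quot) (cls L.rep) := by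
  obtain ⟨f⟩ := cls_eq_iff.1 (cls_rep (cls M))
  refine Fintype.sum_equiv (subEquiv f) _ _ fun L => ?_
  rw [cls_eq (subEquivQuot f L), cls_eq (subEquivRep f L)]

variable [∀ i j : I, Finite (i ⟶ j)] {A : Type*} [CommRing A]

/-- The convolution product on finitely supported functions on isomorphism classes with values in
a commutative ring on which the Grothendieck group acts through `τ`:
`(f * g) M = ∑_{L ⊆ M} f (M / L) * τ [M / L] (g L)`. -/
noncomputable def convolution (τ : K0.{u, v} I → A →+* A) (f g : IsoClass.{u, v} I →₀ A) :
    IsoClass.{u, v} I →₀ A :=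
  Finsupp.ofSupportFinite
    (fun X => ∑ L : Sub X.rep, f (cls L.quot) * τ (cls L.quot).k0 (g (cls L.rep))) (by
      classical
      refine ((f.support ×ˢ g.support).finite_toSet.biUnion fun p _ =>
        finite_dim (p.1.dim + p.2.dim)).subset fun X hX => ?_
      obtain ⟨L, -, hL⟩ := Finset.exists_ne_zero_of_sum_ne_zero (Function.mem_support.1 hX)
      refine Set.mem_biUnion (x := (cls L.quot, cls L.rep)) ?_ ?_
      · rw [Finset.mem_coe, Finset.mem_product, Finsupp.mem_support_iff, Finsupp.mem_support_iff]
        refine ⟨left_ne_zero_of_mul hL, fun h => right_ne_zero_of_mul hL ?_⟩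
        rw [h, _root_.map_zero]
      · funext i
        change X.dim i = (cls L.quot).dim i + (cls L.rep).dim i
        rw [dim_cls, dim_cls, ← dimVec_sub_quot]
        rfl)

theorem convolution_apply (τ : K0.{u, v} I → A →+* A) (f g : IsoClass.{u, v} I →₀ A)
    (X : IsoClass.{u, v} I) : convolution τ f g X =
      ∑ L : Sub X.rep, f (cls L.quot) * τ (cls L.quot).k0 (g (cls L.rep)) := rfl

theorem convolution_cls (τ : K0.{u, v} I → A →+* A) (f g : IsoClass.{u, v} I →₀ A)
    (M : F1Rep.{u, v} I) : convolution τ f g (cls M) =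
      ∑ L : Sub M, f (cls L.quot) * τ (cls L.quot).k0 (g (cls L.rep)) :=
  sum_sub_rep (fun X Y => f X * τ X.k0 (g Y)) M

theorem convolution_add_left (τ : K0.{u, v} I → A →+* A) (f f' g : IsoClass.{u, v} I →₀ A) :
    convolution τ (f + f') g = convolution τ f g + convolution τ f' g := by
  ext X
  simp only [Finsupp.add_apply, convolution_apply, add_mul, Finset.sum_add_distrib]

theorem convolution_add_right (τ : K0.{u, v} I → A →+* A) (f g g' : IsoClass.{u, v} I →₀ A) :
    convolution τ f (g + g') = convolution τ f g + convolution τ f g' := by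
  ext X
  simp only [Finsupp.add_apply, convolution_apply, map_add, mul_add, Finset.sum_add_distrib]

theorem convolution_zero_left (τ : K0.{u, v} I → A →+* A) (g : IsoClass.{u, v} I →₀ A) :
    convolution τ 0 g = 0 := by
  ext X
  simp [convolution_apply]

theorem convolution_zero_right (τ : K0.{u, v} I → A →+* A) (f : IsoClass.{u, v} I →₀ A) :
    convolution τ f 0 = 0 := by
  ext X
  simp [convolution_apply]

theorem convolution_single_left (τ : K0.{u, v} I → A →+* A) (h0 : τ 0 = RingHom.id A) (a : A)
    (g : IsoClass.{u, v} I →₀ A) :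
    convolution τ (Finsupp.single (cls (zeroRep I)) a) g = a • g := by
  classical
  ext X
  rw [convolution_apply, Finset.sum_eq_single (Sub.top X.rep)]
  · rw [(Sub.eq_top_iff _).1 rfl, Finsupp.single_eq_same, k0_zero, h0, cls_top_rep, cls_rep]
    rfl
  · intro L _ hL
    rw [Finsupp.single_eq_of_ne, zero_mul]
    exact fun h => hL ((Sub.eq_top_iff L).2 h)
  · exact fun h => (h (Finset.mem_univ _)).elim

theorem convolution_apply_single_zero (τ : K0.{u, v} I → A →+* A) (f : IsoClass.{u, v} I →₀ A)
    (a : A) (X : IsoClass.{u, v} I) :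
    convolution τ f (Finsupp.single (cls (zeroRep I)) a) X = f X * τ X.k0 a := by
  classical
  rw [convolution_apply, Finset.sum_eq_single (Sub.bot X.rep)]
  · rw [(Sub.eq_bot_iff _).1 rfl, Finsupp.single_eq_same, cls_bot_quot, cls_rep]
  · intro L _ hL
    rw [Finsupp.single_eq_of_ne, _root_.map_zero, mul_zero]
    exact fun h => hL ((Sub.eq_bot_iff L).2 h)
  · exact fun h => (h (Finset.mem_univ _)).elim

theorem convolution_single_right (τ : K0.{u, v} I → A →+* A) (X : IsoClass.{u, v} I) (a b : A) :
    convolution τ (Finsupp.single X a) (Finsupp.single (cls (zeroRep I)) b) =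
      Finsupp.single X (a * τ X.k0 b) := by
  classical
  ext Y
  rw [convolution_apply_single_zero, Finsupp.single_apply, Finsupp.single_apply]
  split_ifs with h
  · rw [h]
  · rw [zero_mul]

theorem convolution_one_left (τ : K0.{u, v} I → A →+* A) (h0 : τ 0 = RingHom.id A)
    (g : IsoClass.{u, v} I →₀ A) :
    convolution τ (Finsupp.single (cls (zeroRep I)) 1) g = g := by
  rw [convolution_single_left τ h0, one_smul]

theorem convolution_one_right (τ : K0.{u, v} I → A →+* A) (f : IsoClass.{u, v} I →₀ A) :
    convolution τ f (Finsupp.single (cls (zeroRep I)) 1) = f := by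
  ext X
  rw [convolution_apply_single_zero, map_one, mul_one]

theorem convolution_assoc (τ : K0.{u, v} I → A →+* A)
    (hτ : ∀ a b, τ (a + b) = (τ a).comp (τ b)) (f g h : IsoClass.{u, v} I →₀ A) :
    convolution τ (convolution τ f g) h = convolution τ f (convolution τ g h) := by
  classical
  ext X
  rw [convolution_apply, convolution_apply]
  simp only [convolution_cls]
  have e1 : ∀ L : Sub X.rep,
      (∑ K : Sub L.quot, f (cls K.quot) * τ (cls K.quot).k0 (g (cls K.rep))) *
        τ (cls L.quot).k0 (h (cls L.rep)) =
      ∑ L' : {L' : Sub X.rep // ∀ i, L.carrier i ⊆ L'.carrier i},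
        f (cls L'.1.quot) * τ (cls L'.1.quot).k0
          (g (cls ((subSubEquiv L'.1).symm ⟨L, L'.2⟩).quot) *
            τ (cls ((subSubEquiv L'.1).symm ⟨L, L'.2⟩).quot).k0 (h (cls L.rep))) := by
    intro L
    rw [Finset.sum_mul]
    refine Fintype.sum_equiv (subQuotEquiv L) _ _ fun K => ?_
    have h1 := cls_eq (quotQuotIso L K)
    have h2 := cls_eq (quotSubIso L (subQuotEquiv L K).1 (subQuotEquiv L K).2)
    rw [Subtype.coe_eta, Equiv.symm_apply_apply] at h2
    rw [← h1, ← h2, k0_sub_quot K, hτ, map_mul, RingHom.comp_apply, mul_assoc]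
  have e2 : ∀ L' : Sub X.rep,
      f (cls L'.quot) * τ (cls L'.quot).k0
        (∑ J : Sub L'.rep, g (cls J.quot) * τ (cls J.quot).k0 (h (cls J.rep))) =
      ∑ L : {L : Sub X.rep // ∀ i, L.carrier i ⊆ L'.carrier i},
        f (cls L'.quot) * τ (cls L'.quot).k0
          (g (cls ((subSubEquiv L').symm L).quot) *
            τ (cls ((subSubEquiv L').symm L).quot).k0 (h (cls L.1.rep))) := by
    intro L'
    rw [map_sum, Finset.mul_sum]
    refine Fintype.sum_equiv (subSubEquiv L') _ _ fun J => ?_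
    have h1 := cls_eq (subSubIso (subSubEquiv L' J).1 L' (subSubEquiv L' J).2)
    rw [Subtype.coe_eta, Equiv.symm_apply_apply] at h1
    rw [Equiv.symm_apply_apply, ← h1]
  simp only [e1, e2]
  rw [← Fintype.sum_sigma', ← Fintype.sum_sigma']
  exact Fintype.sum_equiv
    { toFun := fun p => ⟨p.2.1, ⟨p.1, p.2.2⟩⟩
      invFun := fun p => ⟨p.2.1, ⟨p.1, p.2.2⟩⟩
      left_inv := fun _ => rfl
      right_inv := fun _ => rfl } _ _ fun _ => rfl

end Hall

end F1Rep

section HallAlgebra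

variable (I : Type u) [Quiver.{v} I]

/-- The Hall algebra of the category of representations of a quiver over `𝔽₁`: finitely supported
complex functions on isomorphism classes. -/
def HallAlgebra : Type (max 1 u v) := F1Rep.IsoClass.{u, v} I →₀ ℂ

/-- `𝔥_Q = Hom(K₀, ℂ)`. -/
abbrev HallCartan : Type (max 1 u v) := F1Rep.K0.{u, v} I →+ ℂ

/-- The extended Hall algebra `Sym(𝔥_Q) ⊗ H_Q`, as a vector space: since the isomorphism classes
`[M]` are a basis of `H_Q`, its elements are the finite sums `∑ P_M ⊗ [M]` with `P_M ∈ Sym(𝔥_Q)`,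
that is, the finitely supported functions `M ↦ P_M` on isomorphism classes. -/
def ExtHallAlgebra : Type (max 1 u v) :=
  F1Rep.IsoClass.{u, v} I →₀ SymmetricAlgebra ℂ (HallCartan.{u, v} I)

noncomputable instance HallAlgebra.instAddCommGroup : AddCommGroup (HallAlgebra.{u, v} I) :=
  inferInstanceAs (AddCommGroup (F1Rep.IsoClass.{u, v} I →₀ ℂ))

noncomputable instance HallAlgebra.instModule : Module ℂ (HallAlgebra.{u, v} I) :=
  inferInstanceAs (Module ℂ (F1Rep.IsoClass.{u, v} I →₀ ℂ))

noncomputable instance ExtHallAlgebra.instAddCommGroup : AddCommGroup (ExtHallAlgebra.{u, v} I) :=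
  inferInstanceAs (AddCommGroup (F1Rep.IsoClass.{u, v} I →₀ SymmetricAlgebra ℂ (HallCartan I)))

noncomputable instance ExtHallAlgebra.instModule : Module ℂ (ExtHallAlgebra.{u, v} I) :=
  inferInstanceAs (Module ℂ (F1Rep.IsoClass.{u, v} I →₀ SymmetricAlgebra ℂ (HallCartan I)))

/-- Elements of the Hall algebra are the finitely supported functions on isomorphism classes. -/
noncomputable def HallAlgebra.toFinsupp :
    HallAlgebra.{u, v} I ≃ₗ[ℂ] (F1Rep.IsoClass.{u, v} I →₀ ℂ) :=
  LinearEquiv.refl ℂ (F1Rep.IsoClass.{u, v} I →₀ ℂ)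

/-- Elements of the extended Hall algebra are the finitely supported functions on isomorphism
classes with values in `Sym(𝔥_Q)`. -/
noncomputable def ExtHallAlgebra.toFinsupp : ExtHallAlgebra.{u, v} I ≃ₗ[ℂ]
    (F1Rep.IsoClass.{u, v} I →₀ SymmetricAlgebra ℂ (HallCartan.{u, v} I)) :=
  LinearEquiv.refl ℂ (F1Rep.IsoClass.{u, v} I →₀ SymmetricAlgebra ℂ (HallCartan.{u, v} I))

variable {I}

/-- The delta function `[M]`. -/
noncomputable def HallAlgebra.of (X : F1Rep.IsoClass.{u, v} I) : HallAlgebra I :=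
  Finsupp.single X (1 : ℂ)

/-- The algebra endomorphism `Z ↦ Z - Z(α)` of `Sym(𝔥_Q)`. -/
noncomputable def symShift (α : F1Rep.K0.{u, v} I) :
    SymmetricAlgebra ℂ (HallCartan.{u, v} I) →ₐ[ℂ] SymmetricAlgebra ℂ (HallCartan.{u, v} I) :=
  SymmetricAlgebra.lift
    { toFun := fun Z => SymmetricAlgebra.ι ℂ _ Z - algebraMap ℂ _ (Z α)
      map_add' := fun Z W => by
        rw [map_add, AddMonoidHom.add_apply, map_add]; abel
      map_smul' := fun c Z => by
        rw [map_smul, RingHom.id_apply, smul_sub, AddMonoidHom.smul_apply, smul_eq_mul, map_mul,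
          Algebra.smul_def, Algebra.smul_def] }

theorem symShift_ι (α : F1Rep.K0.{u, v} I) (Z : HallCartan.{u, v} I) :
    symShift α (SymmetricAlgebra.ι ℂ _ Z) = SymmetricAlgebra.ι ℂ _ Z - algebraMap ℂ _ (Z α) :=
  SymmetricAlgebra.lift_ι_apply _ _

theorem symShift_zero : symShift (0 : F1Rep.K0.{u, v} I) = AlgHom.id ℂ _ := by
  refine SymmetricAlgebra.algHom_ext (LinearMap.ext fun Z => ?_)
  change symShift 0 (SymmetricAlgebra.ι ℂ _ Z) = SymmetricAlgebra.ι ℂ _ Z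
  rw [symShift_ι, map_zero, map_zero, sub_zero]

theorem symShift_add (α β : F1Rep.K0.{u, v} I) :
    symShift (α + β) = (symShift α).comp (symShift β) := by
  refine SymmetricAlgebra.algHom_ext (LinearMap.ext fun Z => ?_)
  change symShift (α + β) (SymmetricAlgebra.ι ℂ _ Z) =
    symShift α (symShift β (SymmetricAlgebra.ι ℂ _ Z))
  rw [symShift_ι, symShift_ι, map_sub, symShift_ι, map_add, map_add, AlgHom.commutes]
  abel

variable [Finite I] [∀ i j : I, Finite (i ⟶ j)]

/-- The Hall product `(f * g) M = ∑_{L ⊆ M} f (M / L) g L`. -/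
noncomputable instance HallAlgebra.instMul : Mul (HallAlgebra.{u, v} I) where
  mul f g := F1Rep.convolution (A := ℂ) (fun _ => RingHom.id ℂ) f g

theorem HallAlgebra.mul_apply (f g : HallAlgebra.{u, v} I) (X : F1Rep.IsoClass.{u, v} I) :
    HallAlgebra.toFinsupp I (f * g) X = ∑ L : F1Rep.Sub X.rep,
      HallAlgebra.toFinsupp I f (F1Rep.cls L.quot) *
        HallAlgebra.toFinsupp I g (F1Rep.cls L.rep) := rfl

noncomputable instance HallAlgebra.instRing : Ring (HallAlgebra.{u, v} I) :=
  { HallAlgebra.instAddCommGroup.{u, v} I with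
    mul := (· * ·)
    one := HallAlgebra.of (F1Rep.cls (F1Rep.zeroRep I))
    left_distrib := F1Rep.convolution_add_right (A := ℂ) _
    right_distrib := F1Rep.convolution_add_left (A := ℂ) _
    zero_mul := F1Rep.convolution_zero_left (A := ℂ) _
    mul_zero := F1Rep.convolution_zero_right (A := ℂ) _
    mul_assoc := F1Rep.convolution_assoc (A := ℂ) _ fun _ _ => rfl
    one_mul := F1Rep.convolution_one_left (A := ℂ) _ rfl
    mul_one := F1Rep.convolution_one_right (A := ℂ) _ }

noncomputable instance HallAlgebra.instAlgebra : Algebra ℂ (HallAlgebra.{u, v} I) :=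
  Algebra.ofModule
    (fun c f g => Finsupp.ext fun X => by
      change (∑ L : F1Rep.Sub X.rep, c * HallAlgebra.toFinsupp I f (F1Rep.cls L.quot) * _) =
        c * ∑ L : F1Rep.Sub X.rep, HallAlgebra.toFinsupp I f (F1Rep.cls L.quot) *
          HallAlgebra.toFinsupp I g (F1Rep.cls L.rep)
      rw [Finset.mul_sum]
      exact Finset.sum_congr rfl fun _ _ => mul_assoc _ _ _)
    (fun c f g => Finsupp.ext fun X => by
      change (∑ L : F1Rep.Sub X.rep, HallAlgebra.toFinsupp I f (F1Rep.cls L.quot) *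
          (c * HallAlgebra.toFinsupp I g (F1Rep.cls L.rep))) =
        c * ∑ L : F1Rep.Sub X.rep, HallAlgebra.toFinsupp I f (F1Rep.cls L.quot) *
          HallAlgebra.toFinsupp I g (F1Rep.cls L.rep)
      rw [Finset.mul_sum]
      exact Finset.sum_congr rfl fun _ _ => mul_left_comm _ _ _)

/-- The product of the extended Hall algebra. The relation `[Z, f] = Z(α) f` for `f` of degree `α`
says that `f` moves past `P ∈ Sym(𝔥_Q)` as `f P = (symShift α P) f`, so
`(P ⊗ [M]) (P' ⊗ [N]) = P (symShift [M] P') ⊗ [M] [N]`. -/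
noncomputable instance ExtHallAlgebra.instMul : Mul (ExtHallAlgebra.{u, v} I) where
  mul f g := F1Rep.convolution (A := SymmetricAlgebra ℂ (HallCartan.{u, v} I))
    (fun α => (symShift α).toRingHom) f g

theorem ExtHallAlgebra.mul_apply (f g : ExtHallAlgebra.{u, v} I) (X : F1Rep.IsoClass.{u, v} I) :
    ExtHallAlgebra.toFinsupp I (f * g) X = ∑ L : F1Rep.Sub X.rep,
      ExtHallAlgebra.toFinsupp I f (F1Rep.cls L.quot) *
        symShift (F1Rep.cls L.quot).k0 (ExtHallAlgebra.toFinsupp I g (F1Rep.cls L.rep)) := rfl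

noncomputable instance ExtHallAlgebra.instRing : Ring (ExtHallAlgebra.{u, v} I) :=
  { ExtHallAlgebra.instAddCommGroup.{u, v} I with
    mul := (· * ·)
    one := (Finsupp.single (F1Rep.cls (F1Rep.zeroRep I)) 1 :
      F1Rep.IsoClass.{u, v} I →₀ SymmetricAlgebra ℂ (HallCartan.{u, v} I))
    left_distrib := F1Rep.convolution_add_right (A := SymmetricAlgebra ℂ (HallCartan.{u, v} I)) _
    right_distrib := F1Rep.convolution_add_left (A := SymmetricAlgebra ℂ (HallCartan.{u, v} I)) _
    zero_mul := F1Rep.convolution_zero_left (A := SymmetricAlgebra ℂ (HallCartan.{u, v} I)) _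
    mul_zero := F1Rep.convolution_zero_right (A := SymmetricAlgebra ℂ (HallCartan.{u, v} I)) _
    mul_assoc := F1Rep.convolution_assoc (A := SymmetricAlgebra ℂ (HallCartan.{u, v} I)) _
      fun a b => RingHom.ext fun x => DFunLike.congr_fun (symShift_add a b) x
    one_mul := F1Rep.convolution_one_left (A := SymmetricAlgebra ℂ (HallCartan.{u, v} I)) _
      (RingHom.ext fun x => DFunLike.congr_fun symShift_zero x)
    mul_one := F1Rep.convolution_one_right (A := SymmetricAlgebra ℂ (HallCartan.{u, v} I)) _ }

noncomputable instance ExtHallAlgebra.instAlgebra : Algebra ℂ (ExtHallAlgebra.{u, v} I) :=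
  Algebra.ofModule
    (fun c f g => Finsupp.ext fun X => by
      change (∑ L : F1Rep.Sub X.rep, (c • ExtHallAlgebra.toFinsupp I f (F1Rep.cls L.quot)) * _) =
        c • ∑ L : F1Rep.Sub X.rep, ExtHallAlgebra.toFinsupp I f (F1Rep.cls L.quot) *
          symShift (F1Rep.cls L.quot).k0 (ExtHallAlgebra.toFinsupp I g (F1Rep.cls L.rep))
      rw [Finset.smul_sum]
      exact Finset.sum_congr rfl fun _ _ => smul_mul_assoc _ _ _)
    (fun c f g => Finsupp.ext fun X => by
      change (∑ L : F1Rep.Sub X.rep, ExtHallAlgebra.toFinsupp I f (F1Rep.cls L.quot) *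
          symShift (F1Rep.cls L.quot).k0
            (c • ExtHallAlgebra.toFinsupp I g (F1Rep.cls L.rep))) =
        c • ∑ L : F1Rep.Sub X.rep, ExtHallAlgebra.toFinsupp I f (F1Rep.cls L.quot) *
          symShift (F1Rep.cls L.quot).k0 (ExtHallAlgebra.toFinsupp I g (F1Rep.cls L.rep))
      rw [Finset.smul_sum]
      exact Finset.sum_congr rfl fun _ _ => by rw [map_smul, mul_smul_comm])

/-- The coproduct of the Hall algebra, `Δ f ([M], [N]) = f [M ⊕ N]`, where functions on pairs of
isomorphism classes are elements of the tensor square. -/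
noncomputable def HallAlgebra.comul :
    HallAlgebra.{u, v} I →ₗ[ℂ] HallAlgebra.{u, v} I ⊗[ℂ] HallAlgebra.{u, v} I :=
  (TensorProduct.congr (HallAlgebra.toFinsupp I) (HallAlgebra.toFinsupp I)).symm.toLinearMap ∘ₗ
    (finsuppTensorFinsupp' ℂ (F1Rep.IsoClass.{u, v} I) (F1Rep.IsoClass.{u, v} I)).symm.toLinearMap ∘ₗ
    { toFun := fun f => Finsupp.ofSupportFinite
        (fun p => HallAlgebra.toFinsupp I f (F1Rep.cls (F1Rep.sum p.1.rep p.2.rep))) (by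
          refine ((HallAlgebra.toFinsupp I f).support.finite_toSet.biUnion fun X _ =>
            (F1Rep.finite_dim_le X.dim).prod (F1Rep.finite_dim_le X.dim)).subset fun p hp => ?_
          refine Set.mem_biUnion (x := F1Rep.cls (F1Rep.sum p.1.rep p.2.rep))
            (Finset.mem_coe.2 (Finsupp.mem_support_iff.2 hp)) ?_
          rw [F1Rep.dim_cls]
          exact F1Rep.dimVec_le_sum p.1.rep p.2.rep)
      map_add' := fun _ _ => Finsupp.ext fun _ => rfl
      map_smul' := fun _ _ => Finsupp.ext fun _ => rfl }

/-- The inclusion `Sym(𝔥_Q) → H̃_Q`, `P ↦ P ⊗ 1`. -/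
noncomputable def ExtHallAlgebra.ofSym :
    SymmetricAlgebra ℂ (HallCartan.{u, v} I) →ₗ[ℂ] ExtHallAlgebra.{u, v} I :=
  (ExtHallAlgebra.toFinsupp I).symm.toLinearMap ∘ₗ
    Finsupp.lsingle (F1Rep.cls (F1Rep.zeroRep I))

/-- The inclusion `H_Q → H̃_Q`, `f ↦ 1 ⊗ f`. -/
noncomputable def ExtHallAlgebra.ofHall :
    HallAlgebra.{u, v} I →ₗ[ℂ] ExtHallAlgebra.{u, v} I :=
  (ExtHallAlgebra.toFinsupp I).symm.toLinearMap ∘ₗ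
    Finsupp.mapRange.linearMap (Algebra.linearMap ℂ _) ∘ₗ (HallAlgebra.toFinsupp I).toLinearMap

theorem ExtHallAlgebra.ofHall_of (X : F1Rep.IsoClass.{u, v} I) :
    ExtHallAlgebra.ofHall (HallAlgebra.of X) =
      (ExtHallAlgebra.toFinsupp I).symm (Finsupp.single X 1) := by
  change Finsupp.mapRange (Algebra.linearMap ℂ (SymmetricAlgebra ℂ (HallCartan I)))
    (LinearMap.map_zero _) (Finsupp.single X (1 : ℂ)) = Finsupp.single X 1
  rw [Finsupp.mapRange_single]
  exact congrArg _ (map_one (algebraMap ℂ _))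

theorem ExtHallAlgebra.ofSym_mul_ofHall (P : SymmetricAlgebra ℂ (HallCartan.{u, v} I))
    (X : F1Rep.IsoClass.{u, v} I) :
    ExtHallAlgebra.ofSym P * ExtHallAlgebra.ofHall (HallAlgebra.of X) =
      (ExtHallAlgebra.toFinsupp I).symm (Finsupp.single X P) := by
  rw [ExtHallAlgebra.ofHall_of]
  refine Eq.trans (F1Rep.convolution_single_left _ ?_ P _) ?_
  · exact RingHom.ext fun x => DFunLike.congr_fun symShift_zero x
  · exact (Finsupp.smul_single P X 1).trans (by rw [smul_eq_mul, mul_one]; rfl)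

/-- The defining relation `[Z, f] = Z(α) f` for `f` of degree `α`. -/
theorem ExtHallAlgebra.relation (Z : HallCartan.{u, v} I) (X : F1Rep.IsoClass.{u, v} I) :
    ExtHallAlgebra.ofSym (SymmetricAlgebra.ι ℂ _ Z) * ExtHallAlgebra.ofHall (HallAlgebra.of X) -
      ExtHallAlgebra.ofHall (HallAlgebra.of X) * ExtHallAlgebra.ofSym (SymmetricAlgebra.ι ℂ _ Z) =
      Z X.k0 • ExtHallAlgebra.ofHall (HallAlgebra.of X) := by
  have h : ExtHallAlgebra.ofHall (HallAlgebra.of X) *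
      ExtHallAlgebra.ofSym (SymmetricAlgebra.ι ℂ _ Z) = (ExtHallAlgebra.toFinsupp I).symm
        (Finsupp.single X (SymmetricAlgebra.ι ℂ _ Z - algebraMap ℂ _ (Z X.k0))) := by
    rw [ExtHallAlgebra.ofHall_of]
    refine Eq.trans (F1Rep.convolution_single_right _ X 1 _) ?_
    rw [one_mul]
    exact congrArg (Finsupp.single X) (symShift_ι X.k0 Z)
  rw [h, ExtHallAlgebra.ofSym_mul_ofHall, ExtHallAlgebra.ofHall_of, ← map_sub, ← map_smul,
    ← Finsupp.single_sub, sub_sub_cancel, Finsupp.smul_single, Algebra.algebraMap_eq_smul_one]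

/-- The coproduct of the extended Hall algebra: `Δ (P ⊗ f) = Δ P · Δ f`, with the elements of
`𝔥_Q` primitive. -/
noncomputable def ExtHallAlgebra.comul : ExtHallAlgebra.{u, v} I →ₗ[ℂ]
    ExtHallAlgebra.{u, v} I ⊗[ℂ] ExtHallAlgebra.{u, v} I :=
  (Finsupp.lsum ℂ fun X : F1Rep.IsoClass.{u, v} I =>
    (LinearMap.mulRight ℂ (TensorProduct.map ExtHallAlgebra.ofHall ExtHallAlgebra.ofHall
      (HallAlgebra.comul (HallAlgebra.of X)))) ∘ₗ
    TensorProduct.map ExtHallAlgebra.ofSym ExtHallAlgebra.ofSym ∘ₗ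
    Coalgebra.comul) ∘ₗ (ExtHallAlgebra.toFinsupp I).toLinearMap

/-- The counit of the extended Hall algebra: `P ⊗ [M] ↦ ε(P)` if `M = 0`, and `0` otherwise. -/
noncomputable def ExtHallAlgebra.counit : ExtHallAlgebra.{u, v} I →ₗ[ℂ] ℂ :=
  Coalgebra.counit ∘ₗ Finsupp.lapply (F1Rep.cls (F1Rep.zeroRep I)) ∘ₗ
    (ExtHallAlgebra.toFinsupp I).toLinearMap

end HallAlgebra

section KacMoody

variable (I : Type u) [Quiver.{v} I]

/-- The quiver is of type `A_n`: its underlying graph is the path with `n` vertices, so that after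
numbering the vertices by `0, …, n - 1` there is exactly one edge, in one direction or the other,
between consecutive vertices, and no other edge. -/
def IsTypeA [∀ i j : I, Finite (i ⟶ j)] (n : ℕ) : Prop :=
  ∃ σ : I ≃ Fin n, ∀ i j : I, Nat.card (i ⟶ j) + Nat.card (j ⟶ i) =
    if (σ i : ℕ) + 1 = σ j ∨ (σ j : ℕ) + 1 = σ i then 1 else 0

variable [DecidableEq I]

/-- The generalized Cartan matrix of the underlying graph of a quiver without loops. -/
noncomputable def quiverCartan : Matrix I I ℤ := fun i j =>
  if i = j then 2 else -((Nat.card (i ⟶ j) + Nat.card (j ⟶ i) : ℕ) : ℤ)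

/-- The Lie algebra with generators `h i`, `e i`, `f i` and the Serre relations. If the Cartan
matrix is nonsingular, as in type `A`, the `h i` are a basis of the Cartan subalgebra `𝔥` of its
realization, and this is the Kac-Moody algebra of the graph. -/
abbrev KacMoody : Type u := (quiverCartan I).ToLieAlgebra ℂ

variable {I}

/-- The image of a generator in the Kac-Moody algebra. -/
noncomputable def KacMoody.gen (x : CartanMatrix.Generators I) : KacMoody I :=
  LieSubmodule.Quotient.mk (N := CartanMatrix.Relations.toIdeal ℂ (quiverCartan I))
    (FreeLieAlgebra.of ℂ x)

variable (I)

/-- The subalgebra `𝔫₊` generated by the `e i`. -/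
noncomputable def nPlus : LieSubalgebra ℂ (KacMoody I) :=
  LieSubalgebra.lieSpan ℂ _ (Set.range fun i => KacMoody.gen (.E i))

/-- The derived Borel subalgebra `𝔟'`, generated by the `h i` and `𝔫₊`. -/
noncomputable def bPrime : LieSubalgebra ℂ (KacMoody I) :=
  LieSubalgebra.lieSpan ℂ _ ((Set.range fun i => KacMoody.gen (.H i)) ∪
    (Set.range fun i => KacMoody.gen (.E i)))

theorem nPlus_le_bPrime : nPlus I ≤ bPrime I :=
  LieSubalgebra.lieSpan_mono Set.subset_union_right

/-- The enveloping algebra `U(𝔫₊)`. -/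
abbrev UNPlus : Type u := UniversalEnvelopingAlgebra ℂ (nPlus I)

/-- The enveloping algebra `U(𝔟')`. -/
abbrev UBPrime : Type u := UniversalEnvelopingAlgebra ℂ (bPrime I)

variable {I}

/-- The generator `e i` of `U(𝔫₊)`. -/
noncomputable def UNPlus.e (i : I) : UNPlus I :=
  UniversalEnvelopingAlgebra.ι ℂ
    ⟨KacMoody.gen (.E i), LieSubalgebra.subset_lieSpan ⟨i, rfl⟩⟩

/-- The generator `e i` of `U(𝔟')`. -/
noncomputable def UBPrime.e (i : I) : UBPrime I :=
  UniversalEnvelopingAlgebra.ι ℂ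
    ⟨KacMoody.gen (.E i), LieSubalgebra.subset_lieSpan (Or.inr ⟨i, rfl⟩)⟩

/-- The generator `h i` of `U(𝔟')`. -/
noncomputable def UBPrime.h (i : I) : UBPrime I :=
  UniversalEnvelopingAlgebra.ι ℂ
    ⟨KacMoody.gen (.H i), LieSubalgebra.subset_lieSpan (Or.inl ⟨i, rfl⟩)⟩

attribute [local instance] LieRing.ofAssociativeRing

/-- The homomorphism `U(𝔫₊) → U(𝔟')` induced by the inclusion `𝔫₊ ⊆ 𝔟'`. -/
noncomputable def UNPlus.toUBPrime : UNPlus I →ₐ[ℂ] UBPrime I :=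
  UniversalEnvelopingAlgebra.lift ℂ
    ((UniversalEnvelopingAlgebra.ι ℂ).comp (LieSubalgebra.inclusion (nPlus_le_bPrime I)))

/-- The coproduct of an enveloping algebra, for which the elements of the Lie algebra are
primitive. -/
noncomputable def envelopingComul (L : Type*) [LieRing L] [LieAlgebra ℂ L] :
    UniversalEnvelopingAlgebra ℂ L →ₐ[ℂ]
      UniversalEnvelopingAlgebra ℂ L ⊗[ℂ] UniversalEnvelopingAlgebra ℂ L :=
  UniversalEnvelopingAlgebra.lift ℂ
    { toFun := fun x => UniversalEnvelopingAlgebra.ι ℂ x ⊗ₜ 1 + 1 ⊗ₜ UniversalEnvelopingAlgebra.ι ℂ x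
      map_add' := fun x y => by
        rw [map_add, TensorProduct.add_tmul, TensorProduct.tmul_add]; abel
      map_smul' := fun c x => by
        rw [map_smul, ← TensorProduct.smul_tmul', TensorProduct.tmul_smul, smul_add]; rfl
      map_lie' := fun {x y} => by
        simp only [LieHom.map_lie, LieRing.of_associative_ring_bracket, TensorProduct.sub_tmul,
          TensorProduct.tmul_sub, mul_add, add_mul, Algebra.TensorProduct.tmul_mul_tmul, one_mul,
          mul_one]
        abel }

/-- The counit of an enveloping algebra. -/
noncomputable def envelopingCounit (L : Type*) [LieRing L] [LieAlgebra ℂ L] :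
    UniversalEnvelopingAlgebra ℂ L →ₐ[ℂ] ℂ :=
  UniversalEnvelopingAlgebra.lift ℂ 0

/-- The element `Z i` of `𝔥_Q`, determined by `Z i [S j] = a j i`. -/
noncomputable def hallCoroot [Fintype I] (i : I) : HallCartan.{u, v} I :=
  ∑ j, (zmultiplesHom ℂ (quiverCartan I j i : ℂ)).comp (F1Rep.k0Dim j)

theorem hallCoroot_simple [Fintype I] (i j : I) :
    hallCoroot i (F1Rep.cls (F1Rep.simple j)).k0 = (quiverCartan I j i : ℂ) := by
  classical
  rw [hallCoroot, AddMonoidHom.finsetSum_apply, Finset.sum_eq_single j]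
  · simp [F1Rep.k0Dim_k0, F1Rep.dim_cls, F1Rep.dimVec_simple]
  · intro k _ hk
    simp [F1Rep.k0Dim_k0, F1Rep.dim_cls, F1Rep.dimVec_simple, hk]
  · exact fun h => (h (Finset.mem_univ _)).elim

/-- The integral form of `U(𝔫₊)`: the subring generated by the divided powers `e i ^ k / k!`. -/
noncomputable def kostantForm : Subring (UNPlus I) :=
  Subring.closure {x | ∃ (i : I) (k : ℕ), x = ((k.factorial : ℂ)⁻¹) • UNPlus.e i ^ k}

end KacMoody

/-! ### Enveloping algebras: an injectivity criterion for coalgebra morphisms -/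

section Enveloping

attribute [local instance] LieRing.ofAssociativeRing

open TensorProduct

variable (L : Type*) [LieRing L] [LieAlgebra ℂ L]

/-! The map ρ is built from generators. It is injective because it is a morphism of coalgebras out
of an enveloping algebra, and surjective because counting extensions shows that the simple classes
generate the Hall algebra. The statements about U(𝔫₊) follow by restriction.

Existence. A point of M ⊕ N over 𝔽₁ lies in M or in N, so the subrepresentations of M ⊕ N are
exactly the sums L ⊕ K (`subSumEquiv`). Hence the Hall coproduct is multiplicative
(`HallAlgebra.comul_mul`), and brackets of the primitive elements [S i] are primitive. A primitive
function vanishes on decomposable representations, and in type A every nonzero point lies in a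
direct summand whose dimension vector is the indicator of an interval (`exists_isFull_mem`). The
degrees of the Serre expressions are not of this form, so these expressions vanish
(`typeASerre_simple`). Since 𝔟' is given as a subalgebra of 𝔤 and not by a presentation, a
homomorphism out of it still has to be constructed. The h i and the iterated brackets `rootVec` span
𝔟', and their brackets with the generators are forced by the relations alone
(`TypeASerre.lie_rootVec`, `BorelRelations.lieSpan_le`). The natural representation by matrices
reads off coefficients with respect to this family, which defines `borelLinear` and then `borelHom`.

Injectivity. By `enveloping_injective`, a coalgebra morphism on U(L) is injective as soon as it is
injective on ℂ + L. If F x = 0, the reduced coproduct of x, which lies in lower filtration degree,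
is zero by induction. So x is primitive, and comparing the factors 2 and 2 ^ m of the map
"comultiply, then multiply" lowers the degree of x. On ℂ + 𝔟' injectivity means that the coroots and
the root vectors are independent in the extended Hall algebra (`linearIndependent_borelFamily`). The
root vectors are nonzero functions of distinct degrees, and the Cartan matrix is nonsingular.

Surjectivity. `HallAlgebra.of_mem_of_concentrated` is the combinatorial core: a subring of the Hall
algebra that contains the classes of all representations concentrated at one vertex contains every
class. The product [M / L] [L] is [M] plus other extensions if L is determined in M by the two
classes. The induction is on total dimension and then on the rank of the edge maps, which is
strictly larger for a nonsplit extension than for the direct sum. One splits off the largest summand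
whose edge maps on an interval are bijective; if this is all of M, one cuts M at the last edge of
the interval. The classes at one vertex are the divided powers of [S i] (`simple_pow`), so the same
statement yields both generation over ℂ and the integral form. In the Cartan part, a functional that
kills all [S i] commutes with the whole Hall algebra and is therefore zero (`hallCartan_ext`), so
the Z i span 𝔥_Q.

The basis of U(𝔫₊) is transported from the delta functions. Its structure constants are numbers of
subrepresentations, which makes them nonnegative integers. -/

theorem UniversalEnvelopingAlgebra.adjoin_range_ι :
    Algebra.adjoin ℂ (Set.range (UniversalEnvelopingAlgebra.ι ℂ : L → _)) = ⊤ := by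
  set S := Algebra.adjoin ℂ (Set.range (UniversalEnvelopingAlgebra.ι ℂ : L → _)) with hS
  let j : L →ₗ⁅ℂ⁆ S :=
    { toFun := fun x => ⟨UniversalEnvelopingAlgebra.ι ℂ x, Algebra.subset_adjoin ⟨x, rfl⟩⟩
      map_add' := fun x y => Subtype.ext (map_add _ x y)
      map_smul' := fun c x => Subtype.ext (map_smul _ c x)
      map_lie' := fun {x y} => Subtype.ext (LieHom.map_lie _ x y) }
  -- The universal property gives a homomorphism from the enveloping algebra to `S`. Followed by the
  -- inclusion it fixes the Lie algebra, so it is the identity and `S` is everything.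
  have h : S.val.comp (UniversalEnvelopingAlgebra.lift ℂ j) = AlgHom.id ℂ _ := by
    apply UniversalEnvelopingAlgebra.hom_ext
    ext x
    change ((UniversalEnvelopingAlgebra.lift ℂ j (UniversalEnvelopingAlgebra.ι ℂ x) : S) :
      UniversalEnvelopingAlgebra ℂ L) = UniversalEnvelopingAlgebra.ι ℂ x
    rw [UniversalEnvelopingAlgebra.lift_ι_apply]
    rfl
  rw [eq_top_iff]
  intro x _
  have := DFunLike.congr_fun h x
  change ((UniversalEnvelopingAlgebra.lift ℂ j x : S) : UniversalEnvelopingAlgebra ℂ L) = x at this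
  rw [← this]
  exact Subtype.property _

theorem envelopingComul_ι (x : L) : envelopingComul L (UniversalEnvelopingAlgebra.ι ℂ x) =
    UniversalEnvelopingAlgebra.ι ℂ x ⊗ₜ 1 + 1 ⊗ₜ UniversalEnvelopingAlgebra.ι ℂ x :=
  UniversalEnvelopingAlgebra.lift_ι_apply ℂ _ x

theorem envelopingCounit_ι (x : L) :
    envelopingCounit L (UniversalEnvelopingAlgebra.ι ℂ x) = 0 :=
  UniversalEnvelopingAlgebra.lift_ι_apply ℂ _ x

/-- The span of `1` and of the Lie algebra in its enveloping algebra. -/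
noncomputable def envelopingBase : Submodule ℂ (UniversalEnvelopingAlgebra ℂ L) :=
  1 ⊔ LinearMap.range (UniversalEnvelopingAlgebra.ι ℂ : L →ₗ⁅ℂ⁆ _).toLinearMap

theorem one_le_envelopingBase : 1 ≤ envelopingBase L := le_sup_left

theorem ι_mem_envelopingBase (x : L) : UniversalEnvelopingAlgebra.ι ℂ x ∈ envelopingBase L :=
  Submodule.mem_sup_right ⟨x, rfl⟩

theorem envelopingBase_pow_mono {m n : ℕ} (h : m ≤ n) :
    envelopingBase L ^ m ≤ envelopingBase L ^ n :=
  pow_le_pow_right₀ (one_le_envelopingBase L) h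

theorem one_mem_envelopingBase_pow (n : ℕ) : 1 ∈ envelopingBase L ^ n :=
  envelopingBase_pow_mono L (Nat.zero_le n) (by rw [pow_zero]; exact Submodule.one_le.1 le_rfl)

theorem exists_mem_envelopingBase_pow (x : UniversalEnvelopingAlgebra ℂ L) :
    ∃ n, x ∈ envelopingBase L ^ n := by
  have hx : x ∈ Algebra.adjoin ℂ (Set.range (UniversalEnvelopingAlgebra.ι ℂ : L → _)) := by
    rw [UniversalEnvelopingAlgebra.adjoin_range_ι]; trivial
  induction hx using Algebra.adjoin_induction with
  | mem x hx =>
    obtain ⟨y, rfl⟩ := hx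
    exact ⟨1, by rw [pow_one]; exact ι_mem_envelopingBase L y⟩
  | algebraMap r => exact ⟨0, by rw [pow_zero]; exact Submodule.algebraMap_mem r⟩
  | add x y _ _ hx hy =>
    obtain ⟨m, hm⟩ := hx
    obtain ⟨n, hn⟩ := hy
    exact ⟨max m n, add_mem (envelopingBase_pow_mono L (le_max_left _ _) hm)
      (envelopingBase_pow_mono L (le_max_right _ _) hn)⟩
  | mul x y _ _ hx hy =>
    obtain ⟨m, hm⟩ := hx
    obtain ⟨n, hn⟩ := hy
    exact ⟨m + n, by rw [pow_add]; exact Submodule.mul_mem_mul hm hn⟩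

variable {L}

theorem envelopingBase_cases {v : UniversalEnvelopingAlgebra ℂ L} (hv : v ∈ envelopingBase L) :
    ∃ (c : ℂ) (y : L), v = algebraMap ℂ _ c + UniversalEnvelopingAlgebra.ι ℂ y := by
  obtain ⟨a, ha, b, ⟨y, rfl⟩, rfl⟩ := Submodule.mem_sup.1 hv
  obtain ⟨c, rfl⟩ := Submodule.mem_one.1 ha
  exact ⟨c, y, rfl⟩

/-- Commutation with `y` is a derivation that sends each Lie algebra factor `z` to `⁅z, y⁆`, again a
Lie algebra element, so the length of a product does not grow. -/
theorem commutator_mem_envelopingBase_pow {n : ℕ} {x : UniversalEnvelopingAlgebra ℂ L}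
    (hx : x ∈ envelopingBase L ^ n) (y : L) :
    x * UniversalEnvelopingAlgebra.ι ℂ y - UniversalEnvelopingAlgebra.ι ℂ y * x ∈
      envelopingBase L ^ n := by
  induction n generalizing x with
  | zero =>
    rw [pow_zero] at hx
    obtain ⟨c, rfl⟩ := Submodule.mem_one.1 hx
    rw [Algebra.commutes, sub_self]
    exact zero_mem _
  | succ n ih =>
    rw [pow_succ'] at hx
    induction hx using Submodule.mul_induction_on' with
    | mem_mul_mem v hv x hx =>
      obtain ⟨c, z, rfl⟩ := envelopingBase_cases hv
      have e : (algebraMap ℂ _ c + UniversalEnvelopingAlgebra.ι ℂ z) * x *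
          UniversalEnvelopingAlgebra.ι ℂ y - UniversalEnvelopingAlgebra.ι ℂ y *
          ((algebraMap ℂ _ c + UniversalEnvelopingAlgebra.ι ℂ z) * x) =
          (algebraMap ℂ _ c + UniversalEnvelopingAlgebra.ι ℂ z) *
            (x * UniversalEnvelopingAlgebra.ι ℂ y - UniversalEnvelopingAlgebra.ι ℂ y * x) +
          UniversalEnvelopingAlgebra.ι ℂ ⁅z, y⁆ * x := by
        rw [LieHom.map_lie, LieRing.of_associative_ring_bracket]
        simp only [add_mul, mul_add, sub_mul, mul_sub, mul_assoc, ← Algebra.smul_def,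
          mul_smul_comm, smul_mul_assoc]
        abel
      rw [e, pow_succ']
      exact add_mem (Submodule.mul_mem_mul hv (ih hx))
        (Submodule.mul_mem_mul (ι_mem_envelopingBase L _) hx)
    | add x _ y _ hx hy =>
      convert add_mem hx hy using 1
      rw [add_mul, mul_add]; abel

/-- The degree `n` part of the filtration of the tensor square of an enveloping algebra. -/
def envelopingTensorFiltration (L : Type*) [LieRing L] [LieAlgebra ℂ L] (n : ℕ) : Submodule ℂ
    (UniversalEnvelopingAlgebra ℂ L ⊗[ℂ] UniversalEnvelopingAlgebra ℂ L) :=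
  Submodule.span ℂ {t | ∃ i j, i + j = n ∧ ∃ a ∈ envelopingBase L ^ i, ∃ b ∈ envelopingBase L ^ j,
    t = a ⊗ₜ b}

theorem envelopingComul_mem {n : ℕ} {x : UniversalEnvelopingAlgebra ℂ L}
    (hx : x ∈ envelopingBase L ^ n) :
    envelopingComul L x ∈ envelopingTensorFiltration L n := by
  induction n generalizing x with
  | zero =>
    rw [pow_zero] at hx
    obtain ⟨c, rfl⟩ := Submodule.mem_one.1 hx
    rw [AlgHom.commutes, Algebra.algebraMap_eq_smul_one]
    exact Submodule.smul_mem _ _ (Submodule.subset_span ⟨0, 0, rfl, 1,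
      one_mem_envelopingBase_pow L 0, 1, one_mem_envelopingBase_pow L 0, rfl⟩)
  | succ n ih =>
    rw [pow_succ'] at hx
    induction hx using Submodule.mul_induction_on' with
    | mem_mul_mem v hv x hx =>
      rw [map_mul]
      have h := ih hx
      generalize envelopingComul L x = t at h
      induction h using Submodule.span_induction with
      | mem t ht =>
        obtain ⟨i, j, hij, a, ha, b, hb, rfl⟩ := ht
        obtain ⟨c, z, rfl⟩ := envelopingBase_cases hv
        rw [map_add, AlgHom.commutes, envelopingComul_ι, add_mul, add_mul, ← Algebra.smul_def,
          Algebra.TensorProduct.tmul_mul_tmul, Algebra.TensorProduct.tmul_mul_tmul, one_mul,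
          one_mul]
        refine add_mem (Submodule.smul_mem _ _ (Submodule.subset_span
          ⟨i + 1, j, by omega, a, envelopingBase_pow_mono L (Nat.le_succ i) ha, b, hb, rfl⟩))
          (add_mem (Submodule.subset_span ⟨i + 1, j, by omega, _, ?_, b, hb, rfl⟩)
          (Submodule.subset_span ⟨i, j + 1, by omega, a, ha, _, ?_, rfl⟩)) <;>
        · rw [pow_succ']; exact Submodule.mul_mem_mul (ι_mem_envelopingBase L z) ‹_›
      | zero => rw [mul_zero]; exact zero_mem _
      | add s t _ _ hs ht => rw [mul_add]; exact add_mem hs ht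
      | smul c t _ ht => rw [mul_smul_comm]; exact Submodule.smul_mem _ _ ht
    | add x _ y _ hx hy => rw [map_add]; exact add_mem hx hy

theorem mul'_mem_envelopingBase_pow {n : ℕ}
    {t : UniversalEnvelopingAlgebra ℂ L ⊗[ℂ] UniversalEnvelopingAlgebra ℂ L}
    (ht : t ∈ envelopingTensorFiltration L n) : LinearMap.mul' ℂ _ t ∈ envelopingBase L ^ n := by
  induction ht using Submodule.span_induction with
  | mem t ht =>
    obtain ⟨i, j, hij, a, ha, b, hb, rfl⟩ := ht
    rw [LinearMap.mul'_apply, ← hij, pow_add]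
    exact Submodule.mul_mem_mul ha hb
  | zero => rw [map_zero]; exact zero_mem _
  | add s t _ _ hs ht => rw [map_add]; exact add_mem hs ht
  | smul c t _ ht => rw [map_smul]; exact Submodule.smul_mem _ _ ht

/-- Moving `y` past the left tensor factor costs only a commutator, which does not raise the degree.
Up to lower order both summands of `Δ y` therefore act, after multiplication, as left multiplication
by `y`. -/
theorem mul'_one_tmul_mul_sub_mem {n : ℕ}
    {t : UniversalEnvelopingAlgebra ℂ L ⊗[ℂ] UniversalEnvelopingAlgebra ℂ L}
    (ht : t ∈ envelopingTensorFiltration L n) (y : L) :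
    LinearMap.mul' ℂ _ ((1 ⊗ₜ UniversalEnvelopingAlgebra.ι ℂ y) * t) -
      UniversalEnvelopingAlgebra.ι ℂ y * LinearMap.mul' ℂ _ t ∈ envelopingBase L ^ n := by
  induction ht using Submodule.span_induction with
  | mem t ht =>
    obtain ⟨i, j, hij, a, ha, b, hb, rfl⟩ := ht
    rw [Algebra.TensorProduct.tmul_mul_tmul, LinearMap.mul'_apply, LinearMap.mul'_apply, one_mul,
      ← mul_assoc, ← mul_assoc, ← sub_mul, ← hij, pow_add]
    exact Submodule.mul_mem_mul (commutator_mem_envelopingBase_pow ha y) hb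
  | zero => simp
  | add s t _ _ hs ht =>
    convert add_mem hs ht using 1
    rw [mul_add, map_add, map_add, mul_add]; abel
  | smul c t _ ht =>
    convert Submodule.smul_mem _ c ht using 1
    rw [mul_smul_comm, map_smul, map_smul, mul_smul_comm, smul_sub]

theorem mul'_tmul_one_mul (y : UniversalEnvelopingAlgebra ℂ L)
    (t : UniversalEnvelopingAlgebra ℂ L ⊗[ℂ] UniversalEnvelopingAlgebra ℂ L) :
    LinearMap.mul' ℂ _ ((y ⊗ₜ 1) * t) = y * LinearMap.mul' ℂ _ t := by
  induction t using TensorProduct.induction_on with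
  | zero => simp
  | tmul a b =>
    rw [Algebra.TensorProduct.tmul_mul_tmul, LinearMap.mul'_apply, LinearMap.mul'_apply, one_mul,
      mul_assoc]
  | add s t hs ht => rw [mul_add, map_add, hs, ht, map_add, mul_add]

/-- Comultiplication followed by multiplication is multiplication by `2 ^ n` on the `n`-th graded
piece of the standard filtration. -/
theorem mul'_envelopingComul_sub_mem {n : ℕ} {x : UniversalEnvelopingAlgebra ℂ L}
    (hx : x ∈ envelopingBase L ^ (n + 1)) :
    LinearMap.mul' ℂ _ (envelopingComul L x) - (2 : ℂ) ^ (n + 1) • x ∈ envelopingBase L ^ n := by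
  induction n generalizing x with
  | zero =>
    rw [zero_add, pow_one] at hx
    obtain ⟨c, y, rfl⟩ := envelopingBase_cases hx
    rw [map_add, AlgHom.commutes, envelopingComul_ι, Algebra.algebraMap_eq_smul_one,
      Algebra.algebraMap_eq_smul_one, map_add, map_add, map_smul, Algebra.TensorProduct.one_def,
      LinearMap.mul'_apply, LinearMap.mul'_apply, LinearMap.mul'_apply, mul_one, mul_one, one_mul,
      zero_add, pow_one, two_smul]
    convert Submodule.smul_mem _ (-c) (one_mem_envelopingBase_pow L 0) using 1
    rw [neg_smul]; abel
  | succ n ih =>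
    rw [pow_succ'] at hx
    induction hx using Submodule.mul_induction_on' with
    | mem_mul_mem w hw x hx =>
      have hψ := mul'_mem_envelopingBase_pow (envelopingComul_mem hx)
      obtain ⟨c, y, rfl⟩ := envelopingBase_cases hw
      -- Modulo `envelopingBase L ^ (n + 1)` each of the two summands of `Δ y` contributes `y` times
      -- the value at `x`, which accounts for one more factor 2.
      have e : LinearMap.mul' ℂ _ (envelopingComul L ((algebraMap ℂ _ c +
            UniversalEnvelopingAlgebra.ι ℂ y) * x)) - (2 : ℂ) ^ (n + 2) •
            ((algebraMap ℂ _ c + UniversalEnvelopingAlgebra.ι ℂ y) * x) =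
          c • LinearMap.mul' ℂ _ (envelopingComul L x) - (2 : ℂ) ^ (n + 2) • c • x +
          (LinearMap.mul' ℂ _ ((1 ⊗ₜ UniversalEnvelopingAlgebra.ι ℂ y) * envelopingComul L x) -
            UniversalEnvelopingAlgebra.ι ℂ y * LinearMap.mul' ℂ _ (envelopingComul L x)) +
          (2 : ℂ) • (UniversalEnvelopingAlgebra.ι ℂ y *
            (LinearMap.mul' ℂ _ (envelopingComul L x) - (2 : ℂ) ^ (n + 1) • x)) := by
        rw [map_mul, map_add, AlgHom.commutes, envelopingComul_ι, add_mul, add_mul, map_add,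
          map_add, mul'_tmul_one_mul, ← Algebra.smul_def, map_smul, add_mul, ← Algebra.smul_def,
          mul_sub, mul_smul_comm, smul_sub, smul_smul (2 : ℂ) (2 ^ (n + 1)), smul_add,
          ← pow_succ', two_smul]
        abel
      rw [e]
      refine add_mem (add_mem (sub_mem (Submodule.smul_mem _ _ hψ) (Submodule.smul_mem _ _
        (Submodule.smul_mem _ _ hx))) (mul'_one_tmul_mul_sub_mem (envelopingComul_mem hx) y))
        (Submodule.smul_mem _ _ ?_)
      rw [pow_succ']
      exact Submodule.mul_mem_mul (ι_mem_envelopingBase L y) (ih hx)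
    | add x _ y _ hx hy =>
      convert add_mem hx hy using 1
      rw [map_add, map_add, smul_add]; abel

theorem tmul_mem_range_map_subtype {n : ℕ} {a b : UniversalEnvelopingAlgebra ℂ L}
    (ha : a ∈ envelopingBase L ^ n) (hb : b ∈ envelopingBase L ^ n) :
    a ⊗ₜ[ℂ] b ∈ LinearMap.range (TensorProduct.map
      (envelopingBase L ^ n).subtype (envelopingBase L ^ n).subtype) :=
  ⟨(⟨a, ha⟩ : ↥(envelopingBase L ^ n)) ⊗ₜ (⟨b, hb⟩ : ↥(envelopingBase L ^ n)),
    TensorProduct.map_tmul _ _ _ _⟩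

/-- In the coproduct of a product of Lie algebra elements, every term except the two extreme ones
distributes the factors into two nonempty groups, so both tensor factors drop in degree. The
conclusion is an image of a tensor square, rather than a span, so that injectivity on the lower
filtration step can be tensored with itself. -/
theorem envelopingComul_sub_mem {n : ℕ} {x : UniversalEnvelopingAlgebra ℂ L}
    (hx : x ∈ envelopingBase L ^ (n + 1)) :
    envelopingComul L x - x ⊗ₜ 1 - 1 ⊗ₜ x ∈ LinearMap.range (TensorProduct.map
      (envelopingBase L ^ n).subtype (envelopingBase L ^ n).subtype) := by
  induction n generalizing x with
  | zero =>
    rw [zero_add, pow_one] at hx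
    obtain ⟨c, y, rfl⟩ := envelopingBase_cases hx
    have e : envelopingComul L (algebraMap ℂ _ c + UniversalEnvelopingAlgebra.ι ℂ y) -
        (algebraMap ℂ _ c + UniversalEnvelopingAlgebra.ι ℂ y) ⊗ₜ 1 -
        1 ⊗ₜ (algebraMap ℂ _ c + UniversalEnvelopingAlgebra.ι ℂ y) = - (c • (1 ⊗ₜ 1)) := by
      rw [map_add, AlgHom.commutes, envelopingComul_ι, add_tmul, tmul_add,
        Algebra.algebraMap_eq_smul_one, Algebra.algebraMap_eq_smul_one, tmul_smul,
        Algebra.TensorProduct.one_def, ← smul_tmul']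
      abel
    rw [e]
    exact neg_mem (Submodule.smul_mem _ _ (tmul_mem_range_map_subtype
      (one_mem_envelopingBase_pow L 0) (one_mem_envelopingBase_pow L 0)))
  | succ n ih =>
    rw [pow_succ'] at hx
    induction hx using Submodule.mul_induction_on' with
    | mem_mul_mem w hw x hx =>
      have hx' : x ∈ envelopingBase L ^ (n + 1) := hx
      obtain ⟨t, ht⟩ := ih hx
      -- Multiplication by `Δ w` raises the degree of each tensor factor by at most one.
      have key : ∀ t, envelopingComul L w * TensorProduct.map
          (envelopingBase L ^ n).subtype (envelopingBase L ^ n).subtype t ∈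
          LinearMap.range (TensorProduct.map
          (envelopingBase L ^ (n + 1)).subtype (envelopingBase L ^ (n + 1)).subtype) := by
        intro t
        induction t using TensorProduct.induction_on with
        | zero => rw [map_zero, mul_zero]; exact zero_mem _
        | tmul a b =>
          obtain ⟨c, y, rfl⟩ := envelopingBase_cases hw
          have ha := envelopingBase_pow_mono L (Nat.le_succ n) a.2
          have hb := envelopingBase_pow_mono L (Nat.le_succ n) b.2
          rw [TensorProduct.map_tmul, map_add, AlgHom.commutes, envelopingComul_ι, add_mul,
            add_mul, ← Algebra.smul_def, Algebra.TensorProduct.tmul_mul_tmul,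
            Algebra.TensorProduct.tmul_mul_tmul, one_mul, one_mul]
          refine add_mem (Submodule.smul_mem _ _ (tmul_mem_range_map_subtype ha hb))
            (add_mem (tmul_mem_range_map_subtype ?_ hb) (tmul_mem_range_map_subtype ha ?_)) <;>
          · rw [pow_succ']; exact Submodule.mul_mem_mul (ι_mem_envelopingBase L y) (Subtype.prop _)
        | add s t hs ht => rw [map_add, mul_add]; exact add_mem hs ht
      have e : envelopingComul L x = TensorProduct.map
          (envelopingBase L ^ n).subtype (envelopingBase L ^ n).subtype t + x ⊗ₜ 1 + 1 ⊗ₜ x := by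
        rw [ht]; abel
      obtain ⟨c, y, rfl⟩ := envelopingBase_cases hw
      have e2 : envelopingComul L ((algebraMap ℂ _ c + UniversalEnvelopingAlgebra.ι ℂ y) * x) -
          ((algebraMap ℂ _ c + UniversalEnvelopingAlgebra.ι ℂ y) * x) ⊗ₜ 1 -
          1 ⊗ₜ ((algebraMap ℂ _ c + UniversalEnvelopingAlgebra.ι ℂ y) * x) =
          envelopingComul L (algebraMap ℂ _ c + UniversalEnvelopingAlgebra.ι ℂ y) *
            TensorProduct.map (envelopingBase L ^ n).subtype (envelopingBase L ^ n).subtype t +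
          (UniversalEnvelopingAlgebra.ι ℂ y ⊗ₜ x + x ⊗ₜ UniversalEnvelopingAlgebra.ι ℂ y) := by
        rw [map_mul, e, mul_add, mul_add, map_add, AlgHom.commutes, envelopingComul_ι]
        simp only [add_mul, add_tmul, tmul_add, Algebra.TensorProduct.tmul_mul_tmul, one_mul,
          mul_one, ← Algebra.smul_def, smul_tmul', tmul_smul]
        abel
      rw [e2]
      have hy := envelopingBase_pow_mono L (Nat.le_add_left 1 n)
        (by rw [pow_one]; exact ι_mem_envelopingBase L y)
      exact add_mem (key t) (add_mem (tmul_mem_range_map_subtype hy hx')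
        (tmul_mem_range_map_subtype hx' hy))
    | add x _ y _ hx hy =>
      convert add_mem hx hy using 1
      rw [map_add, add_tmul, tmul_add]; abel

/-- A morphism of coalgebras out of an enveloping algebra is injective as soon as it is injective
on scalars and elements of the Lie algebra. -/
theorem enveloping_injective {A : Type*} [AddCommGroup A] [Module ℂ A]
    (F : UniversalEnvelopingAlgebra ℂ L →ₗ[ℂ] A) (D : A →ₗ[ℂ] A ⊗[ℂ] A)
    (hD : ∀ x, D (F x) = TensorProduct.map F F (envelopingComul L x))
    (hF : ∀ (c : ℂ) (y : L), F (algebraMap ℂ _ c + UniversalEnvelopingAlgebra.ι ℂ y) = 0 →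
      algebraMap ℂ (UniversalEnvelopingAlgebra ℂ L) c + UniversalEnvelopingAlgebra.ι ℂ y = 0) :
    Function.Injective F := by
  have key : ∀ n, ∀ x ∈ envelopingBase L ^ (n + 1), F x = 0 → x = 0 := by
    intro n
    induction n with
    | zero =>
      intro x hx h
      rw [zero_add, pow_one] at hx
      obtain ⟨c, y, rfl⟩ := envelopingBase_cases hx
      exact hF c y h
    | succ n ih =>
      intro x hx h
      -- The reduced coproduct of `x` comes from some `t` over the lower filtration step. There `F`
      -- is injective by induction, hence `F ⊗ F` is injective by flatness. Since `F x = 0`, this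
      -- forces `t = 0`, so `x` is primitive.
      obtain ⟨t, ht⟩ := envelopingComul_sub_mem hx
      have hinj : Function.Injective (F ∘ₗ (envelopingBase L ^ (n + 1)).subtype) := by
        rw [injective_iff_map_eq_zero]
        exact fun z hz => Subtype.ext (ih z.1 z.2 hz)
      have h0 : TensorProduct.map F F (envelopingComul L x - x ⊗ₜ 1 - 1 ⊗ₜ x) = 0 := by
        rw [map_sub, map_sub, ← hD, h, map_zero, TensorProduct.map_tmul, TensorProduct.map_tmul, h,
          zero_tmul, tmul_zero, sub_zero, sub_zero]
      have ht0 : t = 0 := by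
        rw [← ht, ← LinearMap.comp_apply, ← TensorProduct.map_comp] at h0
        exact (injective_iff_map_eq_zero _).1
          (TensorProduct.map_injective_of_flat_flat _ _ hinj hinj) t h0
      rw [ht0, map_zero] at ht
      have hp : envelopingComul L x = x ⊗ₜ 1 + 1 ⊗ₜ x := by
        rw [← sub_eq_zero, ← sub_sub]; exact ht.symm
      -- For a primitive element the composite of coproduct and product is multiplication by 2, but
      -- in filtration degree `n + 2` it is multiplication by `2 ^ (n + 2)` modulo lower degree. The
      -- two constants differ, so `x` lies in the lower step.
      have h2 : (2 : ℂ) • x - (2 : ℂ) ^ (n + 2) • x ∈ envelopingBase L ^ (n + 1) := by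
        have h := mul'_envelopingComul_sub_mem hx
        rwa [hp, map_add, LinearMap.mul'_apply, LinearMap.mul'_apply, mul_one, one_mul,
          ← two_smul ℂ x] at h
      refine ih x ?_ h
      rw [← sub_smul] at h2
      have hc : (2 : ℂ) - 2 ^ (n + 2) ≠ 0 := by
        rw [sub_ne_zero]
        norm_cast
        rw [pow_succ, pow_succ]
        have := Nat.one_le_two_pow (n := n)
        omega
      exact (Submodule.smul_mem_iff _ hc).1 h2
  rw [injective_iff_map_eq_zero]
  intro x hx
  obtain ⟨n, hn⟩ := exists_mem_envelopingBase_pow L x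
  exact key n x (envelopingBase_pow_mono L (Nat.le_succ n) hn) hx

end Enveloping

/-! ### Root vectors in type A, from the Serre relations alone -/

section RootVectors

variable {L : Type*} [LieRing L]

/-- The iterated bracket `[e a, [e (a + 1), …, e (a + l)]]`. -/
def rootVec (e : ℕ → L) : ℕ → ℕ → L
  | a, 0 => e a
  | a, l + 1 => ⁅e a, rootVec e (a + 1) l⁆

/-- The relations between the positive Chevalley generators in type `A`. -/
structure TypeASerre (e : ℕ → L) : Prop where
  comm : ∀ i j, i + 2 ≤ j → ⁅e i, e j⁆ = 0
  serre : ∀ i, ⁅e i, ⁅e i, e (i + 1)⁆⁆ = 0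
  serre' : ∀ i, ⁅e (i + 1), ⁅e (i + 1), e i⁆⁆ = 0

variable {e : ℕ → L}

theorem map_rootVec {L' : Type*} [LieRing L'] (f : L → L') (hf : ∀ x y, f ⁅x, y⁆ = ⁅f x, f y⁆)
    (a l : ℕ) : f (rootVec e a l) = rootVec (fun i => f (e i)) a l := by
  induction l generalizing a with
  | zero => rfl
  | succ l ih => rw [rootVec, rootVec, hf, ih]

theorem rootVec_eq_zero {n : ℕ} (he : ∀ i, n ≤ i → e i = 0) {a l : ℕ} (h : n ≤ a + l) :
    rootVec e a l = 0 := by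
  induction l generalizing a with
  | zero => exact he a h
  | succ l ih => rw [rootVec, ih (by omega), lie_zero]

namespace TypeASerre

theorem comm' (he : TypeASerre e) {i j : ℕ} (h : j + 2 ≤ i) : ⁅e i, e j⁆ = 0 := by
  rw [← lie_skew, he.comm j i h, neg_zero]

theorem lie_rootVec_of_le (he : TypeASerre e) {i a : ℕ} (l : ℕ) (h : i + 2 ≤ a) :
    ⁅e i, rootVec e a l⁆ = 0 := by
  induction l generalizing a with
  | zero => exact he.comm i a h
  | succ l ih =>
    rw [rootVec, leibniz_lie, ih (by omega), he.comm i a h, zero_lie, lie_zero, add_zero]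

theorem lie_rootVec_of_ge (he : TypeASerre e) {i a l : ℕ} (h : a + l + 2 ≤ i) :
    ⁅e i, rootVec e a l⁆ = 0 := by
  induction l generalizing a with
  | zero => exact he.comm' h
  | succ l ih =>
    rw [rootVec, leibniz_lie, ih (by omega), he.comm' (by omega), zero_lie, lie_zero, add_zero]

theorem lie_rootVec_last (he : TypeASerre e) (a l : ℕ) :
    ⁅e (a + l + 1), rootVec e a l⁆ = -rootVec e a (l + 1) := by
  induction l generalizing a with
  | zero => exact (lie_skew _ _).symm
  | succ l ih =>
    have := ih (a + 1)
    rw [show a + 1 + l + 1 = a + (l + 1) + 1 by omega] at this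
    rw [rootVec, leibniz_lie, this, he.comm' (by omega), zero_lie, zero_add, lie_neg]
    rfl

/-- As `e a` commutes with the tail `y` that starts at `a + 2`, the root vector equals `⁅⁅e a, e (a
+ 1)⁆, y⁆`, and a single Serre relation suffices. -/
theorem lie_rootVec_first (he : TypeASerre e) (a l : ℕ) : ⁅e a, rootVec e a l⁆ = 0 := by
  match l with
  | 0 => exact lie_self _
  | 1 => exact he.serre a
  | l + 2 =>
    have h : rootVec e a (l + 2) = ⁅⁅e a, e (a + 1)⁆, rootVec e (a + 2) l⁆ := by
      rw [rootVec, rootVec, leibniz_lie, he.lie_rootVec_of_le l (by omega), lie_zero, add_zero]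
    rw [h, leibniz_lie, he.serre, zero_lie, he.lie_rootVec_of_le l (by omega), lie_zero, add_zero]

theorem lie_rootVec_end (he : TypeASerre e) (a l : ℕ) :
    ⁅e (a + l), rootVec e a l⁆ = 0 := by
  induction l generalizing a with
  | zero => exact lie_self _
  | succ l ih =>
    rcases l with - | l
    · rw [rootVec, rootVec, ← lie_skew (e a), lie_neg]
      exact neg_eq_zero.2 (he.serre' a)
    · have := ih (a + 1)
      rw [show a + 1 + (l + 1) = a + (l + 1 + 1) by omega] at this
      rw [rootVec, leibniz_lie, this, he.comm' (by omega), zero_lie, lie_zero, add_zero]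

/-- Let `y` be the tail from `a + 2` on. Expanding `⁅⁅e (a + 1), ⁅e (a + 1), e a⁆⁆, y⁆ = 0` by the
Jacobi identity leaves twice the required bracket, up to sign. Dividing by 2 is what the complex
structure is for. -/
theorem lie_rootVec_second (he : TypeASerre e) [Module ℂ L] (a l : ℕ) :
    ⁅e (a + 1), rootVec e a (l + 2)⁆ = 0 := by
  set y := rootVec e (a + 2) l with hy
  have h1 : ⁅e a, y⁆ = 0 := he.lie_rootVec_of_le l le_rfl
  have h2 : ⁅e (a + 1), ⁅e (a + 1), y⁆⁆ = 0 := he.lie_rootVec_first (a + 1) (l + 1)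
  have h3 := he.serre' a
  have h4 : ⁅⁅e (a + 1), ⁅e (a + 1), e a⁆⁆, y⁆ = 0 := by rw [h3, zero_lie]
  simp only [lie_lie, h1, h2, lie_zero, sub_zero, zero_sub] at h4
  rw [lie_neg, sub_eq_add_neg, ← neg_add, neg_eq_zero, ← two_smul ℂ] at h4
  exact (smul_eq_zero.1 h4).resolve_left two_ne_zero

/-- Initial factors that commute with `e i` are peeled off until `i` is the first or the second
index of the root vector. -/
theorem lie_rootVec_mid (he : TypeASerre e) [Module ℂ L] {i a l : ℕ} (h1 : a ≤ i)
    (h2 : i ≤ a + l) : ⁅e i, rootVec e a l⁆ = 0 := by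
  induction l generalizing a with
  | zero =>
    obtain rfl : i = a := by omega
    exact lie_self _
  | succ l ih =>
    rcases h1.eq_or_lt with rfl | h
    · exact he.lie_rootVec_first _ _
    rcases (show a + 1 ≤ i by omega).eq_or_lt with rfl | h'
    · rcases l with - | l
      · exact he.lie_rootVec_end a 1
      · exact he.lie_rootVec_second a l
    · rw [rootVec, leibniz_lie, ih (by omega) (by omega), he.comm' (by omega), zero_lie, lie_zero,
        add_zero]

/-- The bracket of a generator with a root vector. -/
theorem lie_rootVec (he : TypeASerre e) [Module ℂ L] (i a l : ℕ) :
    ⁅e i, rootVec e a l⁆ = if i + 1 = a then rootVec e i (l + 1) else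
      if i = a + l + 1 then -rootVec e a (l + 1) else 0 := by
  split_ifs with h1 h2
  · subst h1; rfl
  · subst h2; exact he.lie_rootVec_last a l
  · rcases Nat.lt_or_ge (i + 1) a with h | h
    · exact he.lie_rootVec_of_le l h
    rcases Nat.lt_or_ge (a + l + 1) i with h' | h'
    · exact he.lie_rootVec_of_ge h'
    · exact he.lie_rootVec_mid (by omega) (by omega)

end TypeASerre

/-- A weight vector for `h` that is a sum of weights. -/
theorem lie_rootVec_weight [LieAlgebra ℂ L] (h : L) (c : ℕ → ℂ) (hh : ∀ j, ⁅h, e j⁆ = c j • e j)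
    (a l : ℕ) : ⁅h, rootVec e a l⁆ = (∑ k ∈ Finset.range (l + 1), c (a + k)) • rootVec e a l := by
  induction l generalizing a with
  | zero => simp [rootVec, hh]
  | succ l ih =>
    rw [rootVec, leibniz_lie, ih, hh, smul_lie, lie_smul, ← add_smul, Finset.sum_range_succ' _ (l + 1),
      add_comm]
    simp only [add_zero, add_assoc, add_comm 1]

end RootVectors

/-! ### Elementary matrices -/

section MatrixUnits

attribute [local instance] LieRing.ofAssociativeRing

/-- The complex vector space with basis indexed by the natural numbers. -/
def NatSpace : Type := ℕ →₀ ℂ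

noncomputable instance NatSpace.instAddCommGroup : AddCommGroup NatSpace :=
  inferInstanceAs (AddCommGroup (ℕ →₀ ℂ))

noncomputable instance NatSpace.instModule : Module ℂ NatSpace :=
  inferInstanceAs (Module ℂ (ℕ →₀ ℂ))

/-- Elements of `NatSpace` as functions. -/
noncomputable def NatSpace.toFinsupp : NatSpace ≃ₗ[ℂ] (ℕ →₀ ℂ) := LinearEquiv.refl ℂ (ℕ →₀ ℂ)

/-- The elementary endomorphism of `NatSpace` with a single entry `1` in position `(p, q)`. -/
noncomputable def elemEnd (p q : ℕ) : Module.End ℂ NatSpace :=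
  NatSpace.toFinsupp.symm.toLinearMap ∘ₗ Finsupp.lsingle p ∘ₗ Finsupp.lapply q ∘ₗ
    NatSpace.toFinsupp.toLinearMap

theorem elemEnd_mul (p q r s : ℕ) :
    elemEnd p q * elemEnd r s = if q = r then elemEnd p s else 0 := by
  refine LinearMap.ext fun f => ?_
  change NatSpace.toFinsupp.symm (Finsupp.single p ((Finsupp.single r
    (NatSpace.toFinsupp f s) : ℕ →₀ ℂ) q)) = _
  split_ifs with h
  · subst h
    rw [Finsupp.single_eq_same]
    rfl
  · rw [Finsupp.single_eq_of_ne h, Finsupp.single_zero, map_zero]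
    rfl

/-- The entry of an endomorphism of `NatSpace` in position `(p, q)`. -/
noncomputable def endEntry (p q : ℕ) : Module.End ℂ NatSpace →ₗ[ℂ] ℂ :=
  Finsupp.lapply p ∘ₗ NatSpace.toFinsupp.toLinearMap ∘ₗ
    LinearMap.applyₗ (NatSpace.toFinsupp.symm (Finsupp.single q 1))

theorem endEntry_elemEnd (p q r s : ℕ) :
    endEntry p q (elemEnd r s) = if p = r ∧ q = s then 1 else 0 := by
  change (Finsupp.single r ((Finsupp.single q 1 : ℕ →₀ ℂ) s) : ℕ →₀ ℂ) p = _
  rw [Finsupp.single_apply, Finsupp.single_apply]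
  split_ifs <;> first | rfl | (exfalso; omega)

theorem elemEnd_lie (p q r s : ℕ) : ⁅elemEnd p q, elemEnd r s⁆ =
    (if q = r then elemEnd p s else 0) - if s = p then elemEnd r q else 0 := by
  rw [LieRing.of_associative_ring_bracket, elemEnd_mul, elemEnd_mul]

theorem elemEnd_diag_lie (p r s : ℕ) : ⁅elemEnd p p, elemEnd r s⁆ =
    ((if p = r then 1 else 0) - (if p = s then 1 else 0) : ℂ) • elemEnd r s := by
  rw [elemEnd_lie]
  by_cases h1 : p = r <;> by_cases h2 : p = s
  · subst h1; subst h2; simp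
  · subst h1; simp [h2, Ne.symm h2]
  · subst h2; simp [h1]
  · simp [h1, h2, Ne.symm h2]

theorem rootVec_elemEnd (a l : ℕ) :
    rootVec (fun k => elemEnd k (k + 1)) a l = elemEnd a (a + l + 1) := by
  induction l generalizing a with
  | zero => rfl
  | succ l ih =>
    rw [rootVec, ih, elemEnd_lie, if_pos rfl, if_neg (by omega), sub_zero]
    congr 1; omega

end MatrixUnits

/-! ### The Cartan matrix of type A and numberings of the path -/

section TypeA

/-- The Cartan matrix of type `A`, with rows and columns indexed by natural numbers. -/
def cartanA (p q : ℕ) : ℤ := if p = q then 2 else if p + 1 = q ∨ q + 1 = p then -1 else 0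

theorem cartanA_comm (p q : ℕ) : cartanA p q = cartanA q p := by
  unfold cartanA
  split_ifs <;> first | rfl | (exfalso; omega)

/-- A numbering of the vertices of a quiver of type `A` along its underlying path. -/
structure PathNumbering (I : Type u) [Quiver.{v} I] (n : ℕ) where
  equiv : I ≃ Fin n
  card_hom : ∀ i j : I, Nat.card (i ⟶ j) + Nat.card (j ⟶ i) =
    if (equiv i : ℕ) + 1 = equiv j ∨ (equiv j : ℕ) + 1 = equiv i then 1 else 0

namespace PathNumbering

variable {I : Type u} [Quiver.{v} I] {n : ℕ} (N : PathNumbering I n)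

/-- The position of a vertex on the path. -/
def pos (i : I) : ℕ := N.equiv i

theorem pos_lt (i : I) : N.pos i < n := (N.equiv i).2

theorem pos_injective : Function.Injective N.pos := fun _ _ h => N.equiv.injective (Fin.ext h)

/-- The vertex at a given position. -/
def vertex (k : ℕ) (h : k < n) : I := N.equiv.symm ⟨k, h⟩

@[simp]
theorem pos_vertex (k : ℕ) (h : k < n) : N.pos (N.vertex k h) = k := by
  simp [pos, vertex]

@[simp]
theorem vertex_pos (i : I) (h : N.pos i < n) : N.vertex (N.pos i) h = i :=
  N.pos_injective (N.pos_vertex _ h)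

theorem exists_pos {k : ℕ} (h : k < n) : ∃ i, N.pos i = k := ⟨N.vertex k h, N.pos_vertex k h⟩

/-- A family indexed by the vertices, as a sequence extended by zero. -/
def extend {A : Type*} [Zero A] (f : I → A) (k : ℕ) : A :=
  if h : k < n then f (N.vertex k h) else 0

theorem extend_pos {A : Type*} [Zero A] (f : I → A) (i : I) : N.extend f (N.pos i) = f i := by
  rw [extend, dif_pos (N.pos_lt i), vertex_pos]

theorem extend_of_le {A : Type*} [Zero A] (f : I → A) {k : ℕ} (h : n ≤ k) : N.extend f k = 0 :=
  dif_neg (by omega)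

theorem quiverCartan_eq [DecidableEq I] (i j : I) :
    quiverCartan I i j = cartanA (N.pos i) (N.pos j) := by
  unfold quiverCartan cartanA
  rw [N.card_hom]
  simp only [N.pos_injective.eq_iff]
  change (if i = j then (2 : ℤ) else -((if N.pos i + 1 = N.pos j ∨ N.pos j + 1 = N.pos i then 1
    else 0 : ℕ) : ℤ)) = _
  split_ifs <;> rfl

/-- Extending by zero past the last vertex preserves the relations, so root vectors can be indexed
by natural numbers without bounds. -/
theorem typeASerre_extend {L : Type*} [LieRing L] {f : I → L}
    (h0 : ∀ i j, N.pos i + 2 ≤ N.pos j → ⁅f i, f j⁆ = 0)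
    (h1 : ∀ i j, N.pos i + 1 = N.pos j ∨ N.pos j + 1 = N.pos i → ⁅f i, ⁅f i, f j⁆⁆ = 0) :
    TypeASerre (N.extend f) where
  comm i j h := by
    rcases lt_or_ge j n with hj | hj
    · obtain ⟨i, rfl⟩ := N.exists_pos (show i < n by omega)
      obtain ⟨j, rfl⟩ := N.exists_pos hj
      rw [extend_pos, extend_pos, h0 i j h]
    · rw [N.extend_of_le f hj, lie_zero]
  serre i := by
    rcases lt_or_ge (i + 1) n with hj | hj
    · obtain ⟨j, hj⟩ := N.exists_pos hj
      obtain ⟨i, rfl⟩ := N.exists_pos (show i < n by omega)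
      rw [← hj, extend_pos, extend_pos, h1 i j (Or.inl hj.symm)]
    · rw [N.extend_of_le f hj, lie_zero, lie_zero]
  serre' i := by
    rcases lt_or_ge (i + 1) n with hj | hj
    · obtain ⟨j, hj⟩ := N.exists_pos hj
      obtain ⟨i, rfl⟩ := N.exists_pos (show i < n by omega)
      rw [← hj, extend_pos, extend_pos, h1 j i (Or.inr hj.symm)]
    · rw [N.extend_of_le f hj, zero_lie]

end PathNumbering

/-- The Cartan matrix of type `A` is nonsingular. -/
theorem eq_zero_of_cartanA {n : ℕ} (c : ℕ → ℂ) (hc : ∀ k, n ≤ k → c k = 0)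
    (h : ∀ q < n, ∑ p ∈ Finset.range n, c p * cartanA q p = 0) (p : ℕ) : c p = 0 := by
  -- Row `q` of the system says `2 c q = c (q - 1) + c (q + 1)`, without the first term if `q = 0`.
  -- Hence `c k = (k + 1) c 0` for `k ≤ n`, and the boundary value `c n = 0` gives `c 0 = 0`.
  have hrec : ∀ q < n, c (q + 1) = 2 * c q - if q = 0 then 0 else c (q - 1) := by
    intro q hq
    have h1 : ∀ p, c p * cartanA q p = (if p = q then 2 * c q else 0) +
        (if p = q + 1 then - c (q + 1) else 0) + if p + 1 = q then - c p else 0 := by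
      intro p
      unfold cartanA
      split_ifs <;> first | (exfalso; omega) | (subst_vars; push_cast; ring)
    have h2 := h q hq
    simp only [h1, Finset.sum_add_distrib, Finset.sum_ite_eq', Finset.mem_range, hq, if_true] at h2
    have h3 : (if q + 1 < n then -c (q + 1) else 0) = - c (q + 1) := by
      split_ifs with h
      · rfl
      · rw [hc _ (by omega), neg_zero]
    have h4 : ∑ p ∈ Finset.range n, (if p + 1 = q then - c p else 0) =
        - if q = 0 then 0 else c (q - 1) := by
      rcases q with - | q
      · simp
      · simp only [add_left_inj, Finset.sum_ite_eq', Finset.mem_range]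
        rw [if_pos (by omega), if_neg (by omega)]
        rfl
    rw [h3, h4] at h2
    linear_combination -h2
  have hlin : ∀ k ≤ n, c k = (k + 1) * c 0 := by
    intro k
    induction k using Nat.strong_induction_on with
    | _ k ih =>
      intro hk
      rcases k with - | k
      · simp
      · rw [hrec k (by omega), ih k (by omega) (by omega)]
        split_ifs with h0
        · subst h0; push_cast; ring
        · rw [ih (k - 1) (by omega) (by omega)]
          obtain ⟨k, rfl⟩ := Nat.exists_eq_succ_of_ne_zero h0
          simp only [Nat.succ_eq_add_one, Nat.add_sub_cancel]
          push_cast; ring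
  have h0 : c 0 = 0 := by
    have h1 := hlin n le_rfl
    rw [hc n le_rfl] at h1
    exact (mul_eq_zero.1 h1.symm).resolve_left (by norm_cast)
  rcases le_or_gt n p with hp | hp
  · exact hc p hp
  · rw [hlin p hp.le, h0, mul_zero]

end TypeA

/-! ### Chevalley relations and the natural representation -/

namespace KacMoody

open CartanMatrix

variable {I : Type u} [Quiver.{v} I] [DecidableEq I]

/-- The projection from the free Lie algebra on the Chevalley generators. -/
noncomputable def proj : FreeLieAlgebra ℂ (Generators I) →ₗ⁅ℂ⁆ KacMoody I where
  toFun x := LieSubmodule.Quotient.mk (N := Relations.toIdeal ℂ (quiverCartan I)) x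
  map_add' _ _ := rfl
  map_smul' _ _ := rfl
  map_lie' := rfl

theorem proj_eq_zero {x : FreeLieAlgebra ℂ (Generators I)}
    (hx : x ∈ Relations.toSet ℂ (quiverCartan I)) : proj x = 0 :=
  (LieSubmodule.Quotient.mk_eq_zero _).2 (LieSubmodule.subset_lieSpan hx)

theorem lie_H_H (i j : I) : ⁅(gen (.H i) : KacMoody I), gen (.H j)⁆ = 0 := by
  have h : Relations.HH ℂ (i, j) ∈ Relations.toSet ℂ (quiverCartan I) := by
    simp [Relations.toSet]
  have := proj_eq_zero h
  rwa [Relations.HH, Function.uncurry_apply_pair, LieHom.map_lie] at this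

theorem lie_H_E (i j : I) :
    ⁅(gen (.H i) : KacMoody I), gen (.E j)⁆ = (quiverCartan I i j : ℂ) • gen (.E j) := by
  have h : Relations.HE ℂ (quiverCartan I) (i, j) ∈ Relations.toSet ℂ (quiverCartan I) := by
    simp [Relations.toSet]
  have := proj_eq_zero h
  rw [Relations.HE, Function.uncurry_apply_pair, map_sub, LieHom.map_lie, map_zsmul, sub_eq_zero] at this
  rw [Int.cast_smul_eq_zsmul]
  exact this

/-- The exponent is `-a i j` and not `1 - a i j`, because one bracket with `e i` is already in the
argument. -/
theorem ad_E_pow (i j : I) : ((LieAlgebra.ad ℂ (KacMoody I) (gen (.E i))) ^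
    (-quiverCartan I i j).toNat) ⁅(gen (.E i) : KacMoody I), gen (.E j)⁆ = 0 := by
  have h : Relations.adE ℂ (quiverCartan I) (i, j) ∈ Relations.toSet ℂ (quiverCartan I) := by
    simp [Relations.toSet]
  have h1 := proj_eq_zero h
  rw [Relations.adE, Function.uncurry_apply_pair] at h1
  have h2 : ∀ (m : ℕ) (x y : FreeLieAlgebra ℂ (Generators I)),
      proj ((LieAlgebra.ad ℂ _ x ^ m) y) = (LieAlgebra.ad ℂ (KacMoody I) (proj x) ^ m) (proj y) := by
    intro m x y
    induction m with
    | zero => rfl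
    | succ m ih =>
      rw [pow_succ', pow_succ', Module.End.mul_apply, Module.End.mul_apply, ← ih]
      exact LieHom.map_lie _ _ _
  rw [h2] at h1
  exact h1

/-- The homomorphism from the Kac-Moody algebra given by elements that satisfy the relations. -/
noncomputable def lift {L : Type*} [LieRing L] [LieAlgebra ℂ L] (f : Generators I → L)
    (hf : ∀ x ∈ Relations.toSet ℂ (quiverCartan I), FreeLieAlgebra.lift ℂ f x = 0) :
    KacMoody I →ₗ⁅ℂ⁆ L :=
  { Submodule.liftQ (Relations.toIdeal ℂ (quiverCartan I)).toSubmodule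
      (FreeLieAlgebra.lift ℂ f).toLinearMap (by
        have h : Relations.toIdeal ℂ (quiverCartan I) ≤ (FreeLieAlgebra.lift ℂ f).ker :=
          LieSubmodule.lieSpan_le.2 fun x hx => LieHom.mem_ker.2 (hf x hx)
        exact fun x hx => LieHom.mem_ker.1 (h hx)) with
    map_lie' := fun {x y} => by
      obtain ⟨x, rfl⟩ := LieSubmodule.Quotient.surjective_mk' _ x
      obtain ⟨y, rfl⟩ := LieSubmodule.Quotient.surjective_mk' _ y
      exact LieHom.map_lie (FreeLieAlgebra.lift ℂ f) x y }

theorem lift_gen {L : Type*} [LieRing L] [LieAlgebra ℂ L] (f : Generators I → L)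
    (hf : ∀ x ∈ Relations.toSet ℂ (quiverCartan I), FreeLieAlgebra.lift ℂ f x = 0)
    (x : Generators I) : lift f hf (gen x) = f x :=
  FreeLieAlgebra.lift_of_apply f x

section

attribute [local instance] LieRing.ofAssociativeRing

variable {n : ℕ} (N : PathNumbering I n)

/-- The images of the Chevalley generators in the natural representation. -/
noncomputable def natGen : Generators I → Module.End ℂ NatSpace
  | .H i => elemEnd (N.pos i) (N.pos i) - elemEnd (N.pos i + 1) (N.pos i + 1)
  | .E i => elemEnd (N.pos i) (N.pos i + 1)
  | .F i => elemEnd (N.pos i + 1) (N.pos i)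

/-- The Borel subalgebra is defined inside the full algebra, so telling its elements apart takes a
representation of the full algebra. For this reason the relations that involve the `f i` have to be
verified as well. -/
theorem natGen_relations (x : FreeLieAlgebra ℂ (Generators I))
    (hx : x ∈ Relations.toSet ℂ (quiverCartan I)) :
    FreeLieAlgebra.lift ℂ (natGen N) x = 0 := by
  have had : ∀ (m : ℕ) (x y : FreeLieAlgebra ℂ (Generators I)),
      FreeLieAlgebra.lift ℂ (natGen N) ((LieAlgebra.ad ℂ _ x ^ m) y) =
        (LieAlgebra.ad ℂ (Module.End ℂ NatSpace) (FreeLieAlgebra.lift ℂ (natGen N) x) ^ m)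
          (FreeLieAlgebra.lift ℂ (natGen N) y) := by
    intro m x y
    induction m with
    | zero => rfl
    | succ m ih =>
      rw [pow_succ', pow_succ', Module.End.mul_apply, Module.End.mul_apply, ← ih]
      exact LieHom.map_lie _ _ _
  simp only [Relations.toSet, Set.mem_union, Set.mem_range, Prod.exists] at hx
  rcases hx with ((((⟨i, j, rfl⟩ | ⟨i, j, rfl⟩) | ⟨i, j, rfl⟩) | ⟨i, j, rfl⟩) | ⟨i, j, rfl⟩) |
    ⟨i, j, rfl⟩
  · simp only [Relations.HH, Function.uncurry_apply_pair, Function.comp_apply, LieHom.map_lie,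
      FreeLieAlgebra.lift_of_apply, natGen, sub_lie, lie_sub, elemEnd_diag_lie, sub_self, zero_smul]
  · simp only [Relations.EF, Function.uncurry_apply_pair]
    split_ifs with h
    · subst h
      simp only [Function.comp_apply, LieHom.map_lie, map_sub, FreeLieAlgebra.lift_of_apply, natGen,
        elemEnd_lie, if_true, sub_self]
    · have h' : N.pos i ≠ N.pos j := fun e => h (N.pos_injective e)
      simp only [Function.comp_apply, LieHom.map_lie, FreeLieAlgebra.lift_of_apply, natGen,
        elemEnd_lie]
      rw [if_neg (by omega), if_neg (by omega), sub_self]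
  · simp only [Relations.HE, Function.uncurry_apply_pair, Function.comp_apply, LieHom.map_lie,
      map_sub, FreeLieAlgebra.lift_of_apply, natGen, sub_lie, elemEnd_diag_lie, map_zsmul,
      N.quiverCartan_eq]
    rw [← Int.cast_smul_eq_zsmul ℂ, ← sub_smul, ← sub_smul]
    refine smul_eq_zero_of_left ?_ _
    unfold cartanA
    split_ifs <;> first | (exfalso; omega) | norm_num
  · simp only [Relations.HF, Function.uncurry_apply_pair, Function.comp_apply, LieHom.map_lie,
      map_add, FreeLieAlgebra.lift_of_apply, natGen, sub_lie, elemEnd_diag_lie, map_zsmul,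
      N.quiverCartan_eq]
    rw [← Int.cast_smul_eq_zsmul ℂ, ← sub_smul, ← add_smul]
    refine smul_eq_zero_of_left ?_ _
    unfold cartanA
    split_ifs <;> first | (exfalso; omega) | norm_num
  · simp only [Relations.adE, Function.uncurry_apply_pair, Function.comp_apply, LieHom.map_lie,
      FreeLieAlgebra.lift_of_apply, natGen, had, N.quiverCartan_eq]
    unfold cartanA
    split_ifs with h1 h2
    · rw [h1, lie_self, map_zero]
    -- For adjacent vertices the exponent `(-(-1)).toNat` reduces to one, which gives a double
    -- bracket; for distant vertices it is zero and a single bracket remains.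
    · change ⁅elemEnd _ _, ⁅elemEnd _ _, elemEnd _ _⁆⁆ = 0
      rcases h2 with h2 | h2
      · rw [← h2, elemEnd_lie, if_pos rfl, if_neg (by omega), sub_zero, elemEnd_lie,
          if_neg (by omega), if_neg (by omega), sub_zero]
      · rw [← h2, elemEnd_lie, if_neg (by omega), if_pos rfl, zero_sub, lie_neg, elemEnd_lie,
          if_neg (by omega), if_neg (by omega), sub_zero, neg_zero]
    · change ⁅elemEnd _ _, elemEnd _ _⁆ = 0
      rw [elemEnd_lie, if_neg (by omega), if_neg (by omega), sub_zero]
  · simp only [Relations.adF, Function.uncurry_apply_pair, Function.comp_apply, LieHom.map_lie,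
      FreeLieAlgebra.lift_of_apply, natGen, had, N.quiverCartan_eq]
    unfold cartanA
    split_ifs with h1 h2
    · rw [h1, lie_self, map_zero]
    · change ⁅elemEnd _ _, ⁅elemEnd _ _, elemEnd _ _⁆⁆ = 0
      rcases h2 with h2 | h2
      · rw [← h2, elemEnd_lie, if_neg (by omega), if_pos rfl, zero_sub, lie_neg, elemEnd_lie,
          if_neg (by omega), if_neg (by omega), sub_zero, neg_zero]
      · rw [← h2, elemEnd_lie, if_pos rfl, if_neg (by omega), sub_zero, elemEnd_lie,
          if_neg (by omega), if_neg (by omega), sub_zero]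
    · change ⁅elemEnd _ _, elemEnd _ _⁆ = 0
      rw [elemEnd_lie, if_neg (by omega), if_neg (by omega), sub_zero]

/-- The natural representation. -/
noncomputable def natRep : KacMoody I →ₗ⁅ℂ⁆ Module.End ℂ NatSpace :=
  lift (natGen N) (natGen_relations N)

theorem natRep_gen (x : Generators I) : natRep N (gen x) = natGen N x := lift_gen _ _ _

end

variable {n : ℕ} (N : PathNumbering I n)

theorem lie_E_E_of_not_adj {i j : I} (h : N.pos i + 2 ≤ N.pos j) :
    ⁅(gen (.E i) : KacMoody I), gen (.E j)⁆ = 0 := by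
  have := ad_E_pow i j
  rw [N.quiverCartan_eq, cartanA, if_neg (by omega), if_neg (by omega)] at this
  exact this

theorem lie_E_lie_E_E_of_adj {i j : I} (h : N.pos i + 1 = N.pos j ∨ N.pos j + 1 = N.pos i) :
    ⁅(gen (.E i) : KacMoody I), ⁅(gen (.E i) : KacMoody I), gen (.E j)⁆⁆ = 0 := by
  have := ad_E_pow i j
  rw [N.quiverCartan_eq, cartanA, if_neg (by omega), if_pos h] at this
  exact this

theorem typeASerre_E : TypeASerre (N.extend fun i => (gen (.E i) : KacMoody I)) :=
  N.typeASerre_extend (fun _ _ h => lie_E_E_of_not_adj N h)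
    (fun _ _ h => lie_E_lie_E_E_of_adj N h)

end KacMoody

/-! ### A homomorphism out of the derived Borel subalgebra from its relations -/

section BorelHom

attribute [local instance] LieRing.ofAssociativeRing

variable {I : Type u} [Quiver.{v} I] [DecidableEq I] {n : ℕ} (N : PathNumbering I n)

theorem rootVec_congr {L : Type*} [LieRing L] {e e' : ℕ → L} {a l : ℕ}
    (h : ∀ i, a ≤ i → i ≤ a + l → e i = e' i) : rootVec e a l = rootVec e' a l := by
  induction l generalizing a with
  | zero => exact h a le_rfl le_rfl
  | succ l ih =>
    rw [rootVec, rootVec, h a le_rfl (by omega), ih fun i h1 h2 => h i (by omega) (by omega)]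

/-- Elements of a Lie algebra that satisfy the relations of the generators `e i` and `h i` of the
derived Borel subalgebra in type `A`. -/
structure BorelRelations {L : Type*} [LieRing L] [LieAlgebra ℂ L] (E Z : I → L) : Prop where
  serre : TypeASerre (N.extend E)
  comm : ∀ i j, ⁅Z i, Z j⁆ = 0
  weight : ∀ i j, ⁅Z i, E j⁆ = (quiverCartan I i j : ℂ) • E j

theorem KacMoody.borelRelations :
    BorelRelations N (fun i => (KacMoody.gen (.E i) : KacMoody I)) (fun i => KacMoody.gen (.H i)) where
  serre := KacMoody.typeASerre_E N
  comm := KacMoody.lie_H_H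
  weight := KacMoody.lie_H_E

namespace BorelRelations

variable {N} {L : Type*} [LieRing L] [LieAlgebra ℂ L] {E Z : I → L}

theorem lie_extend (h : BorelRelations N E Z) (i : I) (k : ℕ) :
    ⁅Z i, N.extend E k⁆ = (cartanA (N.pos i) k : ℂ) • N.extend E k := by
  rcases lt_or_ge k n with hk | hk
  · obtain ⟨j, rfl⟩ := N.exists_pos hk
    rw [N.extend_pos, h.weight, N.quiverCartan_eq]
  · rw [N.extend_of_le _ hk, lie_zero, smul_zero]

theorem lie_Z_rootVec (h : BorelRelations N E Z) (i : I) (a l : ℕ) :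
    ⁅Z i, rootVec (N.extend E) a l⁆ =
      (∑ k ∈ Finset.range (l + 1), (cartanA (N.pos i) (a + k) : ℂ)) • rootVec (N.extend E) a l :=
  lie_rootVec_weight (Z i) (fun k => (cartanA (N.pos i) k : ℂ)) (h.lie_extend i) a l

/-- The span of the `Z i` and of all root vectors. -/
def rootSpan (N : PathNumbering I n) (E Z : I → L) : Submodule ℂ L :=
  Submodule.span ℂ (Set.range Z ∪ Set.range fun p : ℕ × ℕ => rootVec (N.extend E) p.1 p.2)

omit [DecidableEq I] in
theorem Z_mem (i : I) : Z i ∈ rootSpan N E Z := Submodule.subset_span (Or.inl ⟨i, rfl⟩)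

omit [DecidableEq I] in
theorem rootVec_mem (a l : ℕ) : rootVec (N.extend E) a l ∈ rootSpan N E Z :=
  Submodule.subset_span (Or.inr ⟨(a, l), rfl⟩)

omit [DecidableEq I] in
theorem E_mem (i : I) : E i ∈ rootSpan N E Z := by
  have := rootVec_mem (N := N) (E := E) (Z := Z) (N.pos i) 0
  rwa [rootVec, N.extend_pos] at this

theorem lie_Z_mem (h : BorelRelations N E Z) (i : I) {y : L} (hy : y ∈ rootSpan N E Z) :
    ⁅Z i, y⁆ ∈ rootSpan N E Z := by
  induction hy using Submodule.span_induction with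
  | mem y hy =>
    rcases hy with ⟨j, rfl⟩ | ⟨p, rfl⟩
    · rw [h.comm]; exact zero_mem _
    · dsimp only
      rw [h.lie_Z_rootVec]; exact Submodule.smul_mem _ _ (rootVec_mem _ _)
  | zero => rw [lie_zero]; exact zero_mem _
  | add x y _ _ hx hy => rw [lie_add]; exact add_mem hx hy
  | smul c x _ hx => rw [lie_smul]; exact Submodule.smul_mem _ _ hx

theorem lie_E_mem (h : BorelRelations N E Z) (i : I) {y : L} (hy : y ∈ rootSpan N E Z) :
    ⁅E i, y⁆ ∈ rootSpan N E Z := by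
  induction hy using Submodule.span_induction with
  | mem y hy =>
    rcases hy with ⟨j, rfl⟩ | ⟨p, rfl⟩
    · rw [← lie_skew, h.weight]
      exact neg_mem (Submodule.smul_mem _ _ (E_mem i))
    · dsimp only
      rw [← N.extend_pos E i, h.serre.lie_rootVec]
      split_ifs
      · exact rootVec_mem _ _
      · exact neg_mem (rootVec_mem _ _)
      · exact zero_mem _
  | zero => rw [lie_zero]; exact zero_mem _
  | add x y _ _ hx hy => rw [lie_add]; exact add_mem hx hy
  | smul c x _ hx => rw [lie_smul]; exact Submodule.smul_mem _ _ hx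

/-- The induction carries along that bracketing with the element preserves the span. This property
passes to brackets by the Jacobi identity, so only brackets of generators with the spanning elements
have to be computed. -/
theorem lieSpan_le (h : BorelRelations N E Z) {x : L}
    (hx : x ∈ LieSubalgebra.lieSpan ℂ L (Set.range Z ∪ Set.range E)) : x ∈ rootSpan N E Z := by
  have key : x ∈ rootSpan N E Z ∧ ∀ y ∈ rootSpan N E Z, ⁅x, y⁆ ∈ rootSpan N E Z := by
    induction hx using LieSubalgebra.lieSpan_induction with
    | mem x hx =>
      rcases hx with ⟨i, rfl⟩ | ⟨i, rfl⟩
      · exact ⟨Z_mem i, fun y hy => h.lie_Z_mem i hy⟩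
      · exact ⟨E_mem i, fun y hy => h.lie_E_mem i hy⟩
    | zero => exact ⟨zero_mem _, fun y _ => by rw [zero_lie]; exact zero_mem _⟩
    | add x y _ _ hx hy =>
      exact ⟨add_mem hx.1 hy.1, fun z hz => by rw [add_lie]; exact add_mem (hx.2 z hz) (hy.2 z hz)⟩
    | smul c x _ hx =>
      exact ⟨Submodule.smul_mem _ _ hx.1, fun z hz => by
        rw [smul_lie]; exact Submodule.smul_mem _ _ (hx.2 z hz)⟩
    | lie x y _ _ hx hy =>
      exact ⟨hx.2 y hy.1, fun z hz => by
        rw [lie_lie]; exact sub_mem (hx.2 _ (hy.2 z hz)) (hy.2 _ (hx.2 z hz))⟩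
  exact key.1

end BorelRelations

/-- The index set of the standard basis of the derived Borel subalgebra. -/
abbrev BorelIndex (I : Type u) (n : ℕ) : Type u := I ⊕ (Σ a : Fin n, Fin (n - a))

/-- The standard family of elements of the derived Borel subalgebra. -/
def borelFamily {L : Type*} [LieRing L] (E Z : I → L) : BorelIndex I n → L :=
  Sum.elim Z fun p => rootVec (N.extend E) p.1 p.2

omit [DecidableEq I] in
theorem rootSpan_eq_span_borelFamily {L : Type*} [LieRing L] [LieAlgebra ℂ L] (E Z : I → L) :
    BorelRelations.rootSpan N E Z = Submodule.span ℂ (Set.range (borelFamily N E Z)) := by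
  apply le_antisymm
  · refine Submodule.span_le.2 ?_
    rintro _ (⟨i, rfl⟩ | ⟨⟨a, l⟩, rfl⟩)
    · exact Submodule.subset_span ⟨Sum.inl i, rfl⟩
    · rcases lt_or_ge (a + l) n with h | h
      · exact Submodule.subset_span ⟨Sum.inr ⟨⟨a, by omega⟩, ⟨l, by simp only; omega⟩⟩, rfl⟩
      · dsimp only
        rw [rootVec_eq_zero (fun i hi => N.extend_of_le E hi) h]
        exact zero_mem _
  · refine Submodule.span_le.2 ?_
    rintro _ ⟨i | p, rfl⟩
    · exact BorelRelations.Z_mem i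
    · exact BorelRelations.rootVec_mem _ _

theorem natRep_rootVec {a l : ℕ} (h : a + l < n) :
    KacMoody.natRep N (rootVec (N.extend fun i => (KacMoody.gen (.E i) : KacMoody I)) a l) =
      elemEnd a (a + l + 1) := by
  rw [map_rootVec (KacMoody.natRep N) (fun x y => LieHom.map_lie _ x y), ← rootVec_elemEnd]
  refine rootVec_congr fun i h1 h2 => ?_
  obtain ⟨i, rfl⟩ := N.exists_pos (show i < n by omega)
  rw [N.extend_pos, KacMoody.natRep_gen]
  rfl

variable [Fintype I] {L : Type*} [LieRing L] [LieAlgebra ℂ L] (E Z : I → L)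

/-- The linear map on matrices that sends the matrix of `h i` to `Z i`, the matrices of the
positive root vectors to the corresponding root vectors, and lower triangular matrices to `0`. -/
noncomputable def endToRootVec : Module.End ℂ NatSpace →ₗ[ℂ] L :=
  -- The partial traces over positions `0, …, pos i` are dual to the matrices of the coroots: on
  -- `E_kk - E_{k+1,k+1}` the value is 1 if `pos i = k` and 0 otherwise.
  ∑ i, (∑ r ∈ Finset.range (N.pos i + 1), endEntry r r).smulRight (Z i) +
    ∑ p : (Σ a : Fin n, Fin (n - a)), (endEntry p.1 (p.1 + p.2 + 1)).smulRight
      (rootVec (N.extend E) p.1 p.2)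

/-- The linear extension of `h i ↦ Z i`, `e i ↦ E i`, compatible with iterated brackets. -/
noncomputable def borelLinear : KacMoody I →ₗ[ℂ] L :=
  endToRootVec N E Z ∘ₗ (KacMoody.natRep N).toLinearMap

theorem borelLinear_apply (x : KacMoody I) : borelLinear N E Z x =
    ∑ i, (∑ r ∈ Finset.range (N.pos i + 1), endEntry r r (KacMoody.natRep N x)) • Z i +
    ∑ p : (Σ a : Fin n, Fin (n - a)), endEntry p.1 (p.1 + p.2 + 1) (KacMoody.natRep N x) •
      rootVec (N.extend E) p.1 p.2 := by
  simp [borelLinear, endToRootVec]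

theorem borelLinear_H (i : I) : borelLinear N E Z (KacMoody.gen (.H i)) = Z i := by
  rw [borelLinear_apply, KacMoody.natRep_gen, KacMoody.natGen]
  have h2 : ∀ p : (Σ a : Fin n, Fin (n - a)), endEntry p.1 (p.1 + p.2 + 1)
      (elemEnd (N.pos i) (N.pos i) - elemEnd (N.pos i + 1) (N.pos i + 1)) = 0 := by
    intro p
    rw [map_sub, endEntry_elemEnd, endEntry_elemEnd, if_neg (by omega), if_neg (by omega), sub_zero]
  simp only [h2, zero_smul, Finset.sum_const_zero, add_zero]
  have h1 : ∀ j : I, ∑ r ∈ Finset.range (N.pos j + 1), endEntry r r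
      (elemEnd (N.pos i) (N.pos i) - elemEnd (N.pos i + 1) (N.pos i + 1)) =
      if i = j then 1 else 0 := by
    intro j
    simp only [map_sub, endEntry_elemEnd, and_self, Finset.sum_sub_distrib, Finset.sum_ite_eq',
      Finset.mem_range, ← N.pos_injective.eq_iff (a := i)]
    split_ifs <;> first | (exfalso; omega) | norm_num
  simp only [h1, ite_smul, one_smul, zero_smul, Finset.sum_ite_eq, Finset.mem_univ, if_true]

theorem borelLinear_rootVec (a l : ℕ) : borelLinear N E Z
    (rootVec (N.extend fun i => (KacMoody.gen (.E i) : KacMoody I)) a l) =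
      rootVec (N.extend E) a l := by
  rcases lt_or_ge (a + l) n with h | h
  · rw [borelLinear_apply, natRep_rootVec N h]
    have h1 : ∀ r, endEntry r r (elemEnd a (a + l + 1)) = 0 := fun r => by
      rw [endEntry_elemEnd, if_neg (by omega)]
    simp only [h1, Finset.sum_const_zero, zero_smul, zero_add]
    rw [Finset.sum_eq_single (⟨⟨a, by omega⟩, ⟨l, by simp only; omega⟩⟩ : Σ a : Fin n, Fin (n - a))]
    · rw [endEntry_elemEnd, if_pos ⟨rfl, rfl⟩, one_smul]
    · rintro ⟨⟨b, hb⟩, ⟨m, hm⟩⟩ _ hne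
      rw [endEntry_elemEnd, if_neg, zero_smul]
      rintro ⟨h2, h3⟩
      simp only at h2 h3
      subst h2
      obtain rfl : m = l := by omega
      exact hne rfl
    · exact fun h => (h (Finset.mem_univ _)).elim
  · rw [rootVec_eq_zero (fun i hi => N.extend_of_le _ hi) h,
      rootVec_eq_zero (fun i hi => N.extend_of_le _ hi) h, map_zero]

theorem borelLinear_E (i : I) : borelLinear N E Z (KacMoody.gen (.E i)) = E i := by
  have := borelLinear_rootVec N E Z (N.pos i) 0
  rwa [rootVec, rootVec, N.extend_pos, N.extend_pos] at this

variable {N E Z}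

theorem borelLinear_lie_H (h : BorelRelations N E Z) (i : I) {y : KacMoody I}
    (hy : y ∈ BorelRelations.rootSpan N (fun i => (KacMoody.gen (.E i) : KacMoody I))
      (fun i => KacMoody.gen (.H i))) :
    borelLinear N E Z ⁅KacMoody.gen (.H i), y⁆ = ⁅Z i, borelLinear N E Z y⁆ := by
  induction hy using Submodule.span_induction with
  | mem y hy =>
    rcases hy with ⟨j, rfl⟩ | ⟨p, rfl⟩
    · rw [(KacMoody.borelRelations N).comm, borelLinear_H, h.comm, map_zero]
    · dsimp only
      rw [(KacMoody.borelRelations N).lie_Z_rootVec, map_smul, borelLinear_rootVec,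
        h.lie_Z_rootVec]
  | zero => rw [lie_zero, map_zero, lie_zero]
  | add x y _ _ hx hy => rw [lie_add, map_add, hx, hy, map_add, lie_add]
  | smul c x _ hx => rw [lie_smul, map_smul, hx, map_smul, lie_smul]

/-- On root vectors, source and target obey the same formula `TypeASerre.lie_rootVec`, a consequence
of the Serre relations. On the `h j` the weight relations agree. -/
theorem borelLinear_lie_E (h : BorelRelations N E Z) (i : I) {y : KacMoody I}
    (hy : y ∈ BorelRelations.rootSpan N (fun i => (KacMoody.gen (.E i) : KacMoody I))
      (fun i => KacMoody.gen (.H i))) :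
    borelLinear N E Z ⁅KacMoody.gen (.E i), y⁆ = ⁅E i, borelLinear N E Z y⁆ := by
  induction hy using Submodule.span_induction with
  | mem y hy =>
    rcases hy with ⟨j, rfl⟩ | ⟨p, rfl⟩
    · rw [← lie_skew, (KacMoody.borelRelations N).weight, map_neg, map_smul, borelLinear_H,
        borelLinear_E, ← lie_skew, h.weight]
    · dsimp only
      rw [borelLinear_rootVec, ← N.extend_pos E i, h.serre.lie_rootVec,
        ← N.extend_pos (fun i => (KacMoody.gen (.E i) : KacMoody I)) i,
        (KacMoody.borelRelations N).serre.lie_rootVec]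
      split_ifs
      · rw [borelLinear_rootVec]
      · rw [map_neg, borelLinear_rootVec]
      · rw [map_zero]
  | zero => rw [lie_zero, map_zero, lie_zero]
  | add x y _ _ hx hy => rw [lie_add, map_add, hx, hy, map_add, lie_add]
  | smul c x _ hx => rw [lie_smul, map_smul, hx, map_smul, lie_smul]

omit [Fintype I] in
theorem mem_rootSpan_of_mem_bPrime {x : KacMoody I} (hx : x ∈ bPrime I) :
    x ∈ BorelRelations.rootSpan N (fun i => (KacMoody.gen (.E i) : KacMoody I))
      (fun i => KacMoody.gen (.H i)) :=
  (KacMoody.borelRelations N).lieSpan_le hx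

theorem borelLinear_lie (h : BorelRelations N E Z) {x y : KacMoody I} (hx : x ∈ bPrime I)
    (hy : y ∈ bPrime I) :
    borelLinear N E Z ⁅x, y⁆ = ⁅borelLinear N E Z x, borelLinear N E Z y⁆ := by
  -- The second argument has to stay arbitrary in the induction on `x`: the elements `x` that are
  -- compatible with all `y` in the subalgebra are closed under brackets by the Jacobi identity.
  have key : ∀ y ∈ bPrime I,
      borelLinear N E Z ⁅x, y⁆ = ⁅borelLinear N E Z x, borelLinear N E Z y⁆ := by
    clear hy y
    induction hx using LieSubalgebra.lieSpan_induction with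
    | mem x hx =>
      rcases hx with ⟨i, rfl⟩ | ⟨i, rfl⟩ <;> intro y hy
      · rw [borelLinear_lie_H h i (mem_rootSpan_of_mem_bPrime hy), borelLinear_H]
      · rw [borelLinear_lie_E h i (mem_rootSpan_of_mem_bPrime hy), borelLinear_E]
    | zero => intro y _; rw [zero_lie, map_zero, zero_lie]
    | add x z _ _ hx hz =>
      intro y hy
      rw [add_lie, map_add, hx y hy, hz y hy, map_add, add_lie]
    | smul c x _ hx => intro y hy; rw [smul_lie, map_smul, hx y hy, map_smul, smul_lie]
    | lie x z hx' hz' hx hz =>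
      intro y hy
      rw [lie_lie, map_sub, hx _ ((bPrime I).lie_mem hz' hy), hz _ ((bPrime I).lie_mem hx' hy),
        hz y hy, hx y hy, hx z hz', lie_lie]
  exact key y hy

/-- The homomorphism out of the derived Borel subalgebra given by elements that satisfy its
relations. -/
noncomputable def borelHom (h : BorelRelations N E Z) : bPrime I →ₗ⁅ℂ⁆ L :=
  { borelLinear N E Z ∘ₗ (bPrime I).toSubmodule.subtype with
    map_lie' := fun {x y} => borelLinear_lie h x.2 y.2 }

theorem borelHom_apply (h : BorelRelations N E Z) (x : bPrime I) :
    borelHom h x = borelLinear N E Z x.1 := rfl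

/-- The standard family spans 𝔟' and is carried to the given independent family, so a combination
with zero image has zero coefficients. Independence in 𝔟' itself is not needed beforehand. -/
theorem borelHom_injective (h : BorelRelations N E Z)
    (hli : LinearIndependent ℂ (borelFamily N E Z)) : Function.Injective (borelHom h) := by
  rw [injective_iff_map_eq_zero]
  rintro ⟨x, hx⟩ h0
  rw [borelHom_apply] at h0
  have hx' := mem_rootSpan_of_mem_bPrime (N := N) hx
  rw [rootSpan_eq_span_borelFamily, Submodule.mem_span_range_iff_exists_fun] at hx'
  obtain ⟨c, rfl⟩ := hx'
  have h1 : ∀ j, borelLinear N E Z (borelFamily N (fun i => (KacMoody.gen (.E i) : KacMoody I))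
      (fun i => KacMoody.gen (.H i)) j) = borelFamily N E Z j := by
    rintro (i | p)
    · exact borelLinear_H N E Z i
    · exact borelLinear_rootVec N E Z _ _
  simp only [map_sum, map_smul, h1] at h0
  have hc := Fintype.linearIndependent_iff.1 hli c h0
  exact Subtype.ext (Finset.sum_eq_zero fun j _ => by rw [hc j, zero_smul])

end BorelHom

/-! ### Direct summands and ranks of edge maps -/

namespace F1Rep

section Clopen

variable {I : Type u} [Quiver.{v} I]

theorem isoEquiv_eq_zero {M N : F1Rep.{u, v} I} (f : M ≅ N) {i : I} {x : M.V i} :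
    isoEquiv f i x = 0 ↔ x = 0 := by
  rw [← isoEquiv_zero f i, (isoEquiv f i).injective.eq_iff]

/-- A point of a sub-representation as a point of the ambient representation. -/
def Sub.repVal {M : F1Rep.{u, v} I} (L : Sub M) {i : I} (x : L.rep.V i) : M.V i := x.1

/-- A point of a sub-representation. -/
def Sub.repMk {M : F1Rep.{u, v} I} (L : Sub M) {i : I} (x : M.V i) (hx : x ∈ L.carrier i) :
    L.rep.V i := ⟨x, hx⟩

/-- The representative of a point of a quotient representation. -/
def Sub.quotVal {M : F1Rep.{u, v} I} (L : Sub M) {i : I} (x : L.quot.V i) : M.V i := x.1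

/-- A point of a quotient representation. -/
def Sub.quotMk {M : F1Rep.{u, v} I} (L : Sub M) {i : I} (x : M.V i)
    (hx : x ∈ L.carrier i → x = 0) : L.quot.V i := ⟨x, hx⟩

section

variable {M : F1Rep.{u, v} I} (L : Sub M) {i j : I}

@[simp]
theorem Sub.repVal_repMk (x : M.V i) (hx : x ∈ L.carrier i) : L.repVal (L.repMk x hx) = x := rfl

@[simp]
theorem Sub.quotVal_quotMk (x : M.V i) (hx : x ∈ L.carrier i → x = 0) :
    L.quotVal (L.quotMk x hx) = x := rfl

theorem Sub.repVal_mem (x : L.rep.V i) : L.repVal x ∈ L.carrier i := x.2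

theorem Sub.quotVal_eq_zero_of_mem (x : L.quot.V i) (h : L.quotVal x ∈ L.carrier i) :
    L.quotVal x = 0 := x.2 h

theorem Sub.repVal_injective : Function.Injective (L.repVal (i := i)) := fun _ _ => Subtype.ext

theorem Sub.quotVal_injective : Function.Injective (L.quotVal (i := i)) := fun _ _ => Subtype.ext

@[simp]
theorem Sub.repVal_zero : L.repVal (0 : L.rep.V i) = 0 := rfl

@[simp]
theorem Sub.repVal_eq_zero {x : L.rep.V i} : L.repVal x = 0 ↔ x = 0 :=
  ⟨fun h => L.repVal_injective h, fun h => h ▸ rfl⟩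

@[simp]
theorem Sub.quotVal_eq_zero {x : L.quot.V i} : L.quotVal x = 0 ↔ x = 0 :=
  ⟨fun h => L.quotVal_injective h, fun h => h ▸ rfl⟩

@[simp]
theorem Sub.repVal_map (h : i ⟶ j) (x : L.rep.V i) :
    L.repVal (L.rep.map h x) = M.map h (L.repVal x) := rfl

theorem Sub.quotVal_map_of_mem (h : i ⟶ j) (x : L.quot.V i)
    (hx : M.map h (L.quotVal x) ∈ L.carrier j) : L.quotVal (L.quot.map h x) = 0 :=
  L.quot_map_pos h x hx

theorem Sub.quotVal_map_of_not_mem (h : i ⟶ j) (x : L.quot.V i)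
    (hx : M.map h (L.quotVal x) ∉ L.carrier j) :
    L.quotVal (L.quot.map h x) = M.map h (L.quotVal x) :=
  L.quot_map_neg h x hx

theorem Sub.quot_map_ne_zero_iff (h : i ⟶ j) (x : L.quot.V i) :
    L.quot.map h x ≠ 0 ↔ M.map h (L.quotVal x) ∉ L.carrier j := by
  rw [ne_eq, ← L.quotVal_eq_zero]
  by_cases hx : M.map h (L.quotVal x) ∈ L.carrier j
  · simp [L.quotVal_map_of_mem h x hx, hx]
  · rw [L.quotVal_map_of_not_mem h x hx]
    exact ⟨fun _ => hx, fun _ h0 => hx (h0 ▸ L.zero_mem j)⟩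

end

/-- The point of a direct sum with the given components. -/
def sumMk {M N : F1Rep.{u, v} I} {i : I} (x : M.V i) (y : N.V i) (h : x = 0 ∨ y = 0) :
    (sum M N).V i := ⟨(x, y), h⟩

/-- The first component of a point of a direct sum. -/
def sumFst {M N : F1Rep.{u, v} I} {i : I} (p : (sum M N).V i) : M.V i := p.1.1

/-- The second component of a point of a direct sum. -/
def sumSnd {M N : F1Rep.{u, v} I} {i : I} (p : (sum M N).V i) : N.V i := p.1.2

section

variable {M N : F1Rep.{u, v} I} {i j : I}

@[simp]
theorem sumFst_sumMk (x : M.V i) (y : N.V i) (h : x = 0 ∨ y = 0) : sumFst (sumMk x y h) = x := rfl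

@[simp]
theorem sumSnd_sumMk (x : M.V i) (y : N.V i) (h : x = 0 ∨ y = 0) : sumSnd (sumMk x y h) = y := rfl

@[simp]
theorem sumFst_zero : sumFst (0 : (sum M N).V i) = 0 := rfl

@[simp]
theorem sumSnd_zero : sumSnd (0 : (sum M N).V i) = 0 := rfl

@[simp]
theorem sumFst_map (h : i ⟶ j) (p : (sum M N).V i) :
    sumFst ((sum M N).map h p) = M.map h (sumFst p) := rfl

@[simp]
theorem sumSnd_map (h : i ⟶ j) (p : (sum M N).V i) :
    sumSnd ((sum M N).map h p) = N.map h (sumSnd p) := rfl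

theorem sum_eq_zero (p : (sum M N).V i) : sumFst p = 0 ∨ sumSnd p = 0 := p.2

theorem sum_ext {p q : (sum M N).V i} (h1 : sumFst p = sumFst q) (h2 : sumSnd p = sumSnd q) :
    p = q := Subtype.ext (Prod.ext h1 h2)

end

/-- A sub-representation that is a direct summand: no edge map sends a point outside of it to a
nonzero point inside of it. -/
def Sub.IsClopen {M : F1Rep.{u, v} I} (L : Sub M) : Prop :=
  ∀ ⦃i j : I⦄ (h : i ⟶ j) (x : M.V i), M.map h x ∈ L.carrier j → M.map h x ≠ 0 → x ∈ L.carrier i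

open Classical in
/-- A representation is the direct sum of a clopen sub-representation and the quotient by it. -/
noncomputable def Sub.IsClopen.sumIso {M : F1Rep.{u, v} I} {L : Sub M} (hL : L.IsClopen) :
    sum L.rep L.quot ≅ M :=
  mkIso (fun i =>
    { toFun := fun p => if sumSnd p = 0 then L.repVal (sumFst p) else L.quotVal (sumSnd p)
      invFun := fun x => if h : x ∈ L.carrier i then sumMk (L.repMk x h) 0 (Or.inr rfl)
        else sumMk 0 (L.quotMk x fun h' => (h h').elim) (Or.inl rfl)
      left_inv := by
        intro p
        dsimp only
        by_cases h1 : sumSnd p = 0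
        · rw [if_pos h1, dif_pos (L.repVal_mem _)]
          exact sum_ext rfl h1.symm
        · have h3 : L.quotVal (sumSnd p) ∉ L.carrier i := fun h3 =>
            h1 ((L.quotVal_eq_zero).1 (L.quotVal_eq_zero_of_mem _ h3))
          rw [if_neg h1, dif_neg h3]
          exact sum_ext ((sum_eq_zero p).resolve_right h1).symm rfl
      right_inv := by
        intro x
        dsimp only
        by_cases h : x ∈ L.carrier i
        · rw [dif_pos h, sumSnd_sumMk, if_pos rfl, sumFst_sumMk, L.repVal_repMk]
        · rw [dif_neg h, sumSnd_sumMk, if_neg, L.quotVal_quotMk]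
          rw [← L.quotVal_eq_zero, L.quotVal_quotMk]
          exact fun h0 => h (h0 ▸ L.zero_mem i) })
    (fun i => if_pos rfl)
    (by
      intro i j h p
      change M.map h (if sumSnd p = 0 then L.repVal (sumFst p) else L.quotVal (sumSnd p)) =
        if L.quot.map h (sumSnd p) = 0 then L.repVal (L.rep.map h (sumFst p))
        else L.quotVal (L.quot.map h (sumSnd p))
      by_cases hy : sumSnd p = 0
      · rw [hy, L.quot.map_zero, if_pos rfl, if_pos rfl, L.repVal_map]
      · have hx : sumFst p = 0 := (sum_eq_zero p).resolve_right hy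
        rw [if_neg hy, hx, L.rep.map_zero, L.repVal_zero]
        by_cases hm : M.map h (L.quotVal (sumSnd p)) ∈ L.carrier j
        · rw [if_pos (L.quotVal_eq_zero.1 (L.quotVal_map_of_mem h _ hm))]
          by_contra hne
          exact hy (L.quotVal_eq_zero.1 (L.quotVal_eq_zero_of_mem _ (hL h _ hm hne)))
        · rw [if_neg ((L.quot_map_ne_zero_iff h _).2 hm), L.quotVal_map_of_not_mem h _ hm])

/-- The direct sum of two isomorphisms. -/
def sumCongr {M N M' N' : F1Rep.{u, v} I} (f : M ≅ M') (g : N ≅ N') : sum M N ≅ sum M' N' :=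
  mkIso (fun i => ((isoEquiv f i).prodCongr (isoEquiv g i)).subtypeEquiv fun p => by
      change _ ↔ isoEquiv f i p.1 = 0 ∨ isoEquiv g i p.2 = 0
      rw [isoEquiv_eq_zero, isoEquiv_eq_zero])
    (fun i => Subtype.ext (Prod.ext (isoEquiv_zero f i) (isoEquiv_zero g i)))
    (fun h p => Subtype.ext (Prod.ext (isoEquiv_comm f h p.1.1) (isoEquiv_comm g h p.1.2)))

/-- A split extension is the direct sum of its two ends, so it is determined by their classes. -/
theorem cls_eq_of_isClopen {M M' : F1Rep.{u, v} I} {L : Sub M} {L' : Sub M'} (hL : L.IsClopen)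
    (hL' : L'.IsClopen) (hr : cls L.rep = cls L'.rep) (hq : cls L.quot = cls L'.quot) :
    cls M = cls M' := by
  obtain ⟨f⟩ := cls_eq_iff.1 hr
  obtain ⟨g⟩ := cls_eq_iff.1 hq
  exact cls_eq (hL.sumIso.symm ≪≫ sumCongr f g ≪≫ hL'.sumIso)

/-- The rank of an edge map: the number of points not sent to the base point. -/
noncomputable def edgeRank (M : F1Rep.{u, v} I) {i j : I} (h : i ⟶ j) : ℕ :=
  Nat.card {x : M.V i // M.map h x ≠ 0}

theorem edgeRank_iso {M N : F1Rep.{u, v} I} (f : M ≅ N) {i j : I} (h : i ⟶ j) :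
    edgeRank M h = edgeRank N h :=
  Nat.card_congr ((isoEquiv f i).subtypeEquiv fun x => by
    rw [isoEquiv_comm, not_iff_not, isoEquiv_eq_zero])

/-- The points that are active in a sub-representation or in the quotient by it. -/
def activeOfSubQuot {M : F1Rep.{u, v} I} (L : Sub M) {i j : I} (h : i ⟶ j) :
    {x : L.rep.V i // L.rep.map h x ≠ 0} ⊕ {x : L.quot.V i // L.quot.map h x ≠ 0} →
      {x : M.V i // M.map h x ≠ 0} :=
  Sum.elim (fun x => ⟨L.repVal x.1, fun h0 => x.2 (L.repVal_eq_zero.1 h0)⟩)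
    fun x => ⟨L.quotVal x.1, fun h0 => (L.quot_map_ne_zero_iff h x.1).1 x.2 (h0 ▸ L.zero_mem j)⟩

theorem activeOfSubQuot_injective {M : F1Rep.{u, v} I} (L : Sub M) {i j : I} (h : i ⟶ j) :
    Function.Injective (activeOfSubQuot L h) := by
  refine Function.Injective.sumElim (fun x y e => ?_) (fun x y e => ?_) fun x y e => ?_
  · exact Subtype.ext (L.repVal_injective (congrArg (fun z : {x // M.map h x ≠ 0} => z.1) e))
  · exact Subtype.ext (L.quotVal_injective (congrArg (fun z : {x // M.map h x ≠ 0} => z.1) e))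
  · have e' : L.repVal x.1 = L.quotVal y.1 :=
      congrArg (fun z : {x // M.map h x ≠ 0} => z.1) e
    refine (L.quot_map_ne_zero_iff h y.1).1 y.2 ?_
    rw [← e']
    exact L.map_mem h _ (L.repVal_mem x.1)

theorem edgeRank_add_le {M : F1Rep.{u, v} I} (L : Sub M) {i j : I} (h : i ⟶ j) :
    edgeRank L.rep h + edgeRank L.quot h ≤ edgeRank M h := by
  unfold edgeRank
  rw [← Nat.card_sum]
  exact Nat.card_le_card_of_injective _ (activeOfSubQuot_injective L h)

/-- The active points of `L` and of the quotient inject into those of `M`. The points that are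
missed are exactly those outside `L` whose nonzero image falls into `L`. -/
theorem edgeRank_add_eq_iff {M : F1Rep.{u, v} I} (L : Sub M) {i j : I} (h : i ⟶ j) :
    edgeRank L.rep h + edgeRank L.quot h = edgeRank M h ↔
      ∀ x : M.V i, M.map h x ∈ L.carrier j → M.map h x ≠ 0 → x ∈ L.carrier i := by
  unfold edgeRank
  rw [← Nat.card_sum]
  constructor
  · intro hc x hx hne
    have hs := ((Nat.bijective_iff_injective_and_card _).2 ⟨activeOfSubQuot_injective L h, hc⟩).2
    obtain ⟨y | y, hy⟩ := hs ⟨x, hne⟩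
    · have e : L.repVal y.1 = x := congrArg (fun z : {x // M.map h x ≠ 0} => z.1) hy
      rw [← e]
      exact L.repVal_mem y.1
    · have e : L.quotVal y.1 = x := congrArg (fun z : {x // M.map h x ≠ 0} => z.1) hy
      rw [← e] at hx
      exact ((L.quot_map_ne_zero_iff h y.1).1 y.2 hx).elim
  · intro hc
    refine Nat.card_congr (Equiv.ofBijective _ ⟨activeOfSubQuot_injective L h, ?_⟩)
    rintro ⟨x, hx⟩
    by_cases hm : M.map h x ∈ L.carrier j
    · exact ⟨.inl ⟨L.repMk x (hc x hm hx), fun e => hx (L.repVal_eq_zero.2 e)⟩, rfl⟩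
    · exact ⟨.inr ⟨L.quotMk x fun hxL => (hm (L.map_mem h x hxL)).elim,
        (L.quot_map_ne_zero_iff h _).2 hm⟩, rfl⟩

section

variable [Finite I] [∀ i j : I, Finite (i ⟶ j)]

noncomputable instance : Fintype (Σ i j : I, i ⟶ j) := Fintype.ofFinite _

/-- The total rank of the edge maps. -/
noncomputable def rank (M : F1Rep.{u, v} I) : ℕ := ∑ h : (Σ i j : I, i ⟶ j), edgeRank M h.2.2

theorem rank_eq_of_cls_eq {M N : F1Rep.{u, v} I} (h : cls M = cls N) : rank M = rank N :=
  Finset.sum_congr rfl fun e _ => edgeRank_iso (cls_eq_iff.1 h).some e.2.2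

variable {M : F1Rep.{u, v} I} (L : Sub M)

theorem rank_add_le : rank L.rep + rank L.quot ≤ rank M := by
  unfold rank
  rw [← Finset.sum_add_distrib]
  exact Finset.sum_le_sum fun e _ => edgeRank_add_le L e.2.2

/-- Termwise inequalities with equal sums are equalities. Splitting thereby becomes a numerical
condition that depends only on isomorphism classes, and the rank can serve as an induction measure.
-/
theorem rank_add_eq_iff : rank L.rep + rank L.quot = rank M ↔ L.IsClopen := by
  unfold rank
  rw [← Finset.sum_add_distrib,
    Finset.sum_eq_sum_iff_of_le fun e _ => edgeRank_add_le L e.2.2]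
  simp only [edgeRank_add_eq_iff]
  exact ⟨fun h i j e => h ⟨i, j, e⟩ (Finset.mem_univ _), fun h e _ => h e.2.2⟩

end

/-- Pointwise inclusion of sub-representations of equal dimension is equality. -/
theorem Sub.eq_of_le {M : F1Rep.{u, v} I} {L L' : Sub M} (h : ∀ i, L.carrier i ⊆ L'.carrier i)
    (hd : dimVec L.rep = dimVec L'.rep) : L = L' := by
  refine Sub.ext (funext fun i => (h i).antisymm fun x hx => ?_)
  by_cases hx0 : x = 0
  · rw [hx0]; exact L.zero_mem i
  let f : {x : L.rep.V i // x ≠ 0} → {x : L'.rep.V i // x ≠ 0} :=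
    fun y => ⟨⟨y.1.1, h i y.1.2⟩, fun e => y.2 (Subtype.ext
      (congrArg Subtype.val e : y.1.1 = 0))⟩
  have hf : Function.Injective f := fun y z e =>
    Subtype.ext (Subtype.ext (congrArg (fun w => w.1.1) e))
  obtain ⟨y, hy⟩ := ((Nat.bijective_iff_injective_and_card f).2 ⟨hf, congrFun hd i⟩).2
    ⟨⟨x, hx⟩, fun e => hx0 (congrArg Subtype.val e)⟩
  have : y.1.1 = x := congrArg (fun w => w.1.1) hy
  rw [← this]
  exact y.1.2

theorem dimVec_eq_zero_iff {M : F1Rep.{u, v} I} {i : I} : dimVec M i = 0 ↔ ∀ x : M.V i, x = 0 := by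
  unfold dimVec
  rw [Finite.card_eq_zero_iff]
  exact ⟨fun h x => by_contra fun hx => h.false ⟨x, hx⟩, fun h => ⟨fun x => x.2 (h x.1)⟩⟩

theorem dimVec_eq_of_cls_eq {M N : F1Rep.{u, v} I} (h : cls M = cls N) : dimVec M = dimVec N :=
  dimVec_iso (cls_eq_iff.1 h).some

theorem Sub.mem_of_dimVec_quot {M : F1Rep.{u, v} I} {L : Sub M} {i : I} (h : dimVec L.quot i = 0)
    (x : M.V i) : x ∈ L.carrier i := by
  by_contra hx
  have : x = 0 := congrArg Subtype.val
    (dimVec_eq_zero_iff.1 h ⟨x, fun hx' => (hx hx').elim⟩)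
  exact hx (this ▸ L.zero_mem i)

theorem Sub.eq_zero_of_dimVec_rep {M : F1Rep.{u, v} I} {L : Sub M} {i : I} (h : dimVec L.rep i = 0)
    {x : M.V i} (hx : x ∈ L.carrier i) : x = 0 :=
  congrArg Subtype.val (dimVec_eq_zero_iff.1 h ⟨x, hx⟩)

end Clopen

end F1Rep

/-! ### Products of classes as counts of extensions -/

namespace HallAlgebra

open F1Rep

variable {I : Type u} [Quiver.{v} I] [Finite I] [∀ i j : I, Finite (i ⟶ j)]

omit [Finite I] [∀ i j : I, Finite (i ⟶ j)] in
open Classical in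
theorem toFinsupp_of (X Y : IsoClass.{u, v} I) :
    toFinsupp I (of X) Y = if X = Y then 1 else 0 := Finsupp.single_apply

/-- A product of functions, evaluated at the class of a representation. -/
theorem mul_apply_cls (f g : HallAlgebra.{u, v} I) (M : F1Rep.{u, v} I) :
    toFinsupp I (f * g) (cls M) =
      ∑ L : Sub M, toFinsupp I f (cls L.quot) * toFinsupp I g (cls L.rep) :=
  convolution_cls (A := ℂ) (fun _ => RingHom.id ℂ) f g M

open Classical in
theorem of_mul_of_apply_cls (X Y : IsoClass.{u, v} I) (M : F1Rep.{u, v} I) :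
    toFinsupp I (of X * of Y) (cls M) =
      ((Finset.univ.filter fun L : Sub M => cls L.quot = X ∧ cls L.rep = Y).card : ℂ) := by
  rw [mul_apply_cls, Finset.card_filter]
  push_cast
  refine Finset.sum_congr rfl fun L _ => ?_
  rw [toFinsupp_of, toFinsupp_of]
  simp only [eq_comm (a := X), eq_comm (a := Y)]
  split_ifs <;> simp_all

open Classical in
theorem eq_sum_of (f : HallAlgebra.{u, v} I) :
    f = ∑ X ∈ (toFinsupp I f).support, toFinsupp I f X • of X := by
  refine (toFinsupp I).injective ?_
  rw [map_sum]
  exact (Finsupp.sum_single (toFinsupp I f)).symm.trans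
    (Finset.sum_congr rfl fun X _ => Finsupp.ext fun Y => by
      rw [map_smul, Finsupp.smul_apply, toFinsupp_of, Finsupp.single_apply, smul_eq_mul,
        mul_ite, mul_one, mul_zero])

/-- If all other extensions of `M / L` by `L` lie in a subring of the Hall algebra that contains
`[M / L]` and `[L]`, and `L` is determined in `M` by these classes, then it contains `[M]`. -/
theorem of_mem_of_extensions (T : Subring (HallAlgebra.{u, v} I)) {M : F1Rep.{u, v} I} (L : Sub M)
    (hq : of (cls L.quot) ∈ T) (hr : of (cls L.rep) ∈ T)
    (huniq : ∀ L' : Sub M, cls L'.quot = cls L.quot → cls L'.rep = cls L.rep → L' = L)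
    (hext : ∀ (R : F1Rep.{u, v} I) (L' : Sub R), cls L'.quot = cls L.quot →
      cls L'.rep = cls L.rep → cls R ≠ cls M → of (cls R) ∈ T) : of (cls M) ∈ T := by
  classical
  set p := of (cls L.quot) * of (cls L.rep) with hp
  have hpT : p ∈ T := T.mul_mem hq hr
  -- By uniqueness of `L` the coefficient of `[M]` is exactly one, so `[M]` is recovered from the
  -- product without division. This is what makes the argument work for subrings.
  have h1 : toFinsupp I p (cls M) = 1 := by
    rw [hp, of_mul_of_apply_cls, Finset.card_eq_one.2 ⟨L, ?_⟩, Nat.cast_one]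
    ext L'
    simp only [Finset.mem_filter, Finset.mem_univ, true_and, Finset.mem_singleton]
    exact ⟨fun h => huniq L' h.1 h.2, fun h => h ▸ ⟨rfl, rfl⟩⟩
  have h2 : ∀ X ∈ (toFinsupp I p).support.erase (cls M), toFinsupp I p X • of X ∈ T := by
    intro X hX
    rw [Finset.mem_erase, Finsupp.mem_support_iff] at hX
    obtain ⟨hne, hX⟩ := hX
    rw [← cls_rep X] at hX hne ⊢
    rw [hp, of_mul_of_apply_cls] at hX ⊢
    obtain ⟨L', hL'⟩ := Finset.card_ne_zero.1 (Nat.cast_ne_zero.1 hX)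
    rw [Finset.mem_filter] at hL'
    rw [Nat.cast_smul_eq_nsmul]
    exact T.nsmul_mem (hext X.rep L' hL'.2.1 hL'.2.2 hne) _
  have h3 : p = of (cls M) + ∑ X ∈ (toFinsupp I p).support.erase (cls M),
      toFinsupp I p X • of X := by
    conv_lhs => rw [eq_sum_of p]
    rw [← Finset.add_sum_erase _ _ (Finsupp.mem_support_iff.2 (h1 ▸ one_ne_zero) :
      cls M ∈ (toFinsupp I p).support), h1, one_smul]
  rw [← add_sub_cancel_right (of (cls M)), ← h3]
  exact T.sub_mem hpT (T.sum_mem h2)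

end HallAlgebra

/-! ### Intervals and edges of the path -/

namespace PathNumbering

variable {I : Type u} [Quiver.{v} I] {n : ℕ} (N : PathNumbering I n)

/-- The vertices with positions in `[a, b]`. -/
def interval (a b : ℕ) : Set I := {i | a ≤ N.pos i ∧ N.pos i ≤ b}

theorem mem_interval {a b : ℕ} {i : I} : i ∈ N.interval a b ↔ a ≤ N.pos i ∧ N.pos i ≤ b := Iff.rfl

theorem card_hom_eq (i j : I) : Nat.card (i ⟶ j) + Nat.card (j ⟶ i) =
    if N.pos i + 1 = N.pos j ∨ N.pos j + 1 = N.pos i then 1 else 0 := N.card_hom i j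

theorem pos_ne {i j : I} (h : i ≠ j) : N.pos i ≠ N.pos j := mt (fun e => N.pos_injective e) h

variable [∀ i j : I, Finite (i ⟶ j)]

theorem adj_of_hom {i j : I} (h : i ⟶ j) : N.pos i + 1 = N.pos j ∨ N.pos j + 1 = N.pos i := by
  have h1 := N.card_hom_eq i j
  have h2 : 0 < Nat.card (i ⟶ j) := Nat.card_pos_iff.2 ⟨⟨h⟩, inferInstance⟩
  by_contra h3
  rw [if_neg h3] at h1
  omega

theorem subsingleton_hom (N : PathNumbering I n) (i j : I) : Subsingleton (i ⟶ j) := by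
  have h1 := N.card_hom_eq i j
  rw [← Finite.card_le_one_iff_subsingleton]
  split_ifs at h1 <;> omega

theorem isEmpty_hom (N : PathNumbering I n) {i j : I} (h : i ⟶ j) : IsEmpty (j ⟶ i) := by
  have h1 := N.card_hom_eq i j
  have h2 : 0 < Nat.card (i ⟶ j) := Nat.card_pos_iff.2 ⟨⟨h⟩, inferInstance⟩
  rw [← Finite.card_eq_zero_iff]
  split_ifs at h1 <;> omega

theorem exists_hom {i j : I} (h : N.pos i + 1 = N.pos j) : Nonempty (i ⟶ j) ∨ Nonempty (j ⟶ i) := by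
  have h1 := N.card_hom_eq i j
  rw [if_pos (Or.inl h)] at h1
  by_contra! h2
  simp only [← Finite.card_eq_zero_iff] at h2
  omega

end PathNumbering

/-! ### Representations with bijective edge maps, and indecomposable summands -/

namespace F1Rep

variable {I : Type u} [Quiver.{v} I]

/-- All edge maps between vertices in `S` are bijective. -/
structure IsBijOn (S : Set I) (M : F1Rep.{u, v} I) : Prop where
  eq_zero : ∀ ⦃i j : I⦄ (h : i ⟶ j), i ∈ S → j ∈ S → ∀ x, M.map h x = 0 → x = 0
  exists_map : ∀ ⦃i j : I⦄ (h : i ⟶ j), i ∈ S → j ∈ S → ∀ y, ∃ x, M.map h x = y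

/-- A representation supported on `S` all of whose edge maps inside `S` are bijective. -/
structure IsFull (S : Set I) (M : F1Rep.{u, v} I) : Prop extends IsBijOn S M where
  eq_zero_of_not_mem : ∀ ⦃i : I⦄, i ∉ S → ∀ x : M.V i, x = 0

theorem IsBijOn.of_iso {S : Set I} {M M' : F1Rep.{u, v} I} (hM : IsBijOn S M) (f : M ≅ M') :
    IsBijOn S M' where
  eq_zero i j h hi hj x hx := by
    obtain ⟨x, rfl⟩ := (isoEquiv f i).surjective x
    rw [isoEquiv_comm, isoEquiv_eq_zero] at hx
    rw [hM.eq_zero h hi hj x hx, isoEquiv_zero]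
  exists_map i j h hi hj y := by
    obtain ⟨y, rfl⟩ := (isoEquiv f j).surjective y
    obtain ⟨x, rfl⟩ := hM.exists_map h hi hj y
    exact ⟨isoEquiv f i x, isoEquiv_comm f h x⟩

theorem IsBijOn.of_cls {S : Set I} {M M' : F1Rep.{u, v} I} (hM : IsBijOn S M)
    (h : cls M = cls M') : IsBijOn S M' := hM.of_iso (cls_eq_iff.1 h).some

theorem IsBijOn.mono {S S' : Set I} {M : F1Rep.{u, v} I} (hM : IsBijOn S M) (h : S' ⊆ S) :
    IsBijOn S' M :=
  ⟨fun _ _ k hi hj => hM.eq_zero k (h hi) (h hj), fun _ _ k hi hj => hM.exists_map k (h hi) (h hj)⟩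

theorem IsFull.of_cls {S : Set I} {M M' : F1Rep.{u, v} I} (hM : IsFull S M)
    (h : cls M = cls M') : IsFull S M' :=
  ⟨hM.toIsBijOn.of_cls h, fun _ hi => dimVec_eq_zero_iff.1
    (dimVec_eq_of_cls_eq h ▸ dimVec_eq_zero_iff.2 (hM.eq_zero_of_not_mem hi))⟩

theorem isBijOn_rep_iff {S : Set I} {M : F1Rep.{u, v} I} {L : Sub M}
    (hL : ∀ i ∈ S, ∀ x, x ∈ L.carrier i) : IsBijOn S L.rep ↔ IsBijOn S M := by
  constructor
  · refine fun h => ⟨fun i j k hi hj x hx => ?_, fun i j k hi hj y => ?_⟩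
    · have := h.eq_zero k hi hj (L.repMk x (hL i hi x)) (L.repVal_eq_zero.1 hx)
      rw [← L.repVal_eq_zero] at this
      exact this
    · obtain ⟨x, hx⟩ := h.exists_map k hi hj (L.repMk y (hL j hj y))
      exact ⟨L.repVal x, congrArg L.repVal hx⟩
  · refine fun h => ⟨fun i j k hi hj x hx => ?_, fun i j k hi hj y => ?_⟩
    · rw [← L.repVal_eq_zero] at hx ⊢
      exact h.eq_zero k hi hj _ hx
    · obtain ⟨x, hx⟩ := h.exists_map k hi hj (L.repVal y)
      exact ⟨L.repMk x (hL i hi x), L.repVal_injective hx⟩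

theorem isBijOn_quot_iff {S : Set I} {M : F1Rep.{u, v} I} {L : Sub M}
    (hL : ∀ i ∈ S, ∀ x, x ∈ L.carrier i → x = 0) : IsBijOn S L.quot ↔ IsBijOn S M := by
  have key : ∀ ⦃i j : I⦄ (k : i ⟶ j), j ∈ S → ∀ x : L.quot.V i,
      L.quotVal (L.quot.map k x) = M.map k (L.quotVal x) := by
    intro i j k hj x
    by_cases hm : M.map k (L.quotVal x) ∈ L.carrier j
    · rw [L.quotVal_map_of_mem k x hm, hL j hj _ hm]
    · exact L.quotVal_map_of_not_mem k x hm
  constructor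
  · refine fun h => ⟨fun i j k hi hj x hx => ?_, fun i j k hi hj y => ?_⟩
    · have := h.eq_zero k hi hj (L.quotMk x (hL i hi x)) (by
        rw [← L.quotVal_eq_zero, key k hj]; exact hx)
      rw [← L.quotVal_eq_zero] at this
      exact this
    · obtain ⟨x, hx⟩ := h.exists_map k hi hj (L.quotMk y (hL j hj y))
      exact ⟨L.quotVal x, by rw [← key k hj, hx, L.quotVal_quotMk]⟩
  · refine fun h => ⟨fun i j k hi hj x hx => ?_, fun i j k hi hj y => ?_⟩
    · rw [← L.quotVal_eq_zero] at hx ⊢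
      rw [key k hj] at hx
      exact h.eq_zero k hi hj _ hx
    · obtain ⟨x, hx⟩ := h.exists_map k hi hj (L.quotVal y)
      exact ⟨L.quotMk x (hL i hi x), L.quotVal_injective (by rw [key k hj]; exact hx)⟩

theorem IsBijOn.bijective {S : Set I} {M : F1Rep.{u, v} I} (hM : IsBijOn S M) {i j : I} (h : i ⟶ j)
    (hi : i ∈ S) (hj : j ∈ S) : Function.Bijective (M.map h) := by
  refine ⟨fun x y e => ?_, hM.exists_map h hi hj⟩
  by_cases hx : M.map h x = 0
  · rw [hM.eq_zero h hi hj x hx, hM.eq_zero h hi hj y (e ▸ hx)]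
  · exact M.map_inj h x y hx e

/-- A nonzero value in `L` is also the image of a point of `L`, because the edge maps of `L` inside
`S` are onto. Injectivity away from the base point identifies the two preimages. Thus an extension
supported on `S` with a full subobject always splits. -/
theorem Sub.isClopen_of_isFull {S : Set I} {M : F1Rep.{u, v} I} {L : Sub M} (hL : IsFull S L.rep)
    (hM : ∀ i ∉ S, ∀ x : M.V i, x = 0) : L.IsClopen := by
  intro i j h x hx hx0
  have hj : j ∈ S := by
    by_contra hj
    exact hx0 (hM j hj _)
  have hi : i ∈ S := by
    by_contra hi
    rw [hM i hi x, M.map_zero] at hx0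
    exact hx0 rfl
  obtain ⟨y, hy⟩ := hL.exists_map h hi hj (L.repMk _ hx)
  rw [M.map_inj h x (L.repVal y) hx0 (congrArg L.repVal hy).symm]
  exact L.repVal_mem y

/-- The largest direct summand that is full on `S`. -/
def isoPart (S : Set I) (M : F1Rep.{u, v} I) : Sub M where
  -- Unions of subrepresentations are again subrepresentations over 𝔽₁, since there is no addition
  -- to respect.
  carrier i := {x | x = 0 ∨ ∃ C : Sub M, C.IsClopen ∧ IsFull S C.rep ∧ x ∈ C.carrier i}
  zero_mem i := Or.inl rfl
  map_mem h x hx := by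
    rcases hx with rfl | ⟨C, h1, h2, h3⟩
    · exact Or.inl (M.map_zero h)
    · exact Or.inr ⟨C, h1, h2, C.map_mem h x h3⟩

theorem isoPart_isClopen (S : Set I) (M : F1Rep.{u, v} I) : (isoPart S M).IsClopen := by
  rintro i j h x (hx | ⟨C, h1, h2, h3⟩) hx0
  · exact (hx0 hx).elim
  · exact Or.inr ⟨C, h1, h2, h1 h x h3 hx0⟩

theorem le_isoPart {S : Set I} {M : F1Rep.{u, v} I} {C : Sub M} (hC : C.IsClopen)
    (hC' : IsFull S C.rep) (i : I) : C.carrier i ⊆ (isoPart S M).carrier i :=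
  fun _ hx => Or.inr ⟨C, hC, hC', hx⟩

theorem isoPart_isFull (S : Set I) (M : F1Rep.{u, v} I) : IsFull S (isoPart S M).rep where
  eq_zero i j h hi hj x hx := by
    rw [← Sub.repVal_eq_zero] at hx ⊢
    obtain h0 | ⟨C, h1, h2, h3⟩ := Sub.repVal_mem _ x
    · exact h0
    · have := h2.eq_zero h hi hj (C.repMk _ h3) (C.repVal_eq_zero.1 hx)
      rw [← C.repVal_eq_zero] at this
      exact this
  exists_map i j h hi hj y := by
    obtain h0 | ⟨C, h1, h2, h3⟩ := Sub.repVal_mem _ y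
    · rw [Sub.repVal_eq_zero] at h0
      exact ⟨0, by rw [h0, F1Rep.map_zero]⟩
    · obtain ⟨x, hx⟩ := h2.exists_map h hi hj (C.repMk _ h3)
      exact ⟨Sub.repMk _ (C.repVal x) (le_isoPart h1 h2 i (C.repVal_mem x)),
        Sub.repVal_injective _ (congrArg C.repVal hx)⟩
  eq_zero_of_not_mem i hi x := by
    rw [← Sub.repVal_eq_zero]
    obtain h0 | ⟨C, h1, h2, h3⟩ := Sub.repVal_mem _ x
    · exact h0
    · have := h2.eq_zero_of_not_mem hi (C.repMk _ h3)
      rw [← C.repVal_eq_zero] at this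
      exact this

/-- A clopen subrepresentation of this class is itself full, hence contained in the largest one, and
the dimensions agree. -/
theorem eq_isoPart {S : Set I} {M : F1Rep.{u, v} I} {C : Sub M} (hC : C.IsClopen)
    (h : cls C.rep = cls (isoPart S M).rep) : C = isoPart S M :=
  Sub.eq_of_le (le_isoPart hC ((isoPart_isFull S M).of_cls h.symm)) (dimVec_eq_of_cls_eq h)

section Chain

variable {n : ℕ} (N : PathNumbering I n)

/-- Two points are matched by an edge map. -/
def Linked (M : F1Rep.{u, v} I) {i j : I} (x : M.V i) (y : M.V j) : Prop :=
  (∃ h : i ⟶ j, M.map h x = y) ∨ ∃ h : j ⟶ i, M.map h y = x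

/-- A family of nonzero points at the vertices of an interval that are matched by the edge maps. -/
structure IsChain (M : F1Rep.{u, v} I) (a b : ℕ) (c : ∀ i, M.V i) : Prop where
  ne_zero_iff : ∀ i, c i ≠ 0 ↔ i ∈ N.interval a b
  map_eq : ∀ ⦃i j : I⦄ (h : i ⟶ j), c i ≠ 0 → c j ≠ 0 → M.map h (c i) = c j

variable {N} {M : F1Rep.{u, v} I}

variable [∀ i j : I, Finite (i ⟶ j)]

-- The hypothesis `hadj` leaves `i` as the only vertex of the old interval adjacent to `j`. There is
-- at most one edge between them, and in one direction only, so the link is the only new condition.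
open Classical in
theorem IsChain.update {a b a' b' : ℕ} {c : ∀ i, M.V i} (hc : IsChain N M a b c) {i j : I}
    (hi : c i ≠ 0) (hj : c j = 0) {y : M.V j} (hy : y ≠ 0) (hl : Linked M (c i) y)
    (hI : ∀ k, k ∈ N.interval a' b' ↔ k ∈ N.interval a b ∨ k = j)
    (hadj : ∀ k ∈ N.interval a b, (N.pos k + 1 = N.pos j ∨ N.pos j + 1 = N.pos k) → k = i) :
    IsChain N M a' b' (Function.update c j y) where
  ne_zero_iff k := by
    rw [hI]
    by_cases hk : k = j
    · subst hk; simp [hy]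
    · rw [Function.update_of_ne hk, hc.ne_zero_iff]; simp [hk]
  map_eq k l h hk hl' := by
    by_cases hkj : k = j
    · subst hkj
      have hlk : l ≠ k := by
        rintro rfl; have := N.adj_of_hom h; omega
      rw [Function.update_of_ne hlk] at hl' ⊢
      rw [Function.update_self]
      obtain rfl := hadj l ((hc.ne_zero_iff l).1 hl') (N.adj_of_hom h).symm
      rcases hl with ⟨h', _⟩ | ⟨h', e⟩
      · exact ((N.isEmpty_hom h).false h').elim
      · rw [← e, (N.subsingleton_hom _ _).elim h h']
    · rw [Function.update_of_ne hkj] at hk ⊢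
      by_cases hlj : l = j
      · subst hlj
        rw [Function.update_self]
        obtain rfl := hadj k ((hc.ne_zero_iff k).1 hk) (N.adj_of_hom h)
        rcases hl with ⟨h', e⟩ | ⟨h', _⟩
        · rw [← e, (N.subsingleton_hom _ _).elim h h']
        · exact ((N.isEmpty_hom h).false h').elim
      · rw [Function.update_of_ne hlj] at hl' ⊢
        exact hc.map_eq h hk hl'

theorem IsChain.exists_update {a b : ℕ} (hb : b < n) {c : ∀ i, M.V i} (hc : IsChain N M a b c)
    {i j : I} (hi : c i ≠ 0) (hj : c j = 0) {y : M.V j} (hy : y ≠ 0) (hl : Linked M (c i) y) :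
    ∃ a' b', b' < n ∧ b - a < b' - a' ∧ ∃ c', IsChain N M a' b' c' ∧
      ∀ k, c k ≠ 0 → c' k = c k := by
  classical
  have hiI := (hc.ne_zero_iff i).1 hi
  have hjI : j ∉ N.interval a b := by rw [← hc.ne_zero_iff]; simpa using hj
  have hij : N.pos i + 1 = N.pos j ∨ N.pos j + 1 = N.pos i := by
    rcases hl with ⟨h, _⟩ | ⟨h, _⟩
    · exact N.adj_of_hom h
    · exact (N.adj_of_hom h).symm
  rw [N.mem_interval] at hiI hjI
  have hjn := N.pos_lt j
  have hup : ∀ k, c k ≠ 0 → Function.update c j y k = c k := by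
    intro k hk
    exact Function.update_of_ne (fun e => hk (by rw [e, hj])) _ _
  rcases hij with h | h
  · refine ⟨a, b + 1, by omega, by omega, Function.update c j y,
      hc.update hi hj hy hl (fun k => ?_) (fun k hk hkj => N.pos_injective ?_), hup⟩
    · rw [← N.pos_injective.eq_iff, N.mem_interval, N.mem_interval]; omega
    · rw [N.mem_interval] at hk; omega
  -- Here `j` lies immediately to the left of the interval, so `a ≥ 1` and the subtraction is exact.
  · refine ⟨a - 1, b, by omega, by omega, Function.update c j y,
      hc.update hi hj hy hl (fun k => ?_) (fun k hk hkj => N.pos_injective ?_), hup⟩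
    · rw [← N.pos_injective.eq_iff, N.mem_interval, N.mem_interval]; omega
    · rw [N.mem_interval] at hk; omega

/-- Every chain is contained in a maximal one. -/
theorem IsChain.exists_maximal {a b : ℕ} (hb : b < n) {c : ∀ i, M.V i} (hc : IsChain N M a b c) :
    ∃ a' b' c', b' < n ∧ IsChain N M a' b' c' ∧ (∀ k, c k ≠ 0 → c' k = c k) ∧
      ∀ ⦃i j : I⦄ (y : M.V j), c' i ≠ 0 → y ≠ 0 → Linked M (c' i) y → c' j ≠ 0 := by
  generalize hm : n - (b - a) = m
  induction m using Nat.strong_induction_on generalizing a b c with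
  | _ m ih =>
    by_cases hmax : ∀ ⦃i j : I⦄ (y : M.V j), c i ≠ 0 → y ≠ 0 → Linked M (c i) y → c j ≠ 0
    · exact ⟨a, b, c, hb, hc, fun _ _ => rfl, hmax⟩
    · push Not at hmax
      obtain ⟨i, j, y, hi, hy, hl, hj⟩ := hmax
      obtain ⟨a', b', hb', hlt, c', hc', hcc'⟩ := hc.exists_update hb hi hj hy hl
      obtain ⟨a'', b'', c'', h0, h1, h2, h3⟩ := ih _ (by omega) hb' hc' rfl
      exact ⟨a'', b'', c'', h0, h1, fun k hk => by
        rw [h2 k (by rw [hcc' k hk]; exact hk), hcc' k hk], h3⟩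

/-- Every nonzero point lies in an indecomposable direct summand: it is full on an interval, with
exactly one nonzero point at every vertex of the interval. -/
theorem exists_isFull_mem (N : PathNumbering I n) {i : I} (x : M.V i) (hx : x ≠ 0) :
    ∃ (a b : ℕ) (C : Sub M), b < n ∧ C.IsClopen ∧ IsFull (N.interval a b) C.rep ∧ x ∈ C.carrier i ∧
      ∀ j, dimVec C.rep j = Set.indicator (N.interval a b) 1 j := by
  classical
  have h0 : IsChain N M (N.pos i) (N.pos i) (Function.update 0 i x) := by
    constructor
    · intro k
      rw [N.mem_interval]
      by_cases hk : k = i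
      · subst hk; simp [hx]
      · rw [Function.update_of_ne hk]
        have := N.pos_ne hk
        simp only [Pi.zero_apply, ne_eq, not_true_eq_false, false_iff]
        omega
    · intro k l h hk hl
      have hk' : k = i := by
        by_contra hki; rw [Function.update_of_ne hki] at hk; exact hk rfl
      have hl' : l = i := by
        by_contra hli; rw [Function.update_of_ne hli] at hl; exact hl rfl
      have := N.adj_of_hom h
      rw [hk', hl'] at this
      omega
  obtain ⟨a, b, c, hb, hc, hci, hmax⟩ := h0.exists_maximal (N.pos_lt i)
  have hci : c i = x := by simpa using hci i (by simpa using hx)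
  have hmap : ∀ ⦃k l : I⦄ (h : k ⟶ l), c k ≠ 0 → M.map h (c k) ≠ 0 → M.map h (c k) = c l :=
    fun k l h hk hne => hc.map_eq h hk (hmax _ hk hne (Or.inl ⟨h, rfl⟩))
  -- The summand consists of the base points and a maximal chain through `x`. By maximality a point
  -- of the chain has no nonzero image off the chain, which makes `C` a subrepresentation, and no
  -- preimage off the chain, which makes it clopen.
  let C : Sub M :=
    { carrier := fun k => {y | y = 0 ∨ y = c k}
      zero_mem := fun k => Or.inl rfl
      map_mem := fun {k l} h y hy => by
        rcases hy with rfl | rfl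
        · exact Or.inl (M.map_zero h)
        · by_cases h1 : M.map h (c k) = 0
          · exact Or.inl h1
          · exact Or.inr (hmap h (fun h2 => h1 (by rw [h2, M.map_zero])) h1) }
  have hmem : ∀ {k} (y : M.V k), y ∈ C.carrier k ↔ y = 0 ∨ y = c k := fun y => Iff.rfl
  refine ⟨a, b, C, hb, ?_, ⟨⟨?_, ?_⟩, ?_⟩, Or.inr hci.symm, ?_⟩
  · rintro k l h y (hy | hy) hy0
    · exact (hy0 hy).elim
    · rw [hy] at hy0
      have hyk : y ≠ 0 := fun h0 => hy0 (by rw [← hy, h0, M.map_zero])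
      have hk := hmax y hy0 hyk (Or.inr ⟨h, hy⟩)
      exact Or.inr (M.map_inj h _ _ (hy ▸ hy0) (hy.trans (hc.map_eq h hk hy0).symm))
  · intro k l h hk hl y hy
    rw [← C.repVal_eq_zero] at hy ⊢
    rcases (hmem _).1 (C.repVal_mem y) with h1 | h1
    · exact h1
    · rw [C.repVal_map, h1, hc.map_eq h ((hc.ne_zero_iff k).2 hk) ((hc.ne_zero_iff l).2 hl)] at hy
      exact ((hc.ne_zero_iff l).2 hl hy).elim
  · intro k l h hk hl y
    rcases (hmem _).1 (C.repVal_mem y) with h1 | h1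
    · exact ⟨0, by rw [C.rep.map_zero, C.repVal_eq_zero.1 h1]⟩
    · refine ⟨C.repMk (c k) (Or.inr rfl), C.repVal_injective ?_⟩
      rw [h1]
      exact hc.map_eq h ((hc.ne_zero_iff k).2 hk) ((hc.ne_zero_iff l).2 hl)
  · intro k hk y
    rw [← C.repVal_eq_zero]
    rcases (hmem _).1 (C.repVal_mem y) with h1 | h1
    · exact h1
    · rw [h1]; by_contra h2; exact hk ((hc.ne_zero_iff k).1 h2)
  · intro k
    by_cases hk : k ∈ N.interval a b
    · rw [Set.indicator_of_mem hk, Pi.one_apply]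
      unfold dimVec
      rw [Nat.card_eq_one_iff_unique]
      refine ⟨⟨fun y z => ?_⟩, ⟨⟨C.repMk (c k) (Or.inr rfl), fun h =>
        (hc.ne_zero_iff k).2 hk (C.repVal_eq_zero.2 h)⟩⟩⟩
      refine Subtype.ext (C.repVal_injective ?_)
      rw [((hmem _).1 (C.repVal_mem y.1)).resolve_left fun h => y.2 (C.repVal_eq_zero.1 h),
        ((hmem _).1 (C.repVal_mem z.1)).resolve_left fun h => z.2 (C.repVal_eq_zero.1 h)]
    · rw [Set.indicator_of_notMem hk, dimVec_eq_zero_iff]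
      intro y
      rw [← C.repVal_eq_zero]
      rcases (hmem _).1 (C.repVal_mem y) with h1 | h1
      · exact h1
      · rw [h1]; by_contra h2; exact hk ((hc.ne_zero_iff k).1 h2)

end Chain

section FullIso

variable {n : ℕ} [∀ i j : I, Finite (i ⟶ j)]

omit [∀ i j : I, Finite (i ⟶ j)] in
theorem exists_equiv_of_dimVec_eq {M M' : F1Rep.{u, v} I} (hd : dimVec M = dimVec M') (i : I) :
    ∃ e : M.V i ≃ M'.V i, e 0 = 0 := by
  classical
  have h : Nat.card {x : M.V i // x ≠ 0} = Nat.card {x : M'.V i // x ≠ 0} := congrFun hd i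
  refine ⟨(Equiv.optionSubtypeNe (0 : M.V i)).symm.trans
    ((Equiv.optionCongr (((Finite.equivFin _).trans
      ((finCongr h).trans (Finite.equivFin _).symm)))).trans
        (Equiv.optionSubtypeNe (0 : M'.V i))), ?_⟩
  rw [Equiv.trans_apply, Equiv.trans_apply, Equiv.optionSubtypeNe_symm_self,
    Equiv.optionCongr_apply, Option.map_none, Equiv.optionSubtypeNe_none]

/-- Full representations are determined by their dimension vectors. -/
theorem IsFull.cls_eq (N : PathNumbering I n) {S : Set I} {M M' : F1Rep.{u, v} I}
    (hM : IsFull S M) (hM' : IsFull S M')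
    (hd : dimVec M = dimVec M') : cls M = cls M' := by
  classical
  -- The isomorphism is built vertex by vertex along the path. If positions `m - 1` and `m` both lie
  -- in `S`, the bijection at `m` is transported through the bijective edge maps; otherwise any
  -- pointed bijection does. A path has no cycles, so no further compatibility arises.
  have key : ∀ m : ℕ, ∃ e : ∀ i, M.V i ≃ M'.V i, (∀ i, e i 0 = 0) ∧
      ∀ ⦃i j : I⦄ (h : i ⟶ j), i ∈ S → j ∈ S → N.pos i < m → N.pos j < m →
        ∀ x, M'.map h (e i x) = e j (M.map h x) := by
    intro m
    induction m with
    | zero =>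
      choose e he using exists_equiv_of_dimVec_eq hd
      exact ⟨e, he, fun i j h hi hj h0 => by omega⟩
    | succ m ih =>
      obtain ⟨e, he, hc⟩ := ih
      by_cases hk : ∃ k l : I, N.pos k = m ∧ N.pos l + 1 = m ∧ k ∈ S ∧ l ∈ S
      · obtain ⟨k, l, hkm, hlm, hkS, hlS⟩ := hk
        have hkl : l ≠ k := by rintro rfl; omega
        obtain ⟨f, hf0, hf⟩ : ∃ f : M.V k ≃ M'.V k, f 0 = 0 ∧
            (∀ h : l ⟶ k, ∀ x, M'.map h (e l x) = f (M.map h x)) ∧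
            (∀ h : k ⟶ l, ∀ x, M'.map h (f x) = e l (M.map h x)) := by
          rcases N.exists_hom (show N.pos l + 1 = N.pos k by omega) with ⟨⟨h⟩⟩ | ⟨⟨h⟩⟩
          · let g := Equiv.ofBijective _ (hM.bijective h hlS hkS)
            let g' := Equiv.ofBijective _ (hM'.bijective h hlS hkS)
            refine ⟨g.symm.trans ((e l).trans g'), ?_, fun h' x => ?_, fun h' =>
              ((N.isEmpty_hom h).false h').elim⟩
            · have : g.symm 0 = 0 := by rw [Equiv.symm_apply_eq]; exact (M.map_zero h).symm
              rw [Equiv.trans_apply, Equiv.trans_apply, this, he]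
              exact M'.map_zero h
            · obtain rfl := (N.subsingleton_hom _ _).elim h h'
              have : g.symm (M.map h x) = x := g.symm_apply_apply x
              rw [Equiv.trans_apply, Equiv.trans_apply, this]
              rfl
          · let g := Equiv.ofBijective _ (hM.bijective h hkS hlS)
            let g' := Equiv.ofBijective _ (hM'.bijective h hkS hlS)
            refine ⟨g.trans ((e l).trans g'.symm), ?_, fun h' =>
              ((N.isEmpty_hom h).false h').elim, fun h' x => ?_⟩
            · have : g 0 = 0 := M.map_zero h
              rw [Equiv.trans_apply, Equiv.trans_apply, this, he, Equiv.symm_apply_eq]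
              exact (M'.map_zero h).symm
            · obtain rfl := (N.subsingleton_hom _ _).elim h h'
              exact g'.apply_symm_apply _
        refine ⟨Function.update e k f, fun i => ?_, fun i j h hi hj him hjm x => ?_⟩
        · by_cases hik : i = k
          · subst hik; rw [Function.update_self, hf0]
          · rw [Function.update_of_ne hik, he]
        · by_cases hik : i = k
          · subst hik
            have hadj := N.adj_of_hom h
            obtain rfl : j = l := N.pos_injective (by omega)
            rw [Function.update_self, Function.update_of_ne hkl, hf.2]
          · by_cases hjk : j = k
            · subst hjk
              have hadj := N.adj_of_hom h
              have hil : i = l := N.pos_injective (by omega)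
              subst hil
              rw [Function.update_self, Function.update_of_ne hkl, hf.1]
            · rw [Function.update_of_ne hik, Function.update_of_ne hjk]
              have h1 := N.pos_ne hik
              have h2 := N.pos_ne hjk
              exact hc h hi hj (by omega) (by omega) x
      · refine ⟨e, he, fun i j h hi hj him hjm => ?_⟩
        have hadj := N.adj_of_hom h
        refine hc h hi hj (lt_of_le_of_ne (by omega) fun h1 => hk ⟨i, j, h1, by omega, hi, hj⟩)
          (lt_of_le_of_ne (by omega) fun h1 => hk ⟨j, i, h1, by omega, hj, hi⟩)
  obtain ⟨e, he, hc⟩ := key n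
  refine F1Rep.cls_eq (mkIso e he fun {i j} h x => ?_)
  by_cases hi : i ∈ S
  · by_cases hj : j ∈ S
    · exact hc h hi hj (N.pos_lt i) (N.pos_lt j) x
    · rw [hM'.eq_zero_of_not_mem hj (M'.map h (e i x)), hM.eq_zero_of_not_mem hj (M.map h x), he]
  · rw [hM.eq_zero_of_not_mem hi x, he, M.map_zero, M'.map_zero, he]

end FullIso

end F1Rep

/-! ### Subrepresentations cut out by sets of vertices, and total dimension -/

namespace F1Rep

variable {I : Type u} [Quiver.{v} I]

theorem dimVec_eq_of_sub {M R : F1Rep.{u, v} I} {L : Sub M} {L' : Sub R}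
    (hq : cls L'.quot = cls L.quot) (hr : cls L'.rep = cls L.rep) : dimVec R = dimVec M := by
  funext i
  rw [dimVec_sub_quot L i, dimVec_sub_quot L' i, dimVec_eq_of_cls_eq hq, dimVec_eq_of_cls_eq hr]

theorem IsBijOn.dimVec_eq {S : Set I} {M : F1Rep.{u, v} I} (hM : IsBijOn S M) {i j : I} (h : i ⟶ j)
    (hi : i ∈ S) (hj : j ∈ S) : dimVec M i = dimVec M j :=
  Nat.card_congr ((Equiv.ofBijective _ (hM.bijective h hi hj)).subtypeEquiv fun x => by
    rw [Equiv.ofBijective_apply, not_iff_not]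
    exact ⟨fun e => by rw [e, M.map_zero], hM.eq_zero h hi hj x⟩)

/-- The sub-representation `L` consists of the spaces at the vertices in `U`. -/
def Sub.IsSupport (U : Set I) {M : F1Rep.{u, v} I} (L : Sub M) : Prop :=
  ∀ i (x : M.V i), x ∈ L.carrier i ↔ x = 0 ∨ i ∈ U

/-- The dimension vectors of the two ends detect the condition, so it carries over to every other
extension of the same classes. -/
theorem Sub.isSupport_iff {U : Set I} {M : F1Rep.{u, v} I} {L : Sub M} : L.IsSupport U ↔
    (∀ i ∉ U, dimVec L.rep i = 0) ∧ ∀ i ∈ U, dimVec L.quot i = 0 := by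
  constructor
  · refine fun h => ⟨fun i hi => dimVec_eq_zero_iff.2 fun x => ?_,
      fun i hi => dimVec_eq_zero_iff.2 fun x => ?_⟩
    · rw [← L.repVal_eq_zero]
      exact ((h i _).1 (L.repVal_mem x)).resolve_right hi
    · rw [← L.quotVal_eq_zero]
      exact L.quotVal_eq_zero_of_mem x ((h i _).2 (Or.inr hi))
  · rintro ⟨h1, h2⟩ i x
    constructor
    · intro hx
      by_cases hi : i ∈ U
      · exact Or.inr hi
      · exact Or.inl (Sub.eq_zero_of_dimVec_rep (h1 i hi) hx)
    · rintro (rfl | hi)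
      · exact L.zero_mem i
      · exact Sub.mem_of_dimVec_quot (h2 i hi) x

theorem Sub.IsSupport.of_cls {U : Set I} {M R : F1Rep.{u, v} I} {L : Sub M} {L' : Sub R}
    (h : L.IsSupport U) (hq : cls L'.quot = cls L.quot) (hr : cls L'.rep = cls L.rep) :
    L'.IsSupport U := by
  rw [isSupport_iff] at h ⊢
  rwa [dimVec_eq_of_cls_eq hq, dimVec_eq_of_cls_eq hr]

theorem Sub.IsSupport.eq {U : Set I} {M : F1Rep.{u, v} I} {L L' : Sub M} (h : L.IsSupport U)
    (h' : L'.IsSupport U) : L = L' :=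
  Sub.ext (funext fun i => Set.ext fun x => (h i x).trans (h' i x).symm)

theorem exists_isSupport (U : Set I) (M : F1Rep.{u, v} I)
    (hU : ∀ ⦃i j : I⦄ (h : i ⟶ j), i ∈ U → j ∉ U → ∀ x, M.map h x = 0) :
    ∃ L : Sub M, L.IsSupport U :=
  ⟨{ carrier := fun i => {x | x = 0 ∨ i ∈ U}
     zero_mem := fun _ => Or.inl rfl
     map_mem := fun {i j} h x hx => by
      by_cases hj : j ∈ U
      · exact Or.inr hj
      · rcases hx with rfl | hi
        · exact Or.inl (M.map_zero h)
        · exact Or.inl (hU h hi hj x) }, fun _ _ => Iff.rfl⟩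

section TotalDim

variable [Fintype I]

/-- The total dimension. -/
noncomputable def totalDim (M : F1Rep.{u, v} I) : ℕ := ∑ i, dimVec M i

theorem totalDim_sub_quot {M : F1Rep.{u, v} I} (L : Sub M) :
    totalDim M = totalDim L.quot + totalDim L.rep := by
  unfold totalDim
  rw [← Finset.sum_add_distrib]
  exact Finset.sum_congr rfl fun i _ => dimVec_sub_quot L i

theorem totalDim_eq_zero_iff {M : F1Rep.{u, v} I} :
    totalDim M = 0 ↔ cls M = cls (zeroRep I) := by
  rw [cls_eq_zero, totalDim, Finset.sum_eq_zero_iff]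
  simp only [dimVec_eq_zero_iff, Finset.mem_univ, forall_const]

theorem totalDim_rep_lt {M : F1Rep.{u, v} I} {L : Sub M} (h : L ≠ Sub.top M) :
    totalDim L.rep < totalDim M := by
  rw [ne_eq, Sub.eq_top_iff, ← totalDim_eq_zero_iff] at h
  rw [totalDim_sub_quot L]
  omega

theorem totalDim_quot_lt {M : F1Rep.{u, v} I} {L : Sub M} (h : L ≠ Sub.bot M) :
    totalDim L.quot < totalDim M := by
  rw [ne_eq, Sub.eq_bot_iff, ← totalDim_eq_zero_iff] at h
  rw [totalDim_sub_quot L]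
  omega

omit [Fintype I] in
theorem Sub.IsSupport.ne_top {U : Set I} {M : F1Rep.{u, v} I} {L : Sub M} (h : L.IsSupport U)
    {i : I} (hi : i ∉ U) (hd : dimVec M i ≠ 0) : L ≠ Sub.top M := by
  rintro rfl
  exact hd (dimVec_eq_zero_iff.2 fun x => ((h i x).1 trivial).resolve_right hi)

omit [Fintype I] in
theorem Sub.IsSupport.ne_bot {U : Set I} {M : F1Rep.{u, v} I} {L : Sub M} (h : L.IsSupport U)
    {i : I} (hi : i ∈ U) (hd : dimVec M i ≠ 0) : L ≠ Sub.bot M := by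
  rintro rfl
  exact hd (dimVec_eq_zero_iff.2 fun x => (h i x).2 (Or.inr hi))

theorem rank_le [∀ i j : I, Finite (i ⟶ j)] (M : F1Rep.{u, v} I) :
    rank M ≤ ∑ h : (Σ i j : I, i ⟶ j), dimVec M h.1 := by
  refine Finset.sum_le_sum fun h _ => ?_
  refine Nat.card_le_card_of_injective (fun x => ⟨x.1, fun h0 => x.2 ?_⟩) fun x y e =>
    Subtype.ext (congrArg (fun z : {x : M.V h.1 // x ≠ 0} => z.1) e)
  rw [h0, M.map_zero]

end TotalDim

end F1Rep

/-! ### Generation by representations concentrated at one vertex -/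

namespace HallAlgebra

open F1Rep

variable {I : Type u} [Quiver.{v} I] [Fintype I] [∀ i j : I, Finite (i ⟶ j)]
  {n : ℕ} (N : PathNumbering I n) (T : Subring (HallAlgebra.{u, v} I))

/-- The subobject used is `isoPart S M`. Any subrepresentation of `M` with the same two classes has
the same rank sum, hence is clopen and equal to it. Split extensions of these classes are isomorphic
to `M`, so only the nonsplit ones are left to `hext`. -/
theorem of_mem_of_isPart {S : Set I} {M : F1Rep.{u, v} I}
    (ih : ∀ R : F1Rep.{u, v} I, totalDim R < totalDim M → of (cls R) ∈ T)
    (hbot : isoPart S M ≠ Sub.bot M) (htop : isoPart S M ≠ Sub.top M)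
    (hext : ∀ (R : F1Rep.{u, v} I) (L : Sub R), cls L.quot = cls (isoPart S M).quot →
      cls L.rep = cls (isoPart S M).rep → ¬ L.IsClopen → of (cls R) ∈ T) : of (cls M) ∈ T := by
  refine of_mem_of_extensions T (isoPart S M) (ih _ (totalDim_quot_lt hbot))
    (ih _ (totalDim_rep_lt htop)) (fun L hq hr => ?_) fun R L hq hr hne => ?_
  · refine eq_isoPart ?_ hr
    rw [← rank_add_eq_iff, rank_eq_of_cls_eq hq, rank_eq_of_cls_eq hr, rank_add_eq_iff]
    exact isoPart_isClopen S M
  · exact hext R L hq hr fun hL => hne (cls_eq_of_isClopen hL (isoPart_isClopen S M) hr hq)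

/-- The last edge `h` of the interval is the only one that crosses between `U` and its complement,
so the extensions of the two restrictions of `M` differ from `M` only in the map along `h`. If that
map is zero, the extension is a direct sum and arises from the product in the opposite order. If
not, a point with nonzero image lies in a summand that is full on the whole interval, and this can
be split off. -/
theorem of_mem_of_isFull_of_cut {M : F1Rep.{u, v} I} {a b : ℕ}
    (hM : IsFull (N.interval a b) M) (hd : ∀ i ∈ N.interval a b, dimVec M i ≠ 0)
    (ih : ∀ R : F1Rep.{u, v} I, totalDim R < totalDim M → of (cls R) ∈ T) {s t : I} (h : s ⟶ t)
    (hs : s ∈ N.interval a b) (ht : t ∈ N.interval a b)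
    (hst : N.pos s = b ∧ N.pos t + 1 = b ∨ N.pos t = b ∧ N.pos s + 1 = b)
    (U : Set I) (hsU : s ∉ U) (htU : t ∈ U)
    (hU : ∀ ⦃i j : I⦄, (i ⟶ j) → i ∈ N.interval a b → j ∈ N.interval a b →
      (i ∈ U ↔ j ∈ U) ∨ i = s ∧ j = t) : of (cls M) ∈ T := by
  set S := N.interval a b with hS
  obtain ⟨L₀, hL₀⟩ := exists_isSupport U M fun i j k hi hj x => by
    by_cases hjS : j ∈ S
    · by_cases hiS : i ∈ S
      · rcases hU k hiS hjS with h1 | ⟨rfl, -⟩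
        · exact (hj (h1.1 hi)).elim
        · exact (hsU hi).elim
      · rw [hM.eq_zero_of_not_mem hiS x, M.map_zero]
    · exact hM.eq_zero_of_not_mem hjS _
  have h0rep : totalDim L₀.rep < totalDim M := totalDim_rep_lt (hL₀.ne_top hsU (hd s hs))
  have h0quot : totalDim L₀.quot < totalDim M := totalDim_quot_lt (hL₀.ne_bot htU (hd t ht))
  refine of_mem_of_extensions T L₀ (ih _ h0quot) (ih _ h0rep)
    (fun L' hq hr => (hL₀.of_cls hq hr).eq hL₀) fun R L' hq hr hne => ?_
  have hdR := dimVec_eq_of_sub hq hr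
  have hRS : ∀ i ∉ S, ∀ x : R.V i, x = 0 := fun i hi => by
    rw [← dimVec_eq_zero_iff, hdR, dimVec_eq_zero_iff]
    exact hM.eq_zero_of_not_mem hi
  have htR : totalDim R = totalDim M := by unfold totalDim; rw [hdR]
  rw [← htR] at ih
  rw [← hdR] at hd
  have hL' := hL₀.of_cls hq hr
  have hbU : IsBijOn (S ∩ U) R := by
    rw [← isBijOn_rep_iff (L := L') fun i hi x => (hL' i x).2 (Or.inr hi.2)]
    refine IsBijOn.of_cls ?_ hr.symm
    rw [isBijOn_rep_iff fun i hi x => (hL₀ i x).2 (Or.inr hi.2)]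
    exact hM.toIsBijOn.mono Set.inter_subset_left
  have hbW : IsBijOn (S \ U) R := by
    rw [← isBijOn_quot_iff (L := L') fun i hi x hx => ((hL' i x).1 hx).resolve_right hi.2]
    refine IsBijOn.of_cls ?_ hq.symm
    rw [isBijOn_quot_iff fun i hi x hx => ((hL₀ i x).1 hx).resolve_right hi.2]
    exact hM.toIsBijOn.mono Set.sdiff_subset
  -- If the map vanishes, the part over `Uᶜ` is a subrepresentation as well. In any extension with
  -- this subobject the edge from `Uᶜ` to `U` must act by zero, so the direct sum is the only
  -- extension.
  by_cases hRh : ∀ x, R.map h x = 0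
  · have hclopen : ∀ (R' : F1Rep.{u, v} I), (∀ i ∉ S, ∀ x : R'.V i, x = 0) → ∀ L : Sub R',
        L.IsSupport Uᶜ → L.IsClopen := by
      intro R' hR' L hL i j k x hx hx0
      have hjS : j ∈ S := by
        by_contra hjS; exact hx0 (hR' j hjS _)
      have hiS : i ∈ S := by
        by_contra hiS; rw [hR' i hiS x, R'.map_zero] at hx0; exact hx0 rfl
      have hj : j ∈ Uᶜ := ((hL j _).1 hx).resolve_left hx0
      rcases hU k hiS hjS with h1 | ⟨-, rfl⟩
      · exact (hL i x).2 (Or.inr fun hi => hj (h1.1 hi))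
      · exact (hj htU).elim
    obtain ⟨L₁, hL₁⟩ := exists_isSupport Uᶜ R fun i j k hi hj x => by
      by_cases hjS : j ∈ S
      · by_cases hiS : i ∈ S
        · rcases hU k hiS hjS with h1 | ⟨rfl, rfl⟩
          · exact (hj fun hj' => hi (h1.2 hj')).elim
          · rw [(N.subsingleton_hom _ _).elim k h, hRh]
        · rw [hRS i hiS x, R.map_zero]
      · exact hRS j hjS _
    refine of_mem_of_extensions T L₁
      (ih _ (totalDim_quot_lt (hL₁.ne_bot hsU (hd s hs))))
      (ih _ (totalDim_rep_lt (hL₁.ne_top (fun hc => hc htU) (hd t ht))))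
      (fun L'' hq hr => (hL₁.of_cls hq hr).eq hL₁) fun R' L'' hq' hr' hne' => ?_
    refine (hne' (cls_eq_of_isClopen (hclopen R' (fun i hi => ?_) L'' (hL₁.of_cls hq' hr'))
      (hclopen R hRS L₁ hL₁) hr' hq')).elim
    rw [← dimVec_eq_zero_iff, dimVec_eq_of_sub hq' hr', dimVec_eq_zero_iff]
    exact hRS i hi
  · push Not at hRh
    obtain ⟨x, hx⟩ := hRh
    have hx0 : x ≠ 0 := by rintro rfl; exact hx (R.map_zero h)
    obtain ⟨a', b', C, hb', hC, hCf, hxC, hCd⟩ := exists_isFull_mem N x hx0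
    have hmem : ∀ {i} {y : R.V i}, y ∈ C.carrier i → y ≠ 0 → i ∈ N.interval a' b' := by
      intro i y hy hy0
      by_contra hi
      exact hy0 (Sub.eq_zero_of_dimVec_rep (by rw [hCd, Set.indicator_of_notMem hi]) hy)
    have hex : ∀ i ∈ N.interval a' b', ∃ y ∈ C.carrier i, y ≠ 0 := by
      intro i hi
      have h1 : dimVec C.rep i ≠ 0 := by rw [hCd, Set.indicator_of_mem hi]; exact one_ne_zero
      rw [ne_eq, dimVec_eq_zero_iff] at h1
      push Not at h1
      obtain ⟨y, hy⟩ := h1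
      exact ⟨C.repVal y, C.repVal_mem y, fun h0 => hy (C.repVal_eq_zero.1 h0)⟩
    have hsub : ∀ i ∈ N.interval a' b', i ∈ S := by
      intro i hi
      obtain ⟨y, -, hy⟩ := hex i hi
      by_contra hiS
      exact hy (hRS i hiS y)
    have hs' := hmem hxC hx0
    have ht' := hmem (C.map_mem h x hxC) hx
    rw [N.mem_interval] at hs' ht' hs ht
    obtain ⟨ib, hib⟩ := N.exists_pos hb'
    have hbb : b' = b := by
      have := (hsub ib (by rw [N.mem_interval]; omega)).2
      omega
    obtain ⟨ia, hia⟩ := N.exists_pos (show a' < n by omega)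
    have haa' := (hsub ia (by rw [N.mem_interval]; omega)).1
    -- Every edge of the interval that avoids its last vertex lies on one side of the cut and is
    -- bijective on `R`. A summand starting at `a' > a` would therefore continue to `a' - 1`.
    have haa : a' = a := by
      by_contra hne
      obtain ⟨i, hi⟩ := N.exists_pos (show a' - 1 < n by omega)
      have hiI : i ∉ N.interval a' b' := by rw [N.mem_interval]; omega
      have hiS : i ∈ S := by rw [hS, N.mem_interval]; omega
      have hiaI : ia ∈ N.interval a' b' := by rw [N.mem_interval]; omega
      have hiaS := hsub ia hiaI
      obtain ⟨y, hyC, hy⟩ := hex ia hiaI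
      have hbij : ∀ ⦃k l : I⦄, (k ⟶ l) → k ∈ S → l ∈ S → N.pos k < b → N.pos l < b →
          ∃ A, IsBijOn A R ∧ k ∈ A ∧ l ∈ A := by
        intro k l e hk hl hkb hlb
        rcases hU e hk hl with h1 | ⟨rfl, rfl⟩
        · by_cases hkU : k ∈ U
          · exact ⟨_, hbU, ⟨hk, hkU⟩, hl, h1.1 hkU⟩
          · exact ⟨_, hbW, ⟨hk, hkU⟩, hl, fun hlU => hkU (h1.2 hlU)⟩
        · omega
      rcases N.exists_hom (show N.pos i + 1 = N.pos ia by omega) with ⟨⟨e⟩⟩ | ⟨⟨e⟩⟩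
      · obtain ⟨A, hA, h1, h2⟩ := hbij e hiS hiaS (by omega) (by omega)
        obtain ⟨z, rfl⟩ := hA.exists_map e h1 h2 y
        exact hiI (hmem (hC e z hyC hy) fun h0 => hy (by rw [h0, R.map_zero]))
      · obtain ⟨A, hA, h1, h2⟩ := hbij e hiaS hiS (by omega) (by omega)
        exact hiI (hmem (C.map_mem e y hyC) fun h0 => hy (hA.eq_zero e h1 h2 y h0))
    rw [hbb, haa, ← hS] at hCf
    -- The full part contains `C`, so it is nonzero. It is proper, since otherwise `R` would be full
    -- of the same dimension vector as `M` and isomorphic to it. Extensions by it split.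
    refine of_mem_of_isPart T (S := S) ih (fun e => ?_) (fun e => ?_) fun R' L'' hq' hr' hcl => ?_
    · have := le_isoPart hC hCf s hxC
      rw [e] at this
      exact hx0 this
    · refine hne (IsFull.cls_eq N ((isoPart_isFull S R).of_cls ?_) hM hdR)
      rw [e, cls_top_rep]
    · refine (hcl (Sub.isClopen_of_isFull ((isoPart_isFull S R).of_cls hr'.symm) fun i hi => ?_)).elim
      rw [← dimVec_eq_zero_iff, dimVec_eq_of_sub hq' hr', dimVec_eq_zero_iff]
      exact hRS i hi

theorem of_zeroRep_mem : of (cls (zeroRep.{u, v} I)) ∈ T := T.one_mem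

/-- The dimension is constant along the interval because the edge maps are bijective, so both ends
of the last edge carry nonzero points. The cut `U` is the side of its head: the vertex at `b` if the
edge points to it, and the vertices before `b` if it points away. -/
theorem of_mem_of_isFull
    (hT : ∀ (i : I) (M : F1Rep.{u, v} I), (∀ j ≠ i, dimVec M j = 0) → of (cls M) ∈ T)
    {M : F1Rep.{u, v} I} {a b : ℕ} (hb : b < n) (hM : IsFull (N.interval a b) M)
    (ih : ∀ R : F1Rep.{u, v} I, totalDim R < totalDim M → of (cls R) ∈ T) : of (cls M) ∈ T := by
  by_cases h0 : ∀ i, dimVec M i = 0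
  · have : cls M = cls (zeroRep I) := cls_eq_zero.2 fun i => dimVec_eq_zero_iff.1 (h0 i)
    rw [this]
    exact of_zeroRep_mem T
  · push Not at h0
    obtain ⟨i, hi⟩ := h0
    have hz : ∀ j ∉ N.interval a b, dimVec M j = 0 := fun j hj =>
      dimVec_eq_zero_iff.2 (hM.eq_zero_of_not_mem hj)
    have hiI : i ∈ N.interval a b := by
      by_contra h; exact hi (hz i h)
    have hiI' := hiI
    rw [N.mem_interval] at hiI'
    rcases le_or_gt b a with hab | hab
    · refine hT i M fun j hj => hz j fun hjI => ?_
      have := N.pos_ne hj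
      rw [N.mem_interval] at hjI
      omega
    · obtain ⟨ia, hia⟩ := N.exists_pos (show a < n by omega)
      have hconst : ∀ m, ∀ j, N.pos j = a + m → j ∈ N.interval a b → dimVec M j = dimVec M ia := by
        intro m
        induction m with
        | zero =>
          intro j hj _
          rw [N.pos_injective (hj.trans hia.symm)]
        | succ m ihm =>
          intro j hj hjI
          rw [N.mem_interval] at hjI
          obtain ⟨k, hk⟩ := N.exists_pos (show a + m < n by omega)
          have hkI : k ∈ N.interval a b := by rw [N.mem_interval]; omega
          rw [← ihm k hk hkI]
          rcases N.exists_hom (show N.pos k + 1 = N.pos j by omega) with ⟨⟨e⟩⟩ | ⟨⟨e⟩⟩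
          · exact (hM.dimVec_eq e hkI hjI).symm
          · exact hM.dimVec_eq e hjI hkI
      have hd : ∀ j ∈ N.interval a b, dimVec M j ≠ 0 := by
        intro j hj
        have hj' := hj
        rw [N.mem_interval] at hj'
        rw [hconst (N.pos j - a) j (by omega) hj, ← hconst (N.pos i - a) i (by omega) hiI]
        exact hi
      obtain ⟨j, hj⟩ := N.exists_pos hb
      obtain ⟨k, hk⟩ := N.exists_pos (show b - 1 < n by omega)
      have hjI : j ∈ N.interval a b := by rw [N.mem_interval]; omega
      have hkI : k ∈ N.interval a b := by rw [N.mem_interval]; omega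
      rcases N.exists_hom (show N.pos k + 1 = N.pos j by omega) with ⟨⟨e⟩⟩ | ⟨⟨e⟩⟩
      · refine of_mem_of_isFull_of_cut N T hM hd ih e hkI hjI (Or.inr (by omega))
          {x | N.pos x = b} (show ¬ N.pos k = b by omega) hj fun x y f hx hy => ?_
        simp only [Set.mem_ofPred_eq]
        rw [N.mem_interval] at hx hy
        have hadj := N.adj_of_hom f
        by_cases hyb : N.pos y = b
        · obtain rfl := N.pos_injective (hyb.trans hj.symm)
          exact Or.inr ⟨N.pos_injective (by omega), rfl⟩
        · by_cases hxb : N.pos x = b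
          · obtain rfl := N.pos_injective (hxb.trans hj.symm)
            obtain rfl : y = k := N.pos_injective (by omega)
            exact ((N.isEmpty_hom e).false f).elim
          · exact Or.inl (by omega)
      · refine of_mem_of_isFull_of_cut N T hM hd ih e hjI hkI (Or.inl (by omega))
          {x | N.pos x < b} (show ¬ N.pos j < b by omega) (show N.pos k < b by omega)
          fun x y f hx hy => ?_
        simp only [Set.mem_ofPred_eq]
        rw [N.mem_interval] at hx hy
        have hadj := N.adj_of_hom f
        by_cases hxb : N.pos x = b
        · obtain rfl := N.pos_injective (hxb.trans hj.symm)
          exact Or.inr ⟨rfl, N.pos_injective (by omega)⟩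
        · by_cases hyb : N.pos y = b
          · obtain rfl := N.pos_injective (hyb.trans hj.symm)
            obtain rfl : x = k := N.pos_injective (by omega)
            exact ((N.isEmpty_hom e).false f).elim
          · exact Or.inl (by omega)

/-- A subring of the Hall algebra that contains the classes of the representations concentrated at
one vertex contains the classes of all representations. -/
theorem of_mem_of_concentrated (N : PathNumbering I n)
    (hT : ∀ (i : I) (M : F1Rep.{u, v} I), (∀ j ≠ i, dimVec M j = 0) → of (cls M) ∈ T)
    (M : F1Rep.{u, v} I) : of (cls M) ∈ T := by
  generalize hm : totalDim M = m
  induction m using Nat.strong_induction_on generalizing M with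
  | _ m ih =>
    have ih : ∀ R : F1Rep.{u, v} I, totalDim R < m → of (cls R) ∈ T := fun R hR => ih _ hR R rfl
    -- The sum bounds the rank and depends only on the dimension vector. A nonsplit extension has
    -- larger rank than the direct sum of its ends, so the difference decreases in the inner
    -- induction.
    generalize hr : (∑ h : (Σ i j : I, i ⟶ j), dimVec M h.1) - rank M = r
    induction r using Nat.strong_induction_on generalizing M with
    | _ r ihr =>
      subst hm
      by_cases h0 : ∀ i (x : M.V i), x = 0
      · rw [cls_eq_zero.2 h0]
        exact of_zeroRep_mem T
      · push Not at h0
        obtain ⟨i, x, hx⟩ := h0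
        obtain ⟨a, b, C, hb, hC, hCf, hxC, -⟩ := exists_isFull_mem N x hx
        by_cases htop : isoPart (N.interval a b) M = Sub.top M
        · refine of_mem_of_isFull N T hT hb ((isoPart_isFull (N.interval a b) M).of_cls ?_) ih
          rw [htop, cls_top_rep]
        · refine of_mem_of_isPart T ih (fun e => ?_) htop fun R L hq hr' hL => ?_
          · have := le_isoPart hC hCf i hxC
            rw [e] at this
            exact hx this
          · have hdR := dimVec_eq_of_sub hq hr'
            have h1 := (rank_add_le L).lt_of_ne (mt (rank_add_eq_iff L).1 hL)
            rw [rank_eq_of_cls_eq hq, rank_eq_of_cls_eq hr',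
              (rank_add_eq_iff _).2 (isoPart_isClopen _ _)] at h1
            have h2 := rank_le R
            refine ihr _ ?_ R (by unfold totalDim; rw [hdR]) rfl
            rw [← hr, ← hdR]
            omega

end HallAlgebra

/-! ### Constant representations and divided powers -/

namespace F1Rep

variable {I : Type u} [Quiver.{v} I]

open Classical in
/-- The representation with the pointed set `{0, …, k}` at the vertices in `S`, all of whose edge
maps inside `S` are identities. -/
noncomputable def constRep (S : Set I) (k : ℕ) : F1Rep.{u, v} I where
  V i := {x : Fin (k + 1) // i ∉ S → x = 0}
  zero _ := ⟨⟨0, fun _ => rfl⟩⟩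
  map {_ j} _ x := ⟨if j ∈ S then x.1 else 0, fun hj => if_neg hj⟩
  map_zero {_ j} _ := Subtype.ext (ite_self (c := j ∈ S) (0 : Fin (k + 1)))
  map_inj {i j} h x y hx e := by
    by_cases hj : j ∈ S
    · have := congrArg Subtype.val e
      simp only [hj, if_true] at this
      exact Subtype.ext this
    · exact (hx (Subtype.ext (if_neg hj))).elim

/-- A point of `constRep S k`, as a number. -/
def constRepVal {S : Set I} {k : ℕ} {i : I} (x : (constRep S k : F1Rep.{u, v} I).V i) :
    Fin (k + 1) := x.1

/-- A point of `constRep S k`. -/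
def constRepMk (S : Set I) {k : ℕ} {i : I} (x : Fin (k + 1)) (h : i ∉ S → x = 0) :
    (constRep S k : F1Rep.{u, v} I).V i := ⟨x, h⟩

section

variable {S : Set I} {k : ℕ} {i j : I}

theorem constRepVal_eq_zero {x : (constRep S k : F1Rep.{u, v} I).V i} :
    constRepVal x = 0 ↔ x = 0 := ⟨fun h => Subtype.ext h, fun h => h ▸ rfl⟩

theorem constRepVal_injective :
    Function.Injective (constRepVal : (constRep S k : F1Rep.{u, v} I).V i → _) :=
  fun _ _ h => Subtype.ext h

theorem constRepVal_of_not_mem (hi : i ∉ S) (x : (constRep S k : F1Rep.{u, v} I).V i) :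
    constRepVal x = 0 := x.2 hi

theorem constRepVal_map (h : i ⟶ j) (hj : j ∈ S) (x : (constRep S k : F1Rep.{u, v} I).V i) :
    constRepVal ((constRep S k).map h x) = constRepVal x := if_pos hj

theorem isFull_constRep (S : Set I) (k : ℕ) : IsFull S (constRep S k : F1Rep.{u, v} I) where
  eq_zero i j h hi hj x hx := by
    rw [← constRepVal_eq_zero] at hx ⊢
    rwa [constRepVal_map h hj] at hx
  exists_map i j h hi hj y := ⟨constRepMk S (constRepVal y) fun h => (h hi).elim,
    constRepVal_injective (constRepVal_map h hj _)⟩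
  eq_zero_of_not_mem i hi x := constRepVal_eq_zero.1 (constRepVal_of_not_mem hi x)

theorem dimVec_constRep (S : Set I) (k : ℕ) :
    dimVec (constRep S k : F1Rep.{u, v} I) = S.indicator fun _ => k := by
  funext i
  by_cases hi : i ∈ S
  · rw [Set.indicator_of_mem hi]
    unfold dimVec
    refine (Nat.card_congr (β := {x : Fin (k + 1) // x ≠ 0})
      ⟨fun x => ⟨constRepVal x.1, fun h => x.2 (constRepVal_eq_zero.1 h)⟩,
        fun x => ⟨constRepMk S x.1 fun h => (h hi).elim, fun h => x.2 (constRepVal_eq_zero.2 h)⟩,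
        fun _ => rfl, fun _ => rfl⟩).trans ?_
    rw [Nat.card_eq_fintype_card, Fintype.card_subtype_compl]
    simp
  · rw [Set.indicator_of_notMem hi]
    exact dimVec_eq_zero_iff.2 fun x => constRepVal_eq_zero.1 (constRepVal_of_not_mem hi x)

end

variable {n : ℕ} [∀ i j : I, Finite (i ⟶ j)]

theorem isFull_singleton (N : PathNumbering I n) {i : I} {M : F1Rep.{u, v} I}
    (hM : ∀ j ≠ i, dimVec M j = 0) : IsFull {i} M where
  eq_zero := by
    rintro k l h rfl hl
    obtain rfl : l = _ := hl
    have := N.adj_of_hom h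
    omega
  exists_map := by
    rintro k l h rfl hl
    obtain rfl : l = _ := hl
    have := N.adj_of_hom h
    omega
  eq_zero_of_not_mem j hj := dimVec_eq_zero_iff.1 (hM j hj)

theorem cls_eq_constRep (N : PathNumbering I n) {S : Set I} {k : ℕ} {M : F1Rep.{u, v} I}
    (hM : IsFull S M) (h : ∀ i ∈ S, dimVec M i = k) : cls M = cls (constRep S k) := by
  refine IsFull.cls_eq N hM (isFull_constRep S k) (funext fun i => ?_)
  rw [dimVec_constRep]
  by_cases hi : i ∈ S
  · rw [Set.indicator_of_mem hi, h i hi]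
  · rw [Set.indicator_of_notMem hi, dimVec_eq_zero_iff]
    exact hM.eq_zero_of_not_mem hi

theorem cls_eq_constRep_singleton (N : PathNumbering I n) {i : I} {M : F1Rep.{u, v} I}
    (hM : ∀ j ≠ i, dimVec M j = 0) : cls M = cls (constRep {i} (dimVec M i)) :=
  cls_eq_constRep N (isFull_singleton N hM) (by rintro _ rfl; rfl)

theorem cls_eq_simple (N : PathNumbering I n) {i : I} {M : F1Rep.{u, v} I}
    (hM : dimVec M = dimVec (simple i)) : cls M = cls (simple i) := by
  classical
  have h : ∀ j ≠ i, dimVec (simple i : F1Rep.{u, v} I) j = 0 := fun j hj => by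
    rw [dimVec_simple, if_neg hj]
  rw [cls_eq_constRep_singleton N h, cls_eq_constRep_singleton N (hM ▸ h), hM]

end F1Rep

namespace HallAlgebra

open F1Rep

variable {I : Type u} [Quiver.{v} I] [Finite I] [∀ i j : I, Finite (i ⟶ j)] {n : ℕ}

omit [Finite I] [∀ i j : I, Finite (i ⟶ j)] in
theorem ext_cls {f g : HallAlgebra.{u, v} I}
    (h : ∀ M : F1Rep.{u, v} I, toFinsupp I f (cls M) = toFinsupp I g (cls M)) : f = g :=
  (toFinsupp I).injective (Finsupp.ext fun X => by rw [← cls_rep X]; exact h X.rep)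

-- A subrepresentation of this kind omits exactly one of the `k + 1` nonzero points at `i`, and
-- every omission is allowed because there are no loops.
open Classical in
theorem card_sub_constRep (N : PathNumbering I n) (i : I) (k : ℕ) :
    (Finset.univ.filter fun L : Sub (constRep {i} (k + 1) : F1Rep.{u, v} I) =>
      cls L.quot = cls (simple i) ∧ cls L.rep = cls (constRep {i} k)).card = k + 1 := by
  have hdim : ∀ L : Sub (constRep {i} (k + 1) : F1Rep.{u, v} I), dimVec L.quot i = 1 →
      cls L.quot = cls (simple i) ∧ cls L.rep = cls (constRep {i} k) := by
    intro L hL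
    have h := fun j => dimVec_sub_quot L j
    rw [dimVec_constRep] at h
    have h0 : ∀ j ≠ i, dimVec L.quot j = 0 ∧ dimVec L.rep j = 0 := by
      intro j hj
      have := h j
      rw [Set.indicator_of_notMem (by exact hj)] at this
      omega
    have h1 := h i
    rw [Set.indicator_of_mem (Set.mem_singleton i)] at h1
    refine ⟨cls_eq_simple N (funext fun j => ?_), ?_⟩
    · rw [dimVec_simple]
      split_ifs with hj
      · rw [hj, hL]
      · exact (h0 j hj).1
    · rw [cls_eq_constRep_singleton N fun j hj => (h0 j hj).2]
      congr 2
      omega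
  have hcard : (Finset.univ.filter fun p : Fin (k + 1 + 1) => p ≠ 0).card = k + 1 := by
    rw [Finset.filter_ne', Finset.card_erase_of_mem (Finset.mem_univ _), Finset.card_univ,
      Fintype.card_fin, Nat.add_sub_cancel]
  refine Eq.trans (Eq.symm ?_) hcard
  let Lp : ∀ p : Fin (k + 1 + 1), p ≠ 0 → Sub (constRep {i} (k + 1) : F1Rep.{u, v} I) :=
    fun p hp =>
    { carrier := fun j => {x | constRepVal x ≠ p}
      zero_mem := fun j => hp.symm
      map_mem := fun {j l} h x _ => by
        by_cases hl : l ∈ ({i} : Set I)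
        · by_cases hj : j ∈ ({i} : Set I)
          · obtain rfl : j = i := hj
            obtain rfl : l = j := hl
            have := N.adj_of_hom h
            omega
          · change constRepVal _ ≠ p
            rw [constRepVal_map h hl, constRepVal_of_not_mem hj]
            exact hp.symm
        · change constRepVal _ ≠ p
          rw [constRepVal_of_not_mem hl]
          exact hp.symm }
  refine Finset.card_bij (fun p hp => Lp p (Finset.mem_filter.1 hp).2) (fun p hp => ?_)
    (fun p hp q hq e => ?_) fun L hL => ?_
  · have hp0 := (Finset.mem_filter.1 hp).2
    refine Finset.mem_filter.2 ⟨Finset.mem_univ _, hdim _ ?_⟩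
    unfold dimVec
    rw [Nat.card_eq_one_iff_unique]
    have hv : ∀ x : {x : (Lp p hp0).quot.V i // x ≠ 0},
        constRepVal ((Lp p hp0).quotVal x.1) = p := by
      intro x
      by_contra hx
      exact x.2 ((Lp p hp0).quotVal_eq_zero.1 ((Lp p hp0).quotVal_eq_zero_of_mem x.1 hx))
    refine ⟨⟨fun x y => Subtype.ext ((Lp p hp0).quotVal_injective
      (constRepVal_injective ((hv x).trans (hv y).symm)))⟩, ⟨⟨(Lp p hp0).quotMk
        (constRepMk {i} p fun h => (h rfl).elim) fun h => (h rfl).elim, fun h => ?_⟩⟩⟩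
    exact hp0 (constRepVal_eq_zero.2 ((Lp p hp0).quotVal_eq_zero.2 h))
  · by_contra hpq
    have hm : constRepMk {i} p (fun h => (h rfl).elim) ∉
        (Lp p (Finset.mem_filter.1 hp).2).carrier i := fun h => h rfl
    rw [e] at hm
    exact hm hpq
  · have h1 : dimVec L.quot i = 1 := by
      rw [dimVec_eq_of_cls_eq (Finset.mem_filter.1 hL).2.1, dimVec_simple, if_pos rfl]
    unfold dimVec at h1
    rw [Nat.card_eq_one_iff_unique] at h1
    obtain ⟨⟨h1⟩, ⟨q, hq⟩⟩ := h1
    have hqL : L.quotVal q ∉ L.carrier i := fun h =>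
      hq (L.quotVal_eq_zero.1 (L.quotVal_eq_zero_of_mem q h))
    have hp0 : constRepVal (L.quotVal q) ≠ 0 := fun h =>
      hq (L.quotVal_eq_zero.1 (constRepVal_eq_zero.1 h))
    refine ⟨constRepVal (L.quotVal q), Finset.mem_filter.2 ⟨Finset.mem_univ _, hp0⟩, ?_⟩
    refine Sub.ext (funext fun j => Set.ext fun x => ?_)
    change constRepVal x ≠ constRepVal (L.quotVal q) ↔ x ∈ L.carrier j
    by_cases hj : j = i
    · subst hj
      rw [constRepVal_injective.ne_iff]
      constructor
      · intro hx
        by_contra hxL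
        refine hx ?_
        have := h1 ⟨L.quotMk x fun h => (hxL h).elim, fun h => hxL ?_⟩ ⟨q, hq⟩
        · exact congrArg (fun z : {x : L.quot.V j // x ≠ 0} => L.quotVal z.1) this
        · rw [← L.quotVal_eq_zero] at h
          rw [show x = 0 from h]
          exact L.zero_mem _
      · rintro hx rfl
        exact hqL hx
    · have h0 := constRepVal_of_not_mem (S := {i}) hj x
      rw [h0, constRepVal_eq_zero.1 h0]
      exact ⟨fun _ => L.zero_mem j, fun _ => hp0.symm⟩

/-- A representation concentrated at one vertex is determined by its dimension, so only one class
occurs in the product. -/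
theorem simple_mul_constRep (N : PathNumbering I n) (i : I) (k : ℕ) :
    of (cls (simple.{u, v} i)) * of (cls (constRep {i} k)) =
      (k + 1) • of (cls (constRep {i} (k + 1))) := by
  classical
  refine ext_cls fun R => ?_
  rw [map_nsmul, Finsupp.smul_apply, toFinsupp_of]
  by_cases hR : cls (constRep {i} (k + 1)) = cls R
  · rw [if_pos hR, ← hR, of_mul_of_apply_cls, card_sub_constRep N]
    simp
  · rw [if_neg hR, smul_zero, of_mul_of_apply_cls, Nat.cast_eq_zero, Finset.card_eq_zero,
      Finset.filter_eq_empty_iff]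
    rintro L - ⟨hq, hr⟩
    have hd : ∀ j, dimVec R j = if j = i then k + 1 else 0 := by
      intro j
      rw [dimVec_sub_quot L, dimVec_eq_of_cls_eq hq, dimVec_eq_of_cls_eq hr, dimVec_simple,
        dimVec_constRep]
      by_cases hj : j = i
      · rw [if_pos hj, if_pos hj, Set.indicator_of_mem (by exact hj), add_comm]
      · rw [if_neg hj, if_neg hj, Set.indicator_of_notMem (by exact hj), add_zero]
    refine hR ?_
    rw [cls_eq_constRep_singleton N (i := i) (M := R) fun j hj => by rw [hd, if_neg hj], hd,
      if_pos rfl]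

/-- The divided powers of `[S i]` are the classes of the representations concentrated at `i`. -/
theorem simple_pow (N : PathNumbering I n) (i : I) (k : ℕ) :
    of (cls (simple.{u, v} i)) ^ k = k.factorial • of (cls (constRep {i} k)) := by
  induction k with
  | zero =>
    have : cls (constRep {i} 0 : F1Rep.{u, v} I) = cls (zeroRep I) := cls_eq_zero.2 fun j =>
      dimVec_eq_zero_iff.1 (by rw [dimVec_constRep]; simp)
    rw [this, pow_zero, Nat.factorial_zero, one_smul]
    rfl
  | succ k ih =>
    rw [pow_succ', ih, mul_smul_comm, simple_mul_constRep N, smul_smul, Nat.factorial_succ,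
      mul_comm]

end HallAlgebra

/-! ### Subrepresentations and quotients of direct sums -/

namespace F1Rep

variable {I : Type u} [Quiver.{v} I]

/-- Sub-representations of a direct sum are direct sums of sub-representations. -/
def subSumEquiv (M N : F1Rep.{u, v} I) : Sub M × Sub N ≃ Sub (sum M N) where
  toFun p :=
    { carrier := fun i => {x | sumFst x ∈ p.1.carrier i ∧ sumSnd x ∈ p.2.carrier i}
      zero_mem := fun i => ⟨p.1.zero_mem i, p.2.zero_mem i⟩
      map_mem := fun h _ hx => ⟨p.1.map_mem h _ hx.1, p.2.map_mem h _ hx.2⟩ }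
  invFun L :=
    ⟨{ carrier := fun i => {x | sumMk x 0 (Or.inr rfl) ∈ L.carrier i}
       zero_mem := fun i => L.zero_mem i
       map_mem := fun h x hx => by
        have := L.map_mem h _ hx
        have e : (sum M N).map h (sumMk x 0 (Or.inr rfl)) = sumMk (M.map h x) 0 (Or.inr rfl) :=
          sum_ext rfl (N.map_zero h)
        rwa [e] at this },
     { carrier := fun i => {x | sumMk 0 x (Or.inl rfl) ∈ L.carrier i}
       zero_mem := fun i => L.zero_mem i
       map_mem := fun h x hx => by
        have := L.map_mem h _ hx
        have e : (sum M N).map h (sumMk 0 x (Or.inl rfl)) = sumMk 0 (N.map h x) (Or.inl rfl) :=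
          sum_ext (M.map_zero h) rfl
        rwa [e] at this }⟩
  left_inv p := by
    refine Prod.ext (Sub.ext (funext fun i => Set.ext fun x => ?_))
      (Sub.ext (funext fun i => Set.ext fun x => ?_))
    · exact ⟨fun h => h.1, fun h => ⟨h, p.2.zero_mem i⟩⟩
    · exact ⟨fun h => h.2, fun h => ⟨p.1.zero_mem i, h⟩⟩
  -- One component of each point of a direct sum is zero, so the point coincides with the image of
  -- one of its components. There are no diagonal subrepresentations.
  right_inv L := by
    refine Sub.ext (funext fun i => Set.ext fun x => ?_)
    change sumMk (sumFst x) 0 _ ∈ L.carrier i ∧ sumMk 0 (sumSnd x) _ ∈ L.carrier i ↔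
      x ∈ L.carrier i
    rcases sum_eq_zero x with h | h
    · have e1 : sumMk (sumFst x) (0 : N.V i) (Or.inr rfl) = 0 := sum_ext h rfl
      have e2 : sumMk (0 : M.V i) (sumSnd x) (Or.inl rfl) = x := sum_ext h.symm rfl
      rw [e1, e2]
      exact ⟨fun h => h.2, fun h => ⟨L.zero_mem i, h⟩⟩
    · have e1 : sumMk (sumFst x) (0 : N.V i) (Or.inr rfl) = x := sum_ext rfl h.symm
      have e2 : sumMk (0 : M.V i) (sumSnd x) (Or.inl rfl) = 0 := sum_ext rfl h
      rw [e1, e2]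
      exact ⟨fun h => h.1, fun h => ⟨h, L.zero_mem i⟩⟩

/-- A sub-representation of a direct sum is the direct sum of its components. -/
def subSumRepIso {M N : F1Rep.{u, v} I} (L : Sub M) (K : Sub N) :
    (subSumEquiv M N (L, K)).rep ≅ sum L.rep K.rep :=
  mkIso (fun _ =>
    { toFun := fun x => sumMk (L.repMk (sumFst (Sub.repVal _ x)) (Sub.repVal_mem _ x).1)
        (K.repMk (sumSnd (Sub.repVal _ x)) (Sub.repVal_mem _ x).2)
        ((sum_eq_zero (Sub.repVal _ x)).imp (fun h => L.repVal_eq_zero.1 h)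
          fun h => K.repVal_eq_zero.1 h)
      invFun := fun y => Sub.repMk _ (sumMk (L.repVal (sumFst y)) (K.repVal (sumSnd y))
        ((sum_eq_zero y).imp (fun h => L.repVal_eq_zero.2 h) fun h => K.repVal_eq_zero.2 h))
        ⟨L.repVal_mem _, K.repVal_mem _⟩
      left_inv := fun _ => rfl
      right_inv := fun _ => rfl })
    (fun _ => rfl) fun _ _ => rfl

theorem sumFst_quotVal {M N : F1Rep.{u, v} I} {L : Sub M} {K : Sub N} {i : I}
    (x : (subSumEquiv M N (L, K)).quot.V i) (h : sumFst (Sub.quotVal _ x) ∈ L.carrier i) :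
    sumFst (Sub.quotVal _ x) = 0 := by
  rcases sum_eq_zero (Sub.quotVal _ x) with h1 | h1
  · exact h1
  · rw [Sub.quotVal_eq_zero_of_mem _ x ⟨h, h1 ▸ K.zero_mem i⟩, sumFst_zero]

theorem sumSnd_quotVal {M N : F1Rep.{u, v} I} {L : Sub M} {K : Sub N} {i : I}
    (x : (subSumEquiv M N (L, K)).quot.V i) (h : sumSnd (Sub.quotVal _ x) ∈ K.carrier i) :
    sumSnd (Sub.quotVal _ x) = 0 := by
  rcases sum_eq_zero (Sub.quotVal _ x) with h1 | h1
  · rw [Sub.quotVal_eq_zero_of_mem _ x ⟨h1 ▸ L.zero_mem i, h⟩, sumSnd_zero]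
  · exact h1

/-- The quotient of a direct sum is the direct sum of the quotients of its components. -/
noncomputable def subSumQuotIso {M N : F1Rep.{u, v} I} (L : Sub M) (K : Sub N) :
    (subSumEquiv M N (L, K)).quot ≅ sum L.quot K.quot :=
  mkIso (fun i =>
    { toFun := fun x => sumMk (L.quotMk (sumFst (Sub.quotVal _ x)) (sumFst_quotVal x))
        (K.quotMk (sumSnd (Sub.quotVal _ x)) (sumSnd_quotVal x))
        ((sum_eq_zero (Sub.quotVal _ x)).imp (fun h => L.quotVal_eq_zero.1 h)
          fun h => K.quotVal_eq_zero.1 h)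
      invFun := fun y => Sub.quotMk _ (sumMk (L.quotVal (sumFst y)) (K.quotVal (sumSnd y))
        ((sum_eq_zero y).imp (fun h => L.quotVal_eq_zero.2 h) fun h => K.quotVal_eq_zero.2 h))
        fun h => sum_ext (L.quotVal_eq_zero_of_mem _ h.1) (K.quotVal_eq_zero_of_mem _ h.2)
      left_inv := fun _ => rfl
      right_inv := fun _ => rfl })
    (fun _ => rfl) (by
      intro i j h x
      set y := Sub.quotVal _ x with hy
      have hmem : (sum M N).map h y ∈ (subSumEquiv M N (L, K)).carrier j ↔
        M.map h (sumFst y) ∈ L.carrier j ∧ N.map h (sumSnd y) ∈ K.carrier j := Iff.rfl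
      refine sum_ext (L.quotVal_injective ?_) (K.quotVal_injective ?_)
      · change L.quotVal (L.quot.map h (L.quotMk (sumFst y) _)) =
          sumFst (Sub.quotVal _ ((subSumEquiv M N (L, K)).quot.map h x))
        by_cases h1 : M.map h (sumFst y) ∈ L.carrier j
        · rw [L.quotVal_map_of_mem h (L.quotMk (sumFst y) (sumFst_quotVal x)) h1]
          by_cases h2 : N.map h (sumSnd y) ∈ K.carrier j
          · rw [Sub.quotVal_map_of_mem _ h x (hmem.2 ⟨h1, h2⟩), sumFst_zero]
          · rw [Sub.quotVal_map_of_not_mem _ h x fun h3 => h2 (hmem.1 h3).2]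
            rcases sum_eq_zero y with h3 | h3
            · rw [← hy, sumFst_map, h3, M.map_zero]
            · rw [h3, N.map_zero] at h2
              exact (h2 (K.zero_mem j)).elim
        · rw [L.quotVal_map_of_not_mem h (L.quotMk (sumFst y) (sumFst_quotVal x)) h1,
            Sub.quotVal_map_of_not_mem _ h x fun h3 => h1 (hmem.1 h3).1]
          rfl
      · change K.quotVal (K.quot.map h (K.quotMk (sumSnd y) _)) =
          sumSnd (Sub.quotVal _ ((subSumEquiv M N (L, K)).quot.map h x))
        by_cases h1 : N.map h (sumSnd y) ∈ K.carrier j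
        · rw [K.quotVal_map_of_mem h (K.quotMk (sumSnd y) (sumSnd_quotVal x)) h1]
          by_cases h2 : M.map h (sumFst y) ∈ L.carrier j
          · rw [Sub.quotVal_map_of_mem _ h x (hmem.2 ⟨h2, h1⟩), sumSnd_zero]
          · rw [Sub.quotVal_map_of_not_mem _ h x fun h3 => h2 (hmem.1 h3).1]
            rcases sum_eq_zero y with h3 | h3
            · rw [h3, M.map_zero] at h2
              exact (h2 (L.zero_mem j)).elim
            · rw [← hy, sumSnd_map, h3, N.map_zero]
        · rw [K.quotVal_map_of_not_mem h (K.quotMk (sumSnd y) (sumSnd_quotVal x)) h1,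
            Sub.quotVal_map_of_not_mem _ h x fun h3 => h1 (hmem.1 h3).2]
          rfl)

end F1Rep

/-! ### Multiplicativity of the Hall coproduct, and primitive elements -/

namespace HallAlgebra

open F1Rep

variable {I : Type u} [Quiver.{v} I]

/-- Elements of the tensor square of the Hall algebra as functions of two variables. -/
noncomputable def pairFinsupp : HallAlgebra.{u, v} I ⊗[ℂ] HallAlgebra.{u, v} I ≃ₗ[ℂ]
    (IsoClass.{u, v} I × IsoClass.{u, v} I →₀ ℂ) :=
  (TensorProduct.congr (toFinsupp I) (toFinsupp I)).trans
    (finsuppTensorFinsupp' ℂ (IsoClass.{u, v} I) (IsoClass.{u, v} I))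

@[simp]
theorem pairFinsupp_tmul (f g : HallAlgebra.{u, v} I) (X Y : IsoClass.{u, v} I) :
    pairFinsupp (f ⊗ₜ g) (X, Y) = toFinsupp I f X * toFinsupp I g Y :=
  finsuppTensorFinsupp'_apply_apply _ _ _ _ _ _ _

variable [Finite I] [∀ i j : I, Finite (i ⟶ j)]

theorem pairFinsupp_comul (f : HallAlgebra.{u, v} I) (M N : F1Rep.{u, v} I) :
    pairFinsupp (comul f) (cls M, cls N) = toFinsupp I f (cls (sum M N)) := by
  have h : pairFinsupp (comul f) (cls M, cls N) =
      toFinsupp I f (cls (sum (cls M).rep (cls N).rep)) := by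
    unfold pairFinsupp comul
    rw [LinearMap.comp_apply, LinearMap.comp_apply, LinearEquiv.trans_apply,
      LinearEquiv.coe_toLinearMap, LinearEquiv.coe_toLinearMap, LinearEquiv.apply_symm_apply,
      LinearEquiv.apply_symm_apply]
    rfl
  rw [h, cls_eq (sumCongr (cls_eq_iff.1 (cls_rep (cls M))).some
    (cls_eq_iff.1 (cls_rep (cls N))).some)]

theorem pairFinsupp_mul (a b : HallAlgebra.{u, v} I ⊗[ℂ] HallAlgebra.{u, v} I)
    (M N : F1Rep.{u, v} I) : pairFinsupp (a * b) (cls M, cls N) =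
      ∑ p : Sub M × Sub N, pairFinsupp a (cls p.1.quot, cls p.2.quot) *
        pairFinsupp b (cls p.1.rep, cls p.2.rep) := by
  induction a using TensorProduct.induction_on with
  | zero => simp
  | add a a' h h' =>
    rw [add_mul, map_add, Finsupp.add_apply, h, h', ← Finset.sum_add_distrib]
    exact Finset.sum_congr rfl fun p _ => by rw [map_add, Finsupp.add_apply, add_mul]
  | tmul f g =>
    induction b using TensorProduct.induction_on with
    | zero => simp
    | add b b' h h' =>
      rw [mul_add, map_add, Finsupp.add_apply, h, h', ← Finset.sum_add_distrib]
      exact Finset.sum_congr rfl fun p _ => by rw [map_add, Finsupp.add_apply, mul_add]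
    | tmul f' g' =>
      rw [Algebra.TensorProduct.tmul_mul_tmul, pairFinsupp_tmul, mul_apply_cls, mul_apply_cls,
        Finset.sum_mul_sum, ← Fintype.sum_prod_type']
      exact Finset.sum_congr rfl fun p _ => by
        rw [pairFinsupp_tmul, pairFinsupp_tmul]; ring

/-- The coproduct of the Hall algebra is multiplicative. -/
theorem comul_mul (f g : HallAlgebra.{u, v} I) : comul (f * g) = comul f * comul g := by
  refine pairFinsupp.injective (Finsupp.ext fun p => ?_)
  obtain ⟨X, Y⟩ := p
  rw [← cls_rep X, ← cls_rep Y, pairFinsupp_comul, mul_apply_cls, pairFinsupp_mul]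
  symm
  refine Fintype.sum_equiv (subSumEquiv X.rep Y.rep) _ _ fun p => ?_
  rw [pairFinsupp_comul, pairFinsupp_comul, ← cls_eq (subSumRepIso p.1 p.2),
    ← cls_eq (subSumQuotIso p.1 p.2)]

theorem one_apply_cls (M : F1Rep.{u, v} I) [Decidable (∀ i (x : M.V i), x = 0)] :
    toFinsupp I (1 : HallAlgebra.{u, v} I) (cls M) = if ∀ i (x : M.V i), x = 0 then 1 else 0 := by
  classical
  refine (toFinsupp_of (cls (zeroRep I)) (cls M)).trans ?_
  simp only [eq_comm (a := cls (zeroRep I)), cls_eq_zero]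

/-- Primitive elements of the Hall algebra. -/
def IsPrimitive (f : HallAlgebra.{u, v} I) : Prop := comul f = f ⊗ₜ 1 + 1 ⊗ₜ f

attribute [local instance] LieRing.ofAssociativeRing

theorem IsPrimitive.lie {f g : HallAlgebra.{u, v} I} (hf : IsPrimitive f) (hg : IsPrimitive g) :
    IsPrimitive ⁅f, g⁆ := by
  unfold IsPrimitive at *
  rw [LieRing.of_associative_ring_bracket, map_sub, comul_mul, comul_mul, hf, hg]
  simp only [mul_add, add_mul, Algebra.TensorProduct.tmul_mul_tmul, one_mul, mul_one,
    TensorProduct.sub_tmul, TensorProduct.tmul_sub]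
  abel

/-- The unit is the delta function of the zero representation, so both terms of the coproduct of a
primitive function vanish at a pair of nonzero representations. Primitive functions thus live on
indecomposables. -/
theorem IsPrimitive.apply_sum {f : HallAlgebra.{u, v} I} (hf : IsPrimitive f)
    {M N : F1Rep.{u, v} I} (hM : ¬ ∀ i (x : M.V i), x = 0) (hN : ¬ ∀ i (x : N.V i), x = 0) :
    toFinsupp I f (cls (sum M N)) = 0 := by
  classical
  rw [← pairFinsupp_comul, hf, map_add, Finsupp.add_apply, pairFinsupp_tmul, pairFinsupp_tmul,
    one_apply_cls, one_apply_cls, if_neg hM, if_neg hN, mul_zero, zero_mul, add_zero]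

theorem isPrimitive_simple (i : I) : IsPrimitive (of (cls (simple.{u, v} i))) := by
  classical
  have hne : cls (simple.{u, v} i) ≠ cls (zeroRep I) := fun h => by
    have := congrFun (dimVec_eq_of_cls_eq h) i
    rw [dimVec_simple, if_pos rfl, dimVec_eq_zero_iff.2 fun _ => rfl] at this
    exact one_ne_zero this
  refine pairFinsupp.injective (Finsupp.ext fun p => ?_)
  obtain ⟨X, Y⟩ := p
  rw [← cls_rep X, ← cls_rep Y, pairFinsupp_comul, map_add, Finsupp.add_apply, pairFinsupp_tmul,
    pairFinsupp_tmul]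
  have hzl : ∀ M N : F1Rep.{u, v} I, (∀ i (x : M.V i), x = 0) → cls (sum M N) = cls N := by
    intro M N h
    refine cls_eq (mkIso (fun j => ⟨sumSnd, fun y => sumMk 0 y (Or.inl rfl), fun p =>
      sum_ext (h _ _).symm rfl, fun _ => rfl⟩) (fun _ => rfl) fun _ _ => rfl)
  have hzr : ∀ M N : F1Rep.{u, v} I, (∀ i (x : N.V i), x = 0) → cls (sum M N) = cls M := by
    intro M N h
    refine cls_eq (mkIso (fun j => ⟨sumFst, fun y => sumMk y 0 (Or.inr rfl), fun p =>
      sum_ext rfl (h _ _).symm, fun _ => rfl⟩) (fun _ => rfl) fun _ _ => rfl)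
  rw [one_apply_cls, one_apply_cls]
  by_cases hX : ∀ i (x : X.rep.V i), x = 0
  · rw [if_pos hX, one_mul, hzl _ _ hX, toFinsupp_of _ (cls X.rep),
      if_neg (fun h => hne (h.trans (cls_eq_zero.2 hX))), zero_mul, zero_add]
  · by_cases hY : ∀ i (x : Y.rep.V i), x = 0
    · rw [if_pos hY, if_neg hX, mul_one, hzr _ _ hY, zero_mul, add_zero]
    · rw [if_neg hX, if_neg hY, mul_zero, zero_mul, add_zero, toFinsupp_of, if_neg]
      intro h
      have hd := dimVec_eq_of_cls_eq h
      push Not at hX hY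
      obtain ⟨j, x, hx⟩ := hX
      obtain ⟨k, y, hy⟩ := hY
      have hle := dimVec_le_sum X.rep Y.rep
      rw [← hd] at hle
      have h1 : dimVec X.rep j ≤ dimVec (simple i) j := hle.1 j
      have h2 : dimVec Y.rep k ≤ dimVec (simple i) k := hle.2 k
      have h1' : dimVec X.rep j ≠ 0 := fun h => hx (dimVec_eq_zero_iff.1 h x)
      have h2' : dimVec Y.rep k ≠ 0 := fun h => hy (dimVec_eq_zero_iff.1 h y)
      rw [dimVec_simple] at h1 h2
      split_ifs at h1 h2 with hj hk
      · subst hj hk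
        -- Two nonzero summands would provide two distinct nonzero points at `i`, where `S i` has
        -- only one.
        have h3 := Nat.card_le_card_of_injective
          (fun b : Bool => (⟨if b then sumMk x 0 (Or.inr rfl) else sumMk 0 y (Or.inl rfl), by
            cases b
            · exact fun h => hy (congrArg sumSnd h)
            · exact fun h => hx (congrArg sumFst h)⟩ :
            {z : (sum X.rep Y.rep).V k // z ≠ 0})) (by
          intro b c hbc
          have h4 := congrArg (fun z : {z : (sum X.rep Y.rep).V k // z ≠ 0} => sumFst z.1) hbc
          cases b <;> cases c <;> first | rfl | exact (hx h4.symm).elim | exact (hx h4).elim)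
        have h5 := congrFun hd k
        rw [dimVec_simple, if_pos rfl] at h5
        unfold dimVec at h5
        rw [← h5] at h3
        simp at h3
      · omega
      · omega
      · omega

end HallAlgebra

/-! ### Homogeneous functions, Serre relations and root vectors -/

namespace HallAlgebra

open F1Rep

variable {I : Type u} [Quiver.{v} I]

/-- Functions supported on representations of a given dimension vector. -/
def IsHomogeneous (d : I → ℕ) (f : HallAlgebra.{u, v} I) : Prop :=
  ∀ M : F1Rep.{u, v} I, toFinsupp I f (cls M) ≠ 0 → dimVec M = d

theorem isHomogeneous_of (M : F1Rep.{u, v} I) : IsHomogeneous (dimVec M) (of (cls M)) := by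
  classical
  intro R hR
  rw [toFinsupp_of] at hR
  exact (dimVec_eq_of_cls_eq (by_contra fun h => hR (if_neg h))).symm

theorem isHomogeneous_zero (d : I → ℕ) : IsHomogeneous d (0 : HallAlgebra.{u, v} I) := fun R hR => by
  rw [_root_.map_zero] at hR
  exact (hR rfl).elim

variable [Finite I] [∀ i j : I, Finite (i ⟶ j)]

section Mul

variable {d d' : I → ℕ} {f g : HallAlgebra.{u, v} I}

theorem IsHomogeneous.mul (hf : IsHomogeneous d f) (hg : IsHomogeneous d' g) :
    IsHomogeneous (d + d') (f * g) := by
  intro M hM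
  rw [mul_apply_cls] at hM
  obtain ⟨L, -, hL⟩ := Finset.exists_ne_zero_of_sum_ne_zero hM
  funext i
  rw [dimVec_sub_quot L, hf _ (left_ne_zero_of_mul hL), hg _ (right_ne_zero_of_mul hL), Pi.add_apply]

attribute [local instance] LieRing.ofAssociativeRing

theorem IsHomogeneous.lie (hf : IsHomogeneous d f) (hg : IsHomogeneous d' g) :
    IsHomogeneous (d + d') ⁅f, g⁆ := by
  intro M hM
  rw [LieRing.of_associative_ring_bracket, map_sub, Finsupp.sub_apply] at hM
  by_cases h : toFinsupp I (f * g) (cls M) = 0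
  · rw [add_comm]
    exact hg.mul hf M fun h' => hM (by rw [h, h', sub_zero])
  · exact hf.mul hg M h

variable {U : Set I}

-- If `U` separates the supports of the two degrees, only the subrepresentation formed by the spaces
-- at the vertices in `U` can contribute to the product.
omit [Finite I] [∀ i j : I, Finite (i ⟶ j)] in
theorem IsHomogeneous.isSupport_of_ne_zero (hf : IsHomogeneous d f) (hg : IsHomogeneous d' g)
    (hd : ∀ i ∈ U, d i = 0) (hd' : ∀ i ∉ U, d' i = 0) {R : F1Rep.{u, v} I} {L : Sub R}
    (h : toFinsupp I f (cls L.quot) * toFinsupp I g (cls L.rep) ≠ 0) : L.IsSupport U := by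
  rw [Sub.isSupport_iff, hf _ (left_ne_zero_of_mul h), hg _ (right_ne_zero_of_mul h)]
  exact ⟨hd', hd⟩

theorem IsHomogeneous.mul_apply_of_isSupport (hf : IsHomogeneous d f) (hg : IsHomogeneous d' g)
    (hd : ∀ i ∈ U, d i = 0) (hd' : ∀ i ∉ U, d' i = 0) {R : F1Rep.{u, v} I} {L : Sub R}
    (hL : L.IsSupport U) : toFinsupp I (f * g) (cls R) =
      toFinsupp I f (cls L.quot) * toFinsupp I g (cls L.rep) := by
  rw [mul_apply_cls]
  refine Finset.sum_eq_single L (fun L' _ hne => ?_) fun h => (h (Finset.mem_univ _)).elim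
  by_contra h
  exact hne ((hf.isSupport_of_ne_zero hg hd hd' h).eq hL)

theorem IsHomogeneous.mul_apply_eq_zero (hf : IsHomogeneous d f) (hg : IsHomogeneous d' g)
    (hd : ∀ i ∈ U, d i = 0) (hd' : ∀ i ∉ U, d' i = 0) {R : F1Rep.{u, v} I} {i j : I} (h : i ⟶ j)
    (hi : i ∈ U) (hj : j ∉ U) (x : R.V i) (hx : R.map h x ≠ 0) :
    toFinsupp I (f * g) (cls R) = 0 := by
  rw [mul_apply_cls]
  refine Finset.sum_eq_zero fun L _ => ?_
  by_contra h0
  have hL := hf.isSupport_of_ne_zero hg hd hd' h0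
  rcases (hL j _).1 (L.map_mem h x ((hL i x).2 (Or.inr hi))) with h1 | h1
  · exact hx h1
  · exact hj h1

end Mul

variable {n : ℕ} (N : PathNumbering I n)

attribute [local instance] LieRing.ofAssociativeRing

/-- A primitive function whose degree is not the dimension vector of an indecomposable
representation vanishes. -/
theorem IsPrimitive.eq_zero (N : PathNumbering I n) {f : HallAlgebra.{u, v} I} (hf : IsPrimitive f)
    {d : I → ℕ} (hd : IsHomogeneous d f) (hd0 : d ≠ 0)
    (hdI : ∀ a b, d ≠ (N.interval a b).indicator 1) : f = 0 := by
  refine ext_cls fun M => ?_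
  rw [_root_.map_zero, Finsupp.zero_apply]
  by_contra hM
  have hdM := hd M hM
  have h0 : ¬ ∀ i (x : M.V i), x = 0 := by
    intro h
    refine hd0 (hdM ▸ funext fun i => ?_)
    exact dimVec_eq_zero_iff.2 (h i)
  push Not at h0
  obtain ⟨i, x, hx⟩ := h0
  obtain ⟨a, b, C, -, hC, -, hxC, hCd⟩ := exists_isFull_mem N x hx
  -- The representation splits as `C` and its quotient. The quotient is nonzero because the
  -- dimension vector of `C` is the indicator of an interval and `d` is not.
  rw [← cls_eq hC.sumIso, hf.apply_sum] at hM
  · exact hM rfl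
  · exact fun h => hx (congrArg C.repVal (h i (C.repMk x hxC)))
  · intro h
    refine hdI a b (hdM ▸ funext fun j => ?_)
    rw [dimVec_sub_quot C, dimVec_eq_zero_iff.2 (h j), zero_add, hCd]

/-- The simple representations satisfy the Serre relations. -/
theorem typeASerre_simple :
    TypeASerre (N.extend fun i => of (cls (simple.{u, v} i))) := by
  classical
  refine N.typeASerre_extend (fun i j hij => ?_) fun i j hij => ?_
  · have hne : i ≠ j := by rintro rfl; omega
    refine IsPrimitive.eq_zero N ((isPrimitive_simple i).lie (isPrimitive_simple j))
      ((isHomogeneous_of _).lie (isHomogeneous_of _)) (fun h => ?_) fun a b h => ?_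
    · have := congrFun h i
      simp [dimVec_simple] at this
    · have hi := congrFun h i
      have hj := congrFun h j
      have hjn := N.pos_lt j
      -- The degree is 1 at `i` and `j` but 0 at the vertex after `i`, which lies strictly between
      -- them, so it is not the indicator of an interval.
      obtain ⟨k, hk⟩ := N.exists_pos (show N.pos i + 1 < n by omega)
      have hk' := congrFun h k
      have hki : k ≠ i := by rintro rfl; omega
      have hkj : k ≠ j := by rintro rfl; omega
      simp only [Pi.add_apply, dimVec_simple, hne, hne.symm, hki, hkj, if_true, if_false,
        Set.indicator_apply, N.mem_interval, Pi.one_apply] at hi hj hk'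
      split_ifs at hi hj hk' <;> omega
  · have hne : i ≠ j := by rintro rfl; omega
    refine IsPrimitive.eq_zero N ((isPrimitive_simple i).lie
      ((isPrimitive_simple i).lie (isPrimitive_simple j)))
      ((isHomogeneous_of _).lie ((isHomogeneous_of _).lie (isHomogeneous_of _)))
      (fun h => ?_) fun a b h => ?_
    · have := congrFun h i
      simp [dimVec_simple] at this
    -- The degree takes the value 2 at `i`, which no indicator function does.
    · have hi := congrFun h i
      simp only [Pi.add_apply, dimVec_simple, hne, if_true, if_false,
        Set.indicator_apply, Pi.one_apply] at hi
      split_ifs at hi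
      all_goals omega

theorem isHomogeneous_rootVec (a l : ℕ) : IsHomogeneous ((N.interval a (a + l)).indicator 1)
    (rootVec (N.extend fun i => of (cls (simple.{u, v} i))) a l) := by
  classical
  rcases lt_or_ge (a + l) n with h | h
  · induction l generalizing a with
    | zero =>
      obtain ⟨i, rfl⟩ := N.exists_pos (show a < n by omega)
      rw [rootVec, N.extend_pos]
      convert isHomogeneous_of (simple.{u, v} i) using 1
      funext j
      rw [dimVec_simple, Set.indicator_apply, N.mem_interval]
      by_cases hj : j = i
      · subst hj; simp
      · have := N.pos_ne hj
        rw [if_neg hj, if_neg (by omega)]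
    | succ l ih =>
      obtain ⟨i, rfl⟩ := N.exists_pos (show a < n by omega)
      rw [rootVec, N.extend_pos]
      convert (isHomogeneous_of (simple.{u, v} i)).lie (ih (N.pos i + 1) (by omega)) using 1
      funext j
      rw [Pi.add_apply, dimVec_simple, Set.indicator_apply, Set.indicator_apply, N.mem_interval,
        N.mem_interval]
      by_cases hj : j = i
      · subst hj
        rw [if_pos ⟨le_rfl, by omega⟩, if_pos rfl, if_neg (by omega), add_zero, Pi.one_apply]
      · have := N.pos_ne hj
        rw [if_neg hj, zero_add]
        split_ifs <;> first | rfl | omega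
  · rw [rootVec_eq_zero (fun i => N.extend_of_le _) h]
    exact isHomogeneous_zero _

/-- In the bracket of `[S i]` with the shorter root vector exactly one of the two products is
nonzero on `R`, depending on the direction of the first edge. The other one would require a
subrepresentation that contains the source of this edge but not its target. Up to sign the surviving
product is the value of the shorter root vector at a full representation on the shorter interval. -/
theorem rootVec_apply_ne_zero {a l : ℕ} (h : a + l < n) {R : F1Rep.{u, v} I}
    (hR : IsFull (N.interval a (a + l)) R) (hd : ∀ i ∈ N.interval a (a + l), dimVec R i = 1) :
    toFinsupp I (rootVec (N.extend fun i => of (cls (simple.{u, v} i))) a l) (cls R) ≠ 0 := by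
  classical
  have hd' : ∀ i, dimVec R i = if i ∈ N.interval a (a + l) then 1 else 0 := by
    intro i
    split_ifs with hi
    · exact hd i hi
    · exact dimVec_eq_zero_iff.2 (hR.eq_zero_of_not_mem hi)
  induction l generalizing a R with
  | zero =>
    obtain ⟨i, rfl⟩ := N.exists_pos (show a < n by omega)
    rw [rootVec, N.extend_pos, toFinsupp_of, if_pos]
    · exact one_ne_zero
    · refine (cls_eq_simple N (funext fun j => ?_)).symm
      rw [hd', dimVec_simple]
      refine if_congr ?_ rfl rfl
      rw [N.mem_interval, ← N.pos_injective.eq_iff]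
      omega
  | succ l ih =>
    obtain ⟨i, rfl⟩ := N.exists_pos (show a < n by omega)
    obtain ⟨j, hj⟩ := N.exists_pos (show N.pos i + 1 < n by omega)
    set S := N.interval (N.pos i) (N.pos i + (l + 1)) with hS
    set U := N.interval (N.pos i + 1) (N.pos i + 1 + l) with hU
    have hiU : i ∉ U := by rw [hU, N.mem_interval]; omega
    have hiS : i ∈ S := by rw [hS, N.mem_interval]; omega
    have hjU : j ∈ U := by rw [hU, N.mem_interval]; omega
    have hji : j ≠ i := by rintro rfl; omega
    have hSU : ∀ k, k ∈ S ↔ k = i ∨ k ∈ U := by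
      intro k
      rw [hS, hU, N.mem_interval, N.mem_interval, ← N.pos_injective.eq_iff]
      omega
    have hUS : U ⊆ S := fun k hk => (hSU k).2 (Or.inr hk)
    have hE := isHomogeneous_of (simple.{u, v} i)
    have hy := isHomogeneous_rootVec N (N.pos i + 1) l
    rw [← hU] at hy
    set y := rootVec (N.extend fun i => of (cls (simple.{u, v} i))) (N.pos i + 1) l with hy'
    have hE0 : ∀ k ∈ U, dimVec (simple i : F1Rep.{u, v} I) k = 0 := fun k hk => by
      rw [dimVec_simple, if_neg]; rintro rfl; exact hiU hk
    have hE1 : ∀ k ∉ ({i} : Set I), dimVec (simple i : F1Rep.{u, v} I) k = 0 := fun k hk => by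
      rw [dimVec_simple]; exact if_neg hk
    have hy0 : ∀ k ∉ U, U.indicator (1 : I → ℕ) k = 0 := fun k hk =>
      Set.indicator_of_notMem hk _
    have hy1 : ∀ k ∈ ({i} : Set I), U.indicator (1 : I → ℕ) k = 0 := by
      rintro k rfl; exact hy0 k hiU
    have hne : ∀ k ∈ S, ∃ x : R.V k, x ≠ 0 := by
      intro k hk
      by_contra! hx
      have := hd k hk
      rw [dimVec_eq_zero_iff.2 hx] at this
      exact zero_ne_one this
    rw [rootVec, ← hy', N.extend_pos, LieRing.of_associative_ring_bracket, map_sub,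
      Finsupp.sub_apply]
    have hsimple : ∀ M : F1Rep.{u, v} I, (∀ k, dimVec M k = if k = i then 1 else 0) →
        toFinsupp I (of (cls (simple.{u, v} i))) (cls M) = 1 := by
      intro M hM
      rw [toFinsupp_of, if_pos]
      exact (cls_eq_simple N (funext fun k => by rw [hM, dimVec_simple])).symm
    have hiSU : ∀ k ∉ U, (if k ∈ S then 1 else 0) = if k = i then 1 else 0 := by
      intro k hk
      exact if_congr (by rw [hSU]; exact or_iff_left hk) rfl rfl
    rcases N.exists_hom hj.symm with ⟨⟨e⟩⟩ | ⟨⟨e⟩⟩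
    · obtain ⟨L, hL⟩ := exists_isSupport U R fun k m f hk hm x => by
        by_cases hmS : m ∈ S
        · obtain rfl := ((hSU m).1 hmS).resolve_right hm
          have hadj := N.adj_of_hom f
          rw [hU, N.mem_interval] at hk
          obtain rfl : k = j := N.pos_injective (by omega)
          exact ((N.isEmpty_hom e).false f).elim
        · exact hR.eq_zero_of_not_mem hmS _
      have hLd := Sub.isSupport_iff.1 hL
      have hLq : ∀ k ∉ U, dimVec L.quot k = if k = i then 1 else 0 := by
        intro k hk
        rw [← hiSU k hk, ← hd', dimVec_sub_quot L, hLd.1 k hk, add_zero]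
      have hLr : ∀ k ∈ U, dimVec L.rep k = 1 := by
        intro k hk
        rw [← hd k (hUS hk), dimVec_sub_quot L, hLd.2 k hk, zero_add]
      obtain ⟨x, hx⟩ := hne i hiS
      rw [hE.mul_apply_of_isSupport hy hE0 hy0 hL,
        hy.mul_apply_eq_zero hE hy1 hE1 e rfl hji x fun h0 => hx (hR.eq_zero e hiS (hUS hjU) x h0),
        sub_zero, hsimple, one_mul]
      · have hLf : IsFull U L.rep := by
          refine ⟨?_, fun k hk => dimVec_eq_zero_iff.1 (hLd.1 k hk)⟩
          rw [isBijOn_rep_iff fun k hk x => (hL k x).2 (Or.inr hk)]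
          exact hR.toIsBijOn.mono hUS
        exact ih (by omega) hLf hLr fun k => by
          split_ifs with hk
          · exact hLr k hk
          · exact hLd.1 k hk
      · intro k
        by_cases hk : k ∈ U
        · rw [hLd.2 k hk, if_neg]; rintro rfl; exact hiU hk
        · exact hLq k hk
    · obtain ⟨L, hL⟩ := exists_isSupport {i} R fun k m f hk hm x => by
        obtain rfl : k = i := hk
        by_cases hmS : m ∈ S
        · have hmU := ((hSU m).1 hmS).resolve_left hm
          have hadj := N.adj_of_hom f
          rw [hU, N.mem_interval] at hmU
          obtain rfl : m = j := N.pos_injective (by omega)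
          exact ((N.isEmpty_hom e).false f).elim
        · exact hR.eq_zero_of_not_mem hmS _
      have hLd := Sub.isSupport_iff.1 hL
      have hLq : ∀ k ∈ U, dimVec L.quot k = 1 := by
        intro k hk
        rw [← hd k (hUS hk), dimVec_sub_quot L, hLd.1 k (by rintro rfl; exact hiU hk), add_zero]
      have hLq' : ∀ k ∉ U, dimVec L.quot k = 0 := by
        intro k hk
        by_cases hki : k = i
        · exact hLd.2 k hki
        · have := dimVec_sub_quot L k
          rw [hd', if_neg (by rw [hSU]; tauto)] at this
          omega
      obtain ⟨x, hx⟩ := hne j (hUS hjU)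
      rw [hE.mul_apply_eq_zero hy hE0 hy0 e hjU hiU x fun h0 => hx (hR.eq_zero e (hUS hjU) hiS x h0),
        hy.mul_apply_of_isSupport hE hy1 hE1 hL, zero_sub, hsimple L.rep, mul_one, neg_ne_zero]
      · have hLf : IsFull U L.quot := by
          refine ⟨?_, fun k hk => dimVec_eq_zero_iff.1 (hLq' k hk)⟩
          rw [isBijOn_quot_iff fun k hk x hx => ((hL k x).1 hx).resolve_right
            (by rintro rfl; exact hiU hk)]
          exact hR.toIsBijOn.mono hUS
        exact ih (by omega) hLf hLq fun k => by
          split_ifs with hk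
          · exact hLq k hk
          · exact hLq' k hk
      · intro k
        by_cases hk : k = i
        · have := dimVec_sub_quot L k
          rw [hd', if_pos (by rw [hSU]; exact Or.inl hk), hLd.2 k hk] at this
          rw [if_pos hk]; omega
        · rw [if_neg hk, hLd.1 k hk]

/-- In every degree that is the dimension vector of an indecomposable representation, the root
vector is nonzero. -/
theorem exists_rootVec_apply_ne_zero {a l : ℕ} (h : a + l < n) : ∃ R : F1Rep.{u, v} I,
    toFinsupp I (rootVec (N.extend fun i => of (cls (simple.{u, v} i))) a l) (cls R) ≠ 0 :=
  ⟨constRep (N.interval a (a + l)) 1, rootVec_apply_ne_zero N h (isFull_constRep _ _) fun i hi => by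
    rw [dimVec_constRep, Set.indicator_of_mem hi]⟩

end HallAlgebra

/-! ### Generation of the Hall algebra by the simple representations -/

namespace HallAlgebra

open F1Rep

variable {I : Type u} [Quiver.{v} I] [Fintype I] [∀ i j : I, Finite (i ⟶ j)] {n : ℕ}

/-- The Hall algebra is generated by the simple representations. -/
theorem adjoin_simple (N : PathNumbering I n) :
    Algebra.adjoin ℂ (Set.range fun i : I => of (cls (simple.{u, v} i))) = ⊤ := by
  set A := Algebra.adjoin ℂ (Set.range fun i : I => of (cls (simple.{u, v} i))) with hA
  have hof : ∀ M : F1Rep.{u, v} I, of (cls M) ∈ A := by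
    refine of_mem_of_concentrated A.toSubring N fun i M hM => ?_
    rw [cls_eq_constRep_singleton N hM]
    have h := A.smul_mem (A.pow_mem (Algebra.subset_adjoin ⟨i, rfl⟩) (dimVec M i))
      ((dimVec M i).factorial : ℂ)⁻¹
    rw [simple_pow N, ← Nat.cast_smul_eq_nsmul ℂ, smul_smul,
      inv_mul_cancel₀ (Nat.cast_ne_zero.2 (Nat.factorial_ne_zero _)), one_smul] at h
    exact h
  refine eq_top_iff.2 fun f _ => ?_
  rw [eq_sum_of f]
  refine A.sum_mem fun X _ => A.smul_mem ?_ _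
  rw [← cls_rep X]
  exact hof _

end HallAlgebra

/-! ### Commutation rules, coproduct and counit of the extended Hall algebra -/

namespace ExtHallAlgebra

open F1Rep

variable {I : Type u} [Quiver.{v} I]

variable [Finite I] [∀ i j : I, Finite (i ⟶ j)]

theorem toFinsupp_ofSym (P : SymmetricAlgebra ℂ (HallCartan.{u, v} I)) :
    toFinsupp I (ofSym P) = Finsupp.single (cls (zeroRep I)) P := rfl

theorem toFinsupp_ofHall (f : HallAlgebra.{u, v} I) (X : IsoClass.{u, v} I) :
    toFinsupp I (ofHall f) X = algebraMap ℂ _ (HallAlgebra.toFinsupp I f X) := rfl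

theorem ofSym_mul_eq (P : SymmetricAlgebra ℂ (HallCartan.{u, v} I)) (x : ExtHallAlgebra.{u, v} I) :
    toFinsupp I (ofSym P * x) = P • toFinsupp I x :=
  convolution_single_left (A := SymmetricAlgebra ℂ (HallCartan.{u, v} I))
    (fun α => (symShift α).toRingHom) (RingHom.ext fun y => DFunLike.congr_fun symShift_zero y) P
    (toFinsupp I x)

/-- The inclusion of the symmetric algebra into the extended Hall algebra, as a homomorphism. -/
noncomputable def ofSymHom :
    SymmetricAlgebra ℂ (HallCartan.{u, v} I) →ₐ[ℂ] ExtHallAlgebra.{u, v} I :=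
  AlgHom.ofLinearMap ofSym rfl fun P Q => (toFinsupp I).injective (by
    rw [ofSym_mul_eq, toFinsupp_ofSym, toFinsupp_ofSym, Finsupp.smul_single, smul_eq_mul])

theorem ofSymHom_apply (P : SymmetricAlgebra ℂ (HallCartan.{u, v} I)) :
    ofSymHom P = ofSym P := rfl

/-- The inclusion of the Hall algebra into the extended Hall algebra, as a homomorphism. -/
noncomputable def ofHallHom : HallAlgebra.{u, v} I →ₐ[ℂ] ExtHallAlgebra.{u, v} I :=
  AlgHom.ofLinearMap ofHall (ofHall_of _) fun f g => (toFinsupp I).injective (Finsupp.ext fun X => by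
    rw [mul_apply, toFinsupp_ofHall, HallAlgebra.mul_apply, map_sum]
    refine Finset.sum_congr rfl fun L _ => ?_
    rw [toFinsupp_ofHall, toFinsupp_ofHall, AlgHom.commutes, map_mul])

theorem ofHallHom_apply (f : HallAlgebra.{u, v} I) : ofHallHom f = ofHall f := rfl

theorem ofHallHom_injective : Function.Injective (ofHallHom (I := I)) := by
  refine (injective_iff_map_eq_zero _).2 fun f hf => ?_
  refine (HallAlgebra.toFinsupp I).injective (Finsupp.ext fun X => ?_)
  have h : toFinsupp I (ofHallHom f) X = toFinsupp I 0 X := congrArg (fun x => toFinsupp I x X) hf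
  rw [ofHallHom_apply, toFinsupp_ofHall, _root_.map_zero, Finsupp.zero_apply,
    SymmetricAlgebra.algebraMap_eq_zero_iff] at h
  rw [h, _root_.map_zero, Finsupp.zero_apply]

theorem ofSymHom_mul_ofHallHom (P : SymmetricAlgebra ℂ (HallCartan.{u, v} I))
    (X : IsoClass.{u, v} I) : ofSymHom P * ofHallHom (HallAlgebra.of X) =
      (toFinsupp I).symm (Finsupp.single X P) := ofSym_mul_ofHall P X

/-- Two linear maps that agree on the products `P [M]` are equal. -/
theorem linearMap_ext {A : Type*} [AddCommGroup A] [Module ℂ A]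
    {F G : ExtHallAlgebra.{u, v} I →ₗ[ℂ] A}
    (h : ∀ P X, F (ofSymHom P * ofHallHom (HallAlgebra.of X)) =
      G (ofSymHom P * ofHallHom (HallAlgebra.of X))) : F = G := by
  have : F ∘ₗ (toFinsupp I).symm.toLinearMap = G ∘ₗ (toFinsupp I).symm.toLinearMap := by
    refine Finsupp.lhom_ext fun X P => ?_
    have := h P X
    rwa [ofSymHom_mul_ofHallHom] at this
  refine LinearMap.ext fun x => ?_
  have := DFunLike.congr_fun this (toFinsupp I x)
  simpa only [LinearMap.comp_apply, LinearEquiv.coe_toLinearMap, LinearEquiv.symm_apply_apply]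
    using this

omit [Finite I] [∀ i j : I, Finite (i ⟶ j)] in
/-- A relation `D Z = (Z - Z(α)) D` for all `Z ∈ 𝔥_Q` extends to the symmetric algebra. -/
theorem mul_algHom_eq {A : Type*} [Ring A] [Algebra ℂ A]
    (S : SymmetricAlgebra ℂ (HallCartan.{u, v} I) →ₐ[ℂ] A) (D : A) (α : K0.{u, v} I)
    (h : ∀ Z, D * S (SymmetricAlgebra.ι ℂ _ Z) =
      (S (SymmetricAlgebra.ι ℂ _ Z) - algebraMap ℂ A (Z α)) * D)
    (P : SymmetricAlgebra ℂ (HallCartan.{u, v} I)) : D * S P = S (symShift α P) * D := by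
  induction P using SymmetricAlgebra.induction with
  | algebraMap c => rw [AlgHom.commutes, AlgHom.commutes, AlgHom.commutes, Algebra.commutes]
  | ι Z => rw [h, symShift_ι, map_sub, AlgHom.commutes]
  | mul P Q hP hQ => rw [map_mul, ← mul_assoc, hP, mul_assoc, hQ, map_mul, map_mul, mul_assoc]
  | add P Q hP hQ => rw [map_add, mul_add, hP, hQ, map_add, map_add, add_mul]

theorem ofHallHom_mul_ofSymHom_ι (X : IsoClass.{u, v} I) (Z : HallCartan.{u, v} I) :
    ofHallHom (HallAlgebra.of X) * ofSymHom (SymmetricAlgebra.ι ℂ _ Z) =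
      (ofSymHom (SymmetricAlgebra.ι ℂ _ Z) - algebraMap ℂ _ (Z X.k0)) *
        ofHallHom (HallAlgebra.of X) := by
  have h := relation Z X
  rw [sub_mul, ← Algebra.smul_def]
  rw [sub_eq_iff_eq_add] at h
  exact eq_sub_of_add_eq' h.symm

theorem ofHallHom_mul_ofSymHom (X : IsoClass.{u, v} I)
    (P : SymmetricAlgebra ℂ (HallCartan.{u, v} I)) :
    ofHallHom (HallAlgebra.of X) * ofSymHom P =
      ofSymHom (symShift X.k0 P) * ofHallHom (HallAlgebra.of X) :=
  mul_algHom_eq ofSymHom _ _ (ofHallHom_mul_ofSymHom_ι X) P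

/-- The coproduct on the symmetric algebra. -/
noncomputable def comulSym : SymmetricAlgebra ℂ (HallCartan.{u, v} I) →ₐ[ℂ]
    ExtHallAlgebra.{u, v} I ⊗[ℂ] ExtHallAlgebra.{u, v} I :=
  (Algebra.TensorProduct.map ofSymHom ofSymHom).comp (Bialgebra.comulAlgHom ℂ _)

/-- The coproduct on the Hall algebra. -/
noncomputable def comulHall : HallAlgebra.{u, v} I →ₗ[ℂ]
    ExtHallAlgebra.{u, v} I ⊗[ℂ] ExtHallAlgebra.{u, v} I :=
  (Algebra.TensorProduct.map ofHallHom ofHallHom).toLinearMap ∘ₗ HallAlgebra.comul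

theorem comulHall_mul (f g : HallAlgebra.{u, v} I) :
    comulHall (f * g) = comulHall f * comulHall g := by
  unfold comulHall
  rw [LinearMap.comp_apply, HallAlgebra.comul_mul, AlgHom.toLinearMap_apply, map_mul]
  rfl

theorem comulSym_ι (Z : HallCartan.{u, v} I) : comulSym (SymmetricAlgebra.ι ℂ _ Z) =
    ofSymHom (SymmetricAlgebra.ι ℂ _ Z) ⊗ₜ 1 + 1 ⊗ₜ ofSymHom (SymmetricAlgebra.ι ℂ _ Z) := by
  unfold comulSym
  rw [AlgHom.comp_apply, Bialgebra.comulAlgHom_apply, SymmetricAlgebra.comul_ι, map_add,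
    Algebra.TensorProduct.map_tmul, Algebra.TensorProduct.map_tmul, map_one]

theorem comulHall_of_isPrimitive {f : HallAlgebra.{u, v} I} (hf : HallAlgebra.IsPrimitive f) :
    comulHall f = ofHallHom f ⊗ₜ 1 + 1 ⊗ₜ ofHallHom f := by
  unfold comulHall
  rw [LinearMap.comp_apply, hf, map_add, AlgHom.toLinearMap_apply, AlgHom.toLinearMap_apply,
    Algebra.TensorProduct.map_tmul, Algebra.TensorProduct.map_tmul, map_one]

theorem comul_ofSymHom_mul_of (P : SymmetricAlgebra ℂ (HallCartan.{u, v} I))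
    (X : IsoClass.{u, v} I) : comul (ofSymHom P * ofHallHom (HallAlgebra.of X)) =
      comulSym P * comulHall (HallAlgebra.of X) := by
  rw [ofSymHom_mul_ofHallHom]
  unfold comul
  rw [LinearMap.comp_apply, LinearEquiv.coe_toLinearMap, LinearEquiv.apply_symm_apply,
    Finsupp.lsum_apply]
  exact Finsupp.sum_single_index (_root_.map_zero _)

theorem comul_ofSymHom_mul_ofHallHom (P : SymmetricAlgebra ℂ (HallCartan.{u, v} I))
    (f : HallAlgebra.{u, v} I) : comul (ofSymHom P * ofHallHom f) = comulSym P * comulHall f := by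
  rw [HallAlgebra.eq_sum_of f]
  simp only [map_sum, Finset.mul_sum, map_smul, mul_smul_comm, comul_ofSymHom_mul_of]

theorem comul_ι_mul (Z : HallCartan.{u, v} I) (x : ExtHallAlgebra.{u, v} I) :
    comul (ofSymHom (SymmetricAlgebra.ι ℂ _ Z) * x) =
      (ofSymHom (SymmetricAlgebra.ι ℂ _ Z) ⊗ₜ 1 + 1 ⊗ₜ ofSymHom (SymmetricAlgebra.ι ℂ _ Z)) *
        comul x := by
  have h : comul ∘ₗ LinearMap.mulLeft ℂ (ofSymHom (SymmetricAlgebra.ι ℂ _ Z)) =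
      LinearMap.mulLeft ℂ (comulSym (SymmetricAlgebra.ι ℂ _ Z)) ∘ₗ comul :=
    linearMap_ext fun P X => by
      rw [LinearMap.comp_apply, LinearMap.comp_apply, LinearMap.mulLeft_apply,
        LinearMap.mulLeft_apply, ← mul_assoc, ← map_mul, comul_ofSymHom_mul_of, map_mul,
        comul_ofSymHom_mul_of, mul_assoc]
  rw [← comulSym_ι]
  exact DFunLike.congr_fun h x

/-- The coproduct is defined on products `P [M]` in this order, so `E` must be moved past `P`, and
its coproduct past that of `P`. The second rule `hD` is checked on elements of 𝔥_Q, where the shift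
by `Z(α)` occurs in one tensor factor at a time. -/
theorem comul_of_mul {X : IsoClass.{u, v} I} (hX : HallAlgebra.IsPrimitive (HallAlgebra.of X))
    (x : ExtHallAlgebra.{u, v} I) : comul (ofHallHom (HallAlgebra.of X) * x) =
      (ofHallHom (HallAlgebra.of X) ⊗ₜ 1 + 1 ⊗ₜ ofHallHom (HallAlgebra.of X)) * comul x := by
  set E := ofHallHom (HallAlgebra.of X) with hE
  have hD : ∀ P, (E ⊗ₜ[ℂ] 1 + 1 ⊗ₜ[ℂ] E) * comulSym P = comulSym (symShift X.k0 P) *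
      (E ⊗ₜ[ℂ] 1 + 1 ⊗ₜ[ℂ] E) := by
    refine mul_algHom_eq comulSym _ _ fun Z => ?_
    have h1 := ofHallHom_mul_ofSymHom_ι X Z
    rw [← hE] at h1
    rw [comulSym_ι]
    set z := ofSymHom (SymmetricAlgebra.ι ℂ _ Z)
    rw [sub_mul, ← Algebra.smul_def] at h1 ⊢
    simp only [mul_add, add_mul, Algebra.TensorProduct.tmul_mul_tmul, one_mul, mul_one, h1,
      TensorProduct.sub_tmul, TensorProduct.tmul_sub, TensorProduct.tmul_smul,
      TensorProduct.smul_tmul', smul_add]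
    abel
  have h : comul ∘ₗ LinearMap.mulLeft ℂ E =
      LinearMap.mulLeft ℂ (A := ExtHallAlgebra.{u, v} I ⊗[ℂ] ExtHallAlgebra.{u, v} I)
        (E ⊗ₜ[ℂ] 1 + 1 ⊗ₜ[ℂ] E) ∘ₗ comul :=
    linearMap_ext fun P Y => by
      rw [LinearMap.comp_apply, LinearMap.comp_apply, LinearMap.mulLeft_apply,
        LinearMap.mulLeft_apply, ← mul_assoc, hE, ofHallHom_mul_ofSymHom, mul_assoc, ← map_mul,
        comul_ofSymHom_mul_ofHallHom, comulHall_mul, comul_ofSymHom_mul_of,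
        comulHall_of_isPrimitive hX, ← hE, ← mul_assoc, ← mul_assoc, hD]
  exact DFunLike.congr_fun h x

theorem counit_ofSymHom_mul_ofHallHom (P : SymmetricAlgebra ℂ (HallCartan.{u, v} I))
    (f : HallAlgebra.{u, v} I) : counit (ofSymHom P * ofHallHom f) =
      HallAlgebra.toFinsupp I f (cls (zeroRep I)) * Coalgebra.counit (R := ℂ) P := by
  unfold counit
  rw [LinearMap.comp_apply, LinearMap.comp_apply, LinearEquiv.coe_toLinearMap,
    Finsupp.lapply_apply, ofSymHom_apply, ofSym_mul_eq, Finsupp.smul_apply, ofHallHom_apply,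
    toFinsupp_ofHall, smul_eq_mul, mul_comm, ← Algebra.smul_def, map_smul, smul_eq_mul]

theorem counit_ι_mul (Z : HallCartan.{u, v} I) (x : ExtHallAlgebra.{u, v} I) :
    counit (ofSymHom (SymmetricAlgebra.ι ℂ _ Z) * x) = 0 := by
  have h : counit ∘ₗ LinearMap.mulLeft ℂ (ofSymHom (SymmetricAlgebra.ι ℂ _ Z)) = 0 :=
    linearMap_ext fun P X => by
      rw [LinearMap.comp_apply, LinearMap.mulLeft_apply, ← mul_assoc, ← map_mul,
        counit_ofSymHom_mul_ofHallHom, Bialgebra.counit_mul, SymmetricAlgebra.counit_ι, zero_mul,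
        mul_zero, LinearMap.zero_apply]
  exact DFunLike.congr_fun h x

/-- A quotient of the zero representation is zero, so `[X]` vanishes on it. -/
theorem counit_of_mul {X : IsoClass.{u, v} I} (hX : X ≠ cls (zeroRep I))
    (x : ExtHallAlgebra.{u, v} I) : counit (ofHallHom (HallAlgebra.of X) * x) = 0 := by
  have h : counit ∘ₗ LinearMap.mulLeft ℂ (ofHallHom (HallAlgebra.of X)) = 0 :=
    linearMap_ext fun P Y => by
      rw [LinearMap.comp_apply, LinearMap.mulLeft_apply, ← mul_assoc, ofHallHom_mul_ofSymHom,
        mul_assoc, ← map_mul, counit_ofSymHom_mul_ofHallHom, LinearMap.zero_apply,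
        HallAlgebra.mul_apply_cls, Finset.sum_eq_zero, zero_mul]
      intro L _
      classical
      rw [HallAlgebra.toFinsupp_of, if_neg, zero_mul]
      rintro rfl
      exact hX (cls_eq_zero.2 fun i x => Subtype.ext rfl)
  exact DFunLike.congr_fun h x

end ExtHallAlgebra

theorem PathNumbering.map_extend {I : Type u} [Quiver.{v} I] {n : ℕ} (N : PathNumbering I n)
    {A B : Type*} [Zero A] [Zero B] (φ : A → B) (h0 : φ 0 = 0) (f : I → A) (k : ℕ) :
    φ (N.extend f k) = N.extend (fun i => φ (f i)) k := by
  unfold PathNumbering.extend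
  split_ifs
  · rfl
  · exact h0

/-! ### Generators of the enveloping algebras -/

section

attribute [local instance] LieRing.ofAssociativeRing

theorem adjoin_ι_lieSpan {L : Type*} [LieRing L] [LieAlgebra ℂ L] (s : Set L) :
    Algebra.adjoin ℂ {x | ∃ (y : L) (hy : y ∈ s), x = UniversalEnvelopingAlgebra.ι ℂ
      (⟨y, LieSubalgebra.subset_lieSpan hy⟩ : LieSubalgebra.lieSpan ℂ L s)} = ⊤ := by
  rw [eq_top_iff, ← UniversalEnvelopingAlgebra.adjoin_range_ι, Algebra.adjoin_le_iff]
  rintro _ ⟨⟨x, hx⟩, rfl⟩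
  rw [SetLike.mem_coe]
  induction hx using LieSubalgebra.lieSpan_induction with
  | mem y hy => exact Algebra.subset_adjoin ⟨y, hy, rfl⟩
  | zero =>
    have : (⟨0, zero_mem _⟩ : LieSubalgebra.lieSpan ℂ L s) = 0 := rfl
    rw [this, map_zero]
    exact zero_mem _
  | smul c y hy h =>
    have : (⟨c • y, (LieSubalgebra.lieSpan ℂ L s).smul_mem c hy⟩ : LieSubalgebra.lieSpan ℂ L s) =
      c • ⟨y, hy⟩ := rfl
    rw [this, map_smul]
    exact Subalgebra.smul_mem _ h c
  | add y z hy hz h h' =>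
    have : (⟨y + z, add_mem hy hz⟩ : LieSubalgebra.lieSpan ℂ L s) = ⟨y, hy⟩ + ⟨z, hz⟩ := rfl
    rw [this, map_add]
    exact add_mem h h'
  | lie y z hy hz h h' =>
    have : (⟨⁅y, z⁆, (LieSubalgebra.lieSpan ℂ L s).lie_mem hy hz⟩ :
      LieSubalgebra.lieSpan ℂ L s) = ⁅(⟨y, hy⟩ : LieSubalgebra.lieSpan ℂ L s), ⟨z, hz⟩⁆ := rfl
    rw [this, LieHom.map_lie, LieRing.of_associative_ring_bracket]
    exact sub_mem (mul_mem h h') (mul_mem h' h)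

variable {I : Type u} [Quiver.{v} I] [DecidableEq I]

theorem UNPlus.adjoin_e : Algebra.adjoin ℂ (Set.range (UNPlus.e : I → UNPlus I)) = ⊤ := by
  refine eq_top_iff.2 ((adjoin_ι_lieSpan _).symm.le.trans (Algebra.adjoin_mono ?_))
  rintro _ ⟨_, ⟨i, rfl⟩, rfl⟩
  exact ⟨i, rfl⟩

theorem UBPrime.adjoin_h_e : Algebra.adjoin ℂ (Set.range (UBPrime.h : I → UBPrime I) ∪
    Set.range (UBPrime.e : I → UBPrime I)) = ⊤ := by
  refine eq_top_iff.2 ((adjoin_ι_lieSpan _).symm.le.trans (Algebra.adjoin_mono ?_))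
  rintro _ ⟨_, ⟨i, rfl⟩ | ⟨i, rfl⟩, rfl⟩
  · exact Or.inl ⟨i, rfl⟩
  · exact Or.inr ⟨i, rfl⟩

theorem UBPrime.algHom_ext {A : Type*} [Ring A] [Algebra ℂ A] {φ ψ : UBPrime I →ₐ[ℂ] A}
    (hh : ∀ i, φ (UBPrime.h i) = ψ (UBPrime.h i)) (he : ∀ i, φ (UBPrime.e i) = ψ (UBPrime.e i)) :
    φ = ψ := by
  refine AlgHom.ext_of_adjoin_eq_top UBPrime.adjoin_h_e ?_
  rintro _ (⟨i, rfl⟩ | ⟨i, rfl⟩)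
  · exact hh i
  · exact he i

theorem UNPlus.algHom_ext {A : Type*} [Ring A] [Algebra ℂ A] {φ ψ : UNPlus I →ₐ[ℂ] A}
    (he : ∀ i, φ (UNPlus.e i) = ψ (UNPlus.e i)) : φ = ψ := by
  refine AlgHom.ext_of_adjoin_eq_top UNPlus.adjoin_e ?_
  rintro _ ⟨i, rfl⟩
  exact he i

theorem UNPlus.toUBPrime_ι (x : nPlus I) : UNPlus.toUBPrime (UniversalEnvelopingAlgebra.ι ℂ x) =
    UniversalEnvelopingAlgebra.ι ℂ (LieSubalgebra.inclusion (nPlus_le_bPrime I) x) :=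
  UniversalEnvelopingAlgebra.lift_ι_apply ℂ _ _

theorem UNPlus.toUBPrime_e (i : I) : UNPlus.toUBPrime (UNPlus.e i) = UBPrime.e i :=
  UNPlus.toUBPrime_ι _

theorem UNPlus.comul_toUBPrime (x : UNPlus I) :
    envelopingComul (bPrime I) (UNPlus.toUBPrime x) =
      TensorProduct.map UNPlus.toUBPrime.toLinearMap UNPlus.toUBPrime.toLinearMap
        (envelopingComul (nPlus I) x) := by
  have h : (envelopingComul (bPrime I)).comp UNPlus.toUBPrime =
      (Algebra.TensorProduct.map UNPlus.toUBPrime UNPlus.toUBPrime).comp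
        (envelopingComul (nPlus I)) := by
    refine UNPlus.algHom_ext fun i => ?_
    rw [AlgHom.comp_apply, AlgHom.comp_apply, UNPlus.toUBPrime_e, UBPrime.e, envelopingComul_ι,
      UNPlus.e, envelopingComul_ι, map_add, Algebra.TensorProduct.map_tmul,
      Algebra.TensorProduct.map_tmul, map_one, UNPlus.toUBPrime_ι]
    rfl
  exact DFunLike.congr_fun h x

end

/-! ### Borel relations and linear independence in the extended Hall algebra -/

namespace ExtHallAlgebra

open F1Rep

attribute [local instance] LieRing.ofAssociativeRing

variable {I : Type u} [Quiver.{v} I] [Fintype I] [DecidableEq I] [∀ i j : I, Finite (i ⟶ j)] {n : ℕ}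

/-- The image of the generator `e i` in the extended Hall algebra. -/
noncomputable def simpleElem (i : I) : ExtHallAlgebra.{u, v} I :=
  ofHallHom (HallAlgebra.of (cls (simple i)))

/-- The image of the generator `h i` in the extended Hall algebra. -/
noncomputable def corootElem (i : I) : ExtHallAlgebra.{u, v} I :=
  ofSymHom (SymmetricAlgebra.ι ℂ _ (hallCoroot i))

variable (N : PathNumbering I n)

omit [DecidableEq I] in
theorem rootVec_simpleElem (a l : ℕ) : rootVec (N.extend (simpleElem (I := I))) a l =
    ofHallHom (rootVec (N.extend fun i => HallAlgebra.of (cls (simple.{u, v} i))) a l) := by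
  rw [map_rootVec (ofHallHom (I := I)) fun x y => (ofHallHom (I := I)).toLieHom.map_lie x y]
  exact rootVec_congr fun k _ _ => (N.map_extend _ (_root_.map_zero ofHallHom) _ k).symm

theorem borelRelations : BorelRelations N (simpleElem (I := I)) corootElem where
  serre := by
    have h : ∀ k, N.extend (simpleElem (I := I)) k =
        ofHallHom (N.extend (fun i => HallAlgebra.of (cls (simple.{u, v} i))) k) :=
      fun k => (N.map_extend _ (_root_.map_zero ofHallHom) _ k).symm
    have hl : ∀ x y : HallAlgebra.{u, v} I, ⁅ofHallHom x, ofHallHom y⁆ = ofHallHom ⁅x, y⁆ :=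
      fun x y => ((ofHallHom (I := I)).toLieHom.map_lie x y).symm
    have hs := HallAlgebra.typeASerre_simple N
    refine ⟨fun i j hij => ?_, fun i => ?_, fun i => ?_⟩
    · rw [h, h, hl, hs.comm i j hij, _root_.map_zero]
    · rw [h, h, hl, hl, hs.serre, _root_.map_zero]
    · rw [h, h, hl, hl, hs.serre', _root_.map_zero]
  comm i j := by
    rw [LieRing.of_associative_ring_bracket, corootElem, corootElem, ← map_mul ofSymHom,
      ← map_mul ofSymHom, mul_comm, sub_self]
  weight i j := by
    -- The functional `hallCoroot i` takes the value `a j i` at `S j`, while the weight relation has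
    -- `a i j`; the Cartan matrix is symmetric.
    rw [LieRing.of_associative_ring_bracket, N.quiverCartan_eq, cartanA_comm, ← N.quiverCartan_eq,
      ← hallCoroot_simple]
    exact relation (hallCoroot i) (cls (simple j))

omit [∀ i j : I, Finite (i ⟶ j)] in
/-- The values of the functionals `Z i` on the simple representations form a nonsingular matrix. -/
theorem eq_zero_of_sum_cartan (N : PathNumbering I n) (c : I → ℂ)
    (h : ∀ j, ∑ i, c i * (quiverCartan I j i : ℂ) = 0) (i : I) : c i = 0 := by
  have h1 := eq_zero_of_cartanA (n := n) (N.extend c) (fun k hk => N.extend_of_le c hk)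
    (fun q hq => ?_) (N.pos i)
  · rwa [N.extend_pos] at h1
  · obtain ⟨j, rfl⟩ := N.exists_pos hq
    rw [← h j, Finset.sum_range, ← N.equiv.sum_comp]
    refine Finset.sum_congr rfl fun i _ => ?_
    change N.extend c (N.pos i) * (cartanA (N.pos j) (N.pos i) : ℂ) = _
    rw [N.extend_pos, N.quiverCartan_eq]

/-- Root vectors are nonzero functions of pairwise different nonzero degrees, so the value at a
suitable representation isolates each coefficient. What remains is a relation between coroots,
excluded by the nonsingular Cartan matrix. -/
theorem linearIndependent_borelFamily :
    LinearIndependent ℂ (borelFamily N (simpleElem (I := I)) corootElem) := by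
  classical
  rw [Fintype.linearIndependent_iff]
  intro c hc
  have hroot : ∀ (p : Σ a : Fin n, Fin (n - a)) (X : IsoClass.{u, v} I),
      toFinsupp I (borelFamily N (simpleElem (I := I)) corootElem (Sum.inr p)) X =
      algebraMap ℂ _ (HallAlgebra.toFinsupp I
        (rootVec (N.extend fun i => HallAlgebra.of (cls (simple.{u, v} i))) p.1 p.2) X) := by
    intro p X
    change toFinsupp I (rootVec (N.extend (simpleElem (I := I))) p.1 p.2) X = _
    rw [rootVec_simpleElem]
    rfl
  have hcoroot : ∀ (i : I) (X : IsoClass.{u, v} I), cls (zeroRep I) ≠ X →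
      toFinsupp I (borelFamily N (simpleElem (I := I)) corootElem (Sum.inl i)) X = 0 :=
    fun i X hX => Finsupp.single_eq_of_ne hX.symm
  have hsum : ∀ X : IsoClass.{u, v} I, ∑ p, c p •
      toFinsupp I (borelFamily N (simpleElem (I := I)) corootElem p) X = 0 := by
    intro X
    have h := congrArg (fun x => toFinsupp I x X) hc
    simpa only [map_sum, map_smul, Finsupp.finsetSum_apply, Finsupp.smul_apply, _root_.map_zero,
      Finsupp.zero_apply] using h
  have hinr : ∀ p, c (Sum.inr p) = 0 := by
    intro p
    obtain ⟨R, hR⟩ := HallAlgebra.exists_rootVec_apply_ne_zero N (a := p.1) (l := p.2) (by omega)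
    have hdp := HallAlgebra.isHomogeneous_rootVec N p.1 p.2 R hR
    have h := hsum (cls R)
    rw [Fintype.sum_sum_type, Finset.sum_eq_zero, zero_add, Finset.sum_eq_single p] at h
    · rw [hroot, Algebra.smul_def, ← map_mul, SymmetricAlgebra.algebraMap_eq_zero_iff] at h
      exact (mul_eq_zero.1 h).resolve_right hR
    · intro q _ hqp
      rw [hroot]
      by_contra hne
      refine hqp ?_
      have hdq := HallAlgebra.isHomogeneous_rootVec N q.1 q.2 R fun h0 => hne (by
        rw [h0, _root_.map_zero, smul_zero])
      rw [hdp] at hdq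
      have hiff : ∀ k < n, ((p.1 : ℕ) ≤ k ∧ k ≤ p.1 + p.2) ↔ ((q.1 : ℕ) ≤ k ∧ k ≤ q.1 + q.2) := by
        intro k hk
        obtain ⟨i, rfl⟩ := N.exists_pos hk
        have := congrFun hdq i
        rw [Set.indicator_apply, Set.indicator_apply, N.mem_interval, N.mem_interval] at this
        constructor <;> intro h1 <;> by_contra h2
        · rw [if_pos h1, if_neg h2] at this
          exact one_ne_zero this
        · rw [if_neg h2, if_pos h1] at this
          exact zero_ne_one this
      obtain ⟨⟨a, ha⟩, ⟨l, hl⟩⟩ := p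
      obtain ⟨⟨b, hb⟩, ⟨m, hm⟩⟩ := q
      simp only at hiff hl hm
      have h1 := (hiff a ha).1 (by omega)
      have h2 := (hiff b hb).2 (by omega)
      have h3 := (hiff (a + l) (by omega)).1 (by omega)
      have h4 := (hiff (b + m) (by omega)).2 (by omega)
      obtain rfl : a = b := by omega
      obtain rfl : l = m := by omega
      rfl
    · exact fun h => (h (Finset.mem_univ _)).elim
    · intro i _
      rw [hcoroot i, smul_zero]
      intro h0
      have hRd := dimVec_eq_of_cls_eq h0
      rw [hdp] at hRd
      obtain ⟨k, hk⟩ := N.exists_pos p.1.2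
      have := congrFun hRd k
      rw [dimVec_eq_zero_iff.2 fun _ => rfl, Set.indicator_of_mem (by
        rw [N.mem_interval]; omega)] at this
      exact zero_ne_one this
  have hinl : ∀ i, c (Sum.inl i) = 0 := by
    refine eq_zero_of_sum_cartan N _ fun j => ?_
    have h := hsum (cls (zeroRep I))
    rw [Fintype.sum_sum_type] at h
    simp only [hinr, zero_smul, Finset.sum_const_zero, add_zero] at h
    have h1 : ∀ i, toFinsupp I (borelFamily N (simpleElem (I := I)) corootElem (Sum.inl i))
        (cls (zeroRep I)) = SymmetricAlgebra.ι ℂ _ (hallCoroot i) :=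
      fun i => Finsupp.single_eq_same
    simp only [h1] at h
    -- Evaluation at `[S j]` extends to an algebra homomorphism on the symmetric algebra and turns
    -- the relation into row `j` of the linear system of the Cartan matrix.
    let ev : HallCartan.{u, v} I →ₗ[ℂ] ℂ :=
      { toFun := fun Z => Z (cls (simple j)).k0
        map_add' := fun _ _ => rfl
        map_smul' := fun _ _ => rfl }
    have h2 := congrArg (SymmetricAlgebra.lift ev) h
    simp only [map_sum, map_smul, SymmetricAlgebra.lift_ι_apply, _root_.map_zero] at h2
    rw [← h2]
    refine Finset.sum_congr rfl fun i _ => ?_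
    change _ = c (Sum.inl i) * hallCoroot i (cls (simple j)).k0
    rw [hallCoroot_simple]
  rintro (i | p)
  · exact hinl i
  · exact hinr p

end ExtHallAlgebra

/-! ### The isomorphism with U(𝔟') and its restriction to U(𝔫₊) -/

namespace ExtHallAlgebra

open F1Rep

attribute [local instance] LieRing.ofAssociativeRing

variable {I : Type u} [Quiver.{v} I] [Fintype I] [DecidableEq I] [∀ i j : I, Finite (i ⟶ j)] {n : ℕ}
  (N : PathNumbering I n)

/-- The homomorphism from the enveloping algebra of the derived Borel subalgebra to the extended
Hall algebra. -/
noncomputable def ofUBPrime : UBPrime I →ₐ[ℂ] ExtHallAlgebra.{u, v} I :=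
  UniversalEnvelopingAlgebra.lift ℂ (borelHom (borelRelations N))

theorem ofUBPrime_ι (x : bPrime I) : ofUBPrime N (UniversalEnvelopingAlgebra.ι ℂ x) =
    borelHom (borelRelations N) x :=
  UniversalEnvelopingAlgebra.lift_ι_apply ℂ _ x

theorem ofUBPrime_h (i : I) : ofUBPrime N (UBPrime.h i) = corootElem i := by
  rw [UBPrime.h, ofUBPrime_ι, borelHom_apply, borelLinear_H]

theorem ofUBPrime_e (i : I) : ofUBPrime N (UBPrime.e i) = simpleElem i := by
  rw [UBPrime.e, ofUBPrime_ι, borelHom_apply, borelLinear_E]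

omit [DecidableEq I] in
theorem comul_one : comul (1 : ExtHallAlgebra.{u, v} I) = 1 := by
  have h := comul_ofSymHom_mul_ofHallHom (I := I) 1 (HallAlgebra.of (cls (zeroRep I)))
  have h0 : HallAlgebra.of (cls (zeroRep.{u, v} I)) = 1 := rfl
  have h1 : HallAlgebra.comul (1 : HallAlgebra.{u, v} I) = 1 ⊗ₜ 1 := by
    classical
    refine HallAlgebra.pairFinsupp.injective (Finsupp.ext fun p => ?_)
    obtain ⟨X, Y⟩ := p
    rw [← cls_rep X, ← cls_rep Y, HallAlgebra.pairFinsupp_comul, HallAlgebra.pairFinsupp_tmul,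
      HallAlgebra.one_apply_cls, HallAlgebra.one_apply_cls, HallAlgebra.one_apply_cls]
    have hiff : (∀ i (z : (sum X.rep Y.rep).V i), z = 0) ↔
        (∀ i (x : X.rep.V i), x = 0) ∧ ∀ i (y : Y.rep.V i), y = 0 :=
      ⟨fun h => ⟨fun i x => congrArg sumFst (h i (sumMk x 0 (Or.inr rfl))),
        fun i y => congrArg sumSnd (h i (sumMk 0 y (Or.inl rfl)))⟩,
        fun h i z => sum_ext (h.1 i _) (h.2 i _)⟩
    by_cases hX : ∀ i (x : X.rep.V i), x = 0
    · by_cases hY : ∀ i (y : Y.rep.V i), y = 0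
      · rw [if_pos (hiff.2 ⟨hX, hY⟩), if_pos hX, if_pos hY, mul_one]
      · rw [if_neg fun h => hY (hiff.1 h).2, if_neg hY, mul_zero]
    · rw [if_neg fun h => hX (hiff.1 h).1, if_neg hX, zero_mul]
  rw [h0, map_one, map_one, map_one, mul_one, one_mul] at h
  rw [h, comulHall, LinearMap.comp_apply, h1, AlgHom.toLinearMap_apply,
    Algebra.TensorProduct.map_tmul, map_one]
  rfl

/-- The homomorphism from the enveloping algebra is compatible with the coproducts. -/
theorem comul_ofUBPrime (x : UBPrime I) : comul (ofUBPrime N x) =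
    TensorProduct.map (ofUBPrime N).toLinearMap (ofUBPrime N).toLinearMap
      (envelopingComul (bPrime I) x) := by
  let Δ : UBPrime I →ₐ[ℂ] ExtHallAlgebra.{u, v} I ⊗[ℂ] ExtHallAlgebra.{u, v} I :=
    (Algebra.TensorProduct.map (ofUBPrime N) (ofUBPrime N)).comp (envelopingComul (bPrime I))
  have hΔ : ∀ y : bPrime I, Δ (UniversalEnvelopingAlgebra.ι ℂ y) =
      ofUBPrime N (UniversalEnvelopingAlgebra.ι ℂ y) ⊗ₜ 1 +
        1 ⊗ₜ ofUBPrime N (UniversalEnvelopingAlgebra.ι ℂ y) := by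
    intro y
    rw [AlgHom.comp_apply, envelopingComul_ι, map_add, Algebra.TensorProduct.map_tmul,
      Algebra.TensorProduct.map_tmul, map_one]
  -- Compatibility of the coproduct with left multiplication is available for the generators.
  -- Keeping `z` arbitrary lets the induction pass to products, so that multiplicativity on all of
  -- the extended algebra is not required.
  have key : ∀ a : UBPrime I, ∀ z, comul (ofUBPrime N a * z) = Δ a * comul z := by
    intro a
    have ha : a ∈ Algebra.adjoin ℂ (Set.range (UBPrime.h : I → UBPrime I) ∪
      Set.range (UBPrime.e : I → UBPrime I)) := by rw [UBPrime.adjoin_h_e]; trivial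
    induction ha using Algebra.adjoin_induction with
    | mem a ha =>
      intro z
      rcases ha with ⟨i, rfl⟩ | ⟨i, rfl⟩
      · rw [UBPrime.h, hΔ, ← UBPrime.h, ofUBPrime_h]
        exact comul_ι_mul _ z
      · rw [UBPrime.e, hΔ, ← UBPrime.e, ofUBPrime_e]
        exact comul_of_mul (HallAlgebra.isPrimitive_simple i) z
    | algebraMap c =>
      intro z
      rw [AlgHom.commutes, AlgHom.commutes, ← Algebra.smul_def, ← Algebra.smul_def, map_smul]
    | add a b _ _ ha hb =>
      intro z
      rw [map_add, map_add, add_mul, add_mul, map_add, ha, hb]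
    | mul a b _ _ ha hb =>
      intro z
      rw [map_mul (ofUBPrime N), mul_assoc, ha, hb, map_mul Δ, mul_assoc]
  have h := key x 1
  rw [mul_one, comul_one, mul_one] at h
  exact h

/-- The homomorphism from the enveloping algebra is compatible with the counits. -/
theorem counit_ofUBPrime (x : UBPrime I) :
    counit (ofUBPrime N x) = envelopingCounit (bPrime I) x := by
  have hne : ∀ i : I, cls (simple.{u, v} i) ≠ cls (zeroRep I) := fun i h => by
    have := congrFun (dimVec_eq_of_cls_eq h) i
    rw [dimVec_simple, if_pos rfl, dimVec_eq_zero_iff.2 fun _ => rfl] at this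
    exact one_ne_zero this
  have key : ∀ a : UBPrime I, ∀ z, counit (ofUBPrime N a * z) =
      envelopingCounit (bPrime I) a * counit z := by
    intro a
    have ha : a ∈ Algebra.adjoin ℂ (Set.range (UBPrime.h : I → UBPrime I) ∪
      Set.range (UBPrime.e : I → UBPrime I)) := by rw [UBPrime.adjoin_h_e]; trivial
    induction ha using Algebra.adjoin_induction with
    | mem a ha =>
      intro z
      rcases ha with ⟨i, rfl⟩ | ⟨i, rfl⟩
      · rw [UBPrime.h, envelopingCounit_ι, ← UBPrime.h, ofUBPrime_h, zero_mul]
        exact counit_ι_mul _ z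
      · rw [UBPrime.e, envelopingCounit_ι, ← UBPrime.e, ofUBPrime_e, zero_mul]
        exact counit_of_mul (hne i) z
    | algebraMap c =>
      intro z
      rw [AlgHom.commutes, AlgHom.commutes, ← Algebra.smul_def, map_smul, smul_eq_mul]
      rfl
    | add a b _ _ ha hb =>
      intro z
      rw [map_add, map_add, add_mul, add_mul, map_add, ha, hb]
    | mul a b _ _ ha hb =>
      intro z
      rw [map_mul (ofUBPrime N), mul_assoc, ha, hb, map_mul (envelopingCounit (bPrime I)),
        mul_assoc]
  have h := key x 1
  have h1 : counit (1 : ExtHallAlgebra.{u, v} I) = 1 := by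
    have h := counit_ofSymHom_mul_ofHallHom (I := I) 1 (HallAlgebra.of (cls (zeroRep I)))
    have h0 : HallAlgebra.of (cls (zeroRep.{u, v} I)) = 1 := rfl
    rw [HallAlgebra.toFinsupp_of, if_pos rfl, Bialgebra.counit_one, h0, map_one, map_one,
      mul_one, mul_one] at h
    exact h
  rw [mul_one, h1, mul_one] at h
  exact h

/-- The counit isolates the scalar, and the independence of coroots and root vectors disposes of the
Lie algebra element. -/
theorem algebraMap_add_ι_eq_zero {c : ℂ} {y : bPrime I}
    (h : ofUBPrime N (algebraMap ℂ _ c + UniversalEnvelopingAlgebra.ι ℂ y) = 0) :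
    c = 0 ∧ y = 0 := by
  have hc := counit_ofUBPrime N (algebraMap ℂ _ c + UniversalEnvelopingAlgebra.ι ℂ y)
  rw [h, _root_.map_zero, map_add, envelopingCounit_ι, AlgHom.commutes, add_zero] at hc
  have hc : c = 0 := hc.symm
  subst hc
  rw [_root_.map_zero, zero_add, ofUBPrime_ι] at h
  exact ⟨rfl, borelHom_injective (borelRelations N) (linearIndependent_borelFamily N)
    (h.trans (_root_.map_zero _).symm)⟩

theorem ofUBPrime_injective : Function.Injective (ofUBPrime N) := by
  refine enveloping_injective (ofUBPrime N).toLinearMap comul (comul_ofUBPrime N)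
    fun c y h => ?_
  obtain ⟨rfl, rfl⟩ := algebraMap_add_ι_eq_zero N h
  rw [_root_.map_zero, _root_.map_zero, add_zero]

/-- The criterion is applied to the composite itself, so the inclusion of 𝔫₊ into 𝔟' only has to be
injective on Lie algebra elements. -/
theorem ofUBPrime_toUBPrime_injective :
    Function.Injective ((ofUBPrime N).comp (UNPlus.toUBPrime (I := I))) := by
  refine enveloping_injective
    ((ofUBPrime N).comp (UNPlus.toUBPrime (I := I))).toLinearMap comul (fun x => ?_) fun c y h => ?_
  · rw [AlgHom.toLinearMap_apply, AlgHom.comp_apply, comul_ofUBPrime, UNPlus.comul_toUBPrime,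
      ← LinearMap.comp_apply, ← TensorProduct.map_comp]
    rfl
  · rw [AlgHom.toLinearMap_apply, AlgHom.comp_apply, map_add, AlgHom.commutes,
      UNPlus.toUBPrime_ι] at h
    obtain ⟨rfl, hy⟩ := algebraMap_add_ι_eq_zero N h
    have hy : y = 0 := LieSubalgebra.inclusion_injective (nPlus_le_bPrime I)
      (hy.trans (_root_.map_zero _).symm)
    rw [hy, _root_.map_zero, _root_.map_zero, add_zero]

omit [DecidableEq I] in
/-- A functional on the Grothendieck group that vanishes on the simple representations is zero. -/
theorem hallCartan_ext (N : PathNumbering I n) {Z : HallCartan.{u, v} I}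
    (hZ : ∀ i, Z (cls (simple i)).k0 = 0) : Z = 0 := by
  set z : ExtHallAlgebra.{u, v} I := ofSymHom (SymmetricAlgebra.ι ℂ _ Z) with hz
  -- A functional that kills the simple classes commutes with the generators, hence with every
  -- `[X]`. The relation `[Z, [X]] = Z(X) [X]` then gives `Z(X) = 0`, without any composition
  -- series.
  have hcomm : ∀ f : HallAlgebra.{u, v} I, z * ofHallHom f = ofHallHom f * z := by
    intro f
    have hf : f ∈ Algebra.adjoin ℂ
        (Set.range fun i : I => HallAlgebra.of (cls (simple.{u, v} i))) := by
      rw [HallAlgebra.adjoin_simple N]; trivial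
    induction hf using Algebra.adjoin_induction with
    | mem f hf =>
      obtain ⟨i, rfl⟩ := hf
      have h := relation Z (cls (simple i))
      rw [hZ, zero_smul] at h
      exact sub_eq_zero.1 h
    | algebraMap c => rw [AlgHom.commutes, Algebra.commutes]
    | add f g _ _ hf hg => rw [map_add, mul_add, add_mul, hf, hg]
    | mul f g _ _ hf hg => rw [map_mul, ← mul_assoc, hf, mul_assoc, hg, mul_assoc]
  have hX : ∀ X : IsoClass.{u, v} I, Z X.k0 = 0 := by
    intro X
    have h := relation Z X
    rw [← ofSymHom_apply, ← ofHallHom_apply, ← hz, hcomm, sub_self] at h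
    refine (smul_eq_zero.1 h.symm).resolve_right fun h0 => ?_
    have h1 := ofHallHom_injective (h0.trans (_root_.map_zero ofHallHom).symm)
    classical
    have h2 := HallAlgebra.toFinsupp_of X X
    rw [h1, _root_.map_zero, if_pos rfl] at h2
    exact zero_ne_one h2
  refine AddMonoidHom.ext fun x => ?_
  obtain ⟨x, rfl⟩ := QuotientAddGroup.mk_surjective x
  have : Z.comp (QuotientAddGroup.mk' (K0Rel I)) = 0 := FreeAbelianGroup.lift_ext _ _ hX
  exact DFunLike.congr_fun this x

/-- The functionals `Z i` span `𝔥_Q`. -/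
theorem exists_sum_hallCoroot (N : PathNumbering I n) (Z : HallCartan.{u, v} I) :
    ∃ c : I → ℂ, Z = ∑ i, c i • hallCoroot i := by
  let A : Matrix I I ℂ := Matrix.of fun j i => (quiverCartan I j i : ℂ)
  have hinj : Function.Injective A.mulVec := by
    refine (injective_iff_map_eq_zero A.mulVecLin).2 fun c hc => ?_
    refine funext fun i => eq_zero_of_sum_cartan N c (fun j => ?_) i
    have h := congrFun hc j
    rw [Matrix.mulVecLin_apply] at h
    refine Eq.trans (Finset.sum_congr rfl fun i _ => mul_comm _ _) h
  obtain ⟨c, hc⟩ := Matrix.mulVec_surjective_iff_isUnit.2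
    (Matrix.mulVec_injective_iff_isUnit.1 hinj) fun j => Z (cls (simple j)).k0
  refine ⟨c, sub_eq_zero.1 (hallCartan_ext N fun j => ?_)⟩
  rw [AddMonoidHom.sub_apply, AddMonoidHom.finsetSum_apply, sub_eq_zero, ← congrFun hc j]
  refine Finset.sum_congr rfl fun i _ => ?_
  rw [AddMonoidHom.smul_apply, hallCoroot_simple, smul_eq_mul, mul_comm]
  rfl

theorem ofUBPrime_surjective : Function.Surjective (ofUBPrime N) := by
  set A := (ofUBPrime N).range with hA
  have hhall : ∀ f, ofHallHom f ∈ A := by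
    intro f
    have hf : f ∈ Algebra.adjoin ℂ
        (Set.range fun i : I => HallAlgebra.of (cls (simple.{u, v} i))) := by
      rw [HallAlgebra.adjoin_simple N]; trivial
    have : f ∈ A.comap ofHallHom := by
      refine Algebra.adjoin_le ?_ hf
      rintro _ ⟨i, rfl⟩
      exact ⟨UBPrime.e i, ofUBPrime_e N i⟩
    exact this
  have hsym : ∀ P, ofSymHom P ∈ A := by
    intro P
    induction P using SymmetricAlgebra.induction with
    | algebraMap c => rw [AlgHom.commutes]; exact A.algebraMap_mem c
    | ι Z =>
      obtain ⟨c, rfl⟩ := exists_sum_hallCoroot N Z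
      rw [map_sum, map_sum]
      refine A.sum_mem fun i _ => ?_
      rw [map_smul, map_smul]
      exact A.smul_mem ⟨UBPrime.h i, ofUBPrime_h N i⟩ _
    | mul P Q hP hQ => rw [map_mul]; exact A.mul_mem hP hQ
    | add P Q hP hQ => rw [map_add]; exact A.add_mem hP hQ
  intro x
  -- The products `P [M]` span the extended Hall algebra, so it suffices that the projection modulo
  -- the range kills them.
  have h : A.toSubmodule.mkQ = 0 := linearMap_ext fun P X => by
    rw [LinearMap.zero_apply, Submodule.mkQ_apply, Submodule.Quotient.mk_eq_zero]
    exact A.mul_mem (hsym P) (hhall _)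
  have h' : A.toSubmodule.mkQ x = 0 := DFunLike.congr_fun h x
  rw [Submodule.mkQ_apply, Submodule.Quotient.mk_eq_zero] at h'
  exact h'

/-- The extended Hall algebra is the enveloping algebra of the derived Borel subalgebra. -/
noncomputable def ubPrimeEquiv : UBPrime I ≃ₐ[ℂ] ExtHallAlgebra.{u, v} I :=
  AlgEquiv.ofBijective (ofUBPrime N) ⟨ofUBPrime_injective N, ofUBPrime_surjective N⟩

theorem ofUBPrime_toUBPrime_mem_range (x : UNPlus I) :
    ofUBPrime N (UNPlus.toUBPrime x) ∈ (ofHallHom (I := I)).range := by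
  have hx : x ∈ Algebra.adjoin ℂ (Set.range (UNPlus.e : I → UNPlus I)) := by
    rw [UNPlus.adjoin_e]; trivial
  have : x ∈ (ofHallHom (I := I)).range.comap ((ofUBPrime N).comp (UNPlus.toUBPrime (I := I))) := by
    refine Algebra.adjoin_le ?_ hx
    rintro _ ⟨i, rfl⟩
    refine ⟨HallAlgebra.of (cls (simple i)), ?_⟩
    change _ = ofUBPrime N (UNPlus.toUBPrime (UNPlus.e i))
    rw [UNPlus.toUBPrime_e, ofUBPrime_e]
    rfl
  exact this

/-- The homomorphism from the enveloping algebra of `𝔫₊` to the Hall algebra. -/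
noncomputable def ofUNPlus : UNPlus I →ₐ[ℂ] HallAlgebra.{u, v} I :=
  (AlgEquiv.ofInjective (ofHallHom (I := I)) ofHallHom_injective).symm.toAlgHom.comp
    (((ofUBPrime N).comp (UNPlus.toUBPrime (I := I))).codRestrict _
      (ofUBPrime_toUBPrime_mem_range N))

theorem ofHallHom_ofUNPlus (x : UNPlus I) :
    ofHallHom (ofUNPlus N x) = ofUBPrime N (UNPlus.toUBPrime x) :=
  congrArg Subtype.val (AlgEquiv.apply_symm_apply
    (AlgEquiv.ofInjective (ofHallHom (I := I)) ofHallHom_injective) _)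

theorem ofUNPlus_e (i : I) : ofUNPlus N (UNPlus.e i) = HallAlgebra.of (cls (simple i)) :=
  ofHallHom_injective (by rw [ofHallHom_ofUNPlus, UNPlus.toUBPrime_e, ofUBPrime_e, simpleElem])

theorem ofUNPlus_bijective : Function.Bijective (ofUNPlus N) := by
  refine ⟨fun x y h => ofUBPrime_toUBPrime_injective N ?_, ?_⟩
  · rw [AlgHom.comp_apply, AlgHom.comp_apply, ← ofHallHom_ofUNPlus, ← ofHallHom_ofUNPlus, h]
  · rw [← AlgHom.range_eq_top, eq_top_iff, ← HallAlgebra.adjoin_simple N]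
    refine Algebra.adjoin_le ?_
    rintro _ ⟨i, rfl⟩
    exact ⟨UNPlus.e i, ofUNPlus_e N i⟩

/-- The Hall algebra is the enveloping algebra of `𝔫₊`. -/
noncomputable def unPlusEquiv : UNPlus I ≃ₐ[ℂ] HallAlgebra.{u, v} I :=
  AlgEquiv.ofBijective (ofUNPlus N) (ofUNPlus_bijective N)

/-- The basis of `U(𝔫₊)` given by the isomorphism classes of representations. -/
noncomputable def unPlusBasis : Module.Basis (IsoClass.{u, v} I) ℂ (UNPlus I) :=
  Module.Basis.ofRepr ((unPlusEquiv N).toLinearEquiv.trans (HallAlgebra.toFinsupp I))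

theorem unPlusEquiv_basis (X : IsoClass.{u, v} I) :
    unPlusEquiv N (unPlusBasis N X) = HallAlgebra.of X :=
  AlgEquiv.apply_symm_apply (unPlusEquiv N) _

end ExtHallAlgebra

/-! ### Structure constants and the integral form -/

namespace HallAlgebra

open F1Rep

variable {I : Type u} [Quiver.{v} I] [Fintype I] [∀ i j : I, Finite (i ⟶ j)] {n : ℕ}

/-- The coefficient of `[R]` is the number of subrepresentations of `R` in the class `Y` with
quotient in the class `X`. -/
theorem of_mul_of (X Y : IsoClass.{u, v} I) :
    ∃ c : IsoClass.{u, v} I →₀ ℕ, of X * of Y = c.sum fun R m => m • of R := by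
  classical
  let c : IsoClass.{u, v} I → ℕ := fun R =>
    (Finset.univ.filter fun L : Sub R.rep => cls L.quot = X ∧ cls L.rep = Y).card
  have hc : ∀ R, toFinsupp I (of X * of Y) R = c R := fun R => by
    conv_lhs => rw [← cls_rep R]
    exact of_mul_of_apply_cls X Y R.rep
  refine ⟨Finsupp.onFinset (toFinsupp I (of X * of Y)).support c fun R hR => ?_, ?_⟩
  · rw [Finsupp.mem_support_iff, hc]
    exact Nat.cast_ne_zero.2 hR
  · rw [Finsupp.onFinset_sum _ fun R => zero_smul ℕ (of R)]
    conv_lhs => rw [eq_sum_of (of X * of Y)]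
    refine Finset.sum_congr rfl fun R _ => ?_
    rw [hc, Nat.cast_smul_eq_nsmul]

/-- The classes of the representations span the subring generated by the divided powers of the
classes of the simple representations. -/
theorem closure_of_eq (N : PathNumbering I n) :
    AddSubgroup.closure (Set.range (of (I := I))) = (Subring.closure {x : HallAlgebra.{u, v} I |
      ∃ (i : I) (k : ℕ), x = ((k.factorial : ℂ)⁻¹) • of (cls (simple i)) ^ k}).toAddSubgroup := by
  have hpow : ∀ (i : I) (k : ℕ), ((k.factorial : ℂ)⁻¹) • of (cls (simple.{u, v} i)) ^ k =
      of (cls (constRep {i} k)) := by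
    intro i k
    rw [simple_pow N, ← Nat.cast_smul_eq_nsmul ℂ, smul_smul,
      inv_mul_cancel₀ (Nat.cast_ne_zero.2 (Nat.factorial_ne_zero _)), one_smul]
  apply le_antisymm
  · rw [AddSubgroup.closure_le]
    rintro _ ⟨X, rfl⟩
    rw [← cls_rep X]
    -- Classes concentrated at one vertex are divided powers of simple classes, and the generation
    -- theorem holds for subrings, so no denominators appear.
    refine of_mem_of_concentrated (Subring.closure {x : HallAlgebra.{u, v} I |
      ∃ (i : I) (k : ℕ), x = ((k.factorial : ℂ)⁻¹) • of (cls (simple i)) ^ k}) N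
      (fun i M hM => ?_) X.rep
    rw [cls_eq_constRep_singleton N hM, ← hpow]
    exact Subring.subset_closure ⟨i, _, rfl⟩
  · intro x hx
    have hmul : ∀ x ∈ AddSubgroup.closure (Set.range (of (I := I))),
        ∀ y ∈ AddSubgroup.closure (Set.range (of (I := I))),
          x * y ∈ AddSubgroup.closure (Set.range (of (I := I))) := by
      intro x hx y hy
      induction hx using AddSubgroup.closure_induction with
      | mem x hx =>
        obtain ⟨X, rfl⟩ := hx
        induction hy using AddSubgroup.closure_induction with
        | mem y hy =>
          obtain ⟨Y, rfl⟩ := hy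
          obtain ⟨c, hc⟩ := of_mul_of X Y
          rw [hc]
          exact AddSubgroup.sum_mem _ fun R _ =>
            AddSubgroup.nsmul_mem _ (AddSubgroup.subset_closure (Set.mem_range_self R)) _
        | zero => rw [mul_zero]; exact zero_mem _
        | add y z _ _ hy hz => rw [mul_add]; exact add_mem hy hz
        | neg y _ hy => rw [mul_neg]; exact neg_mem hy
      | zero => rw [zero_mul]; exact zero_mem _
      | add x z _ _ hx hz => rw [add_mul]; exact add_mem hx hz
      | neg x _ hx => rw [neg_mul]; exact neg_mem hx
    replace hx : x ∈ Subring.closure {x : HallAlgebra.{u, v} I |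
      ∃ (i : I) (k : ℕ), x = ((k.factorial : ℂ)⁻¹) • of (cls (simple i)) ^ k} := hx
    induction hx using Subring.closure_induction with
    | mem x hx =>
      obtain ⟨i, k, rfl⟩ := hx
      rw [hpow]
      exact AddSubgroup.subset_closure ⟨_, rfl⟩
    | zero => exact zero_mem _
    | one => exact AddSubgroup.subset_closure ⟨cls (zeroRep I), rfl⟩
    | add x y _ _ hx hy => exact add_mem hx hy
    | neg x _ hx => exact neg_mem hx
    | mul x y _ _ hx hy => exact hmul x hx y hy

end HallAlgebra

/-! ### The main theorem -/

theorem mainTheorem3 (n : ℕ) (I : Type u) [Fintype I] [DecidableEq I] [Quiver.{v} I]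
    [∀ i j : I, Finite (i ⟶ j)] (hQ : IsTypeA I n) :
    ∃ ρ : UBPrime I ≃ₐ[ℂ] ExtHallAlgebra.{u, v} I,
      (∀ i : I, ρ (UBPrime.e i) =
        ExtHallAlgebra.ofHall (HallAlgebra.of (F1Rep.cls (F1Rep.simple i)))) ∧
      (∀ i : I, ρ (UBPrime.h i) =
        ExtHallAlgebra.ofSym (SymmetricAlgebra.ι ℂ _ (hallCoroot i))) ∧
      (∀ φ : UBPrime I →ₐ[ℂ] ExtHallAlgebra.{u, v} I,
        (∀ i : I, φ (UBPrime.e i) =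
          ExtHallAlgebra.ofHall (HallAlgebra.of (F1Rep.cls (F1Rep.simple i)))) →
        (∀ i : I, φ (UBPrime.h i) =
          ExtHallAlgebra.ofSym (SymmetricAlgebra.ι ℂ _ (hallCoroot i))) →
        φ = ρ.toAlgHom) ∧
      (∀ x : UBPrime I, ExtHallAlgebra.comul (ρ x) =
        TensorProduct.map ρ.toLinearMap ρ.toLinearMap (envelopingComul (bPrime I) x)) ∧
      (∀ x : UBPrime I, ExtHallAlgebra.counit (ρ x) = envelopingCounit (bPrime I) x) ∧
      ∃ ρ' : UNPlus I ≃ₐ[ℂ] HallAlgebra.{u, v} I,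
        (∀ i : I, ρ' (UNPlus.e i) = HallAlgebra.of (F1Rep.cls (F1Rep.simple i))) ∧
        (∀ x : UNPlus I, ExtHallAlgebra.ofHall (ρ' x) = ρ (UNPlus.toUBPrime x)) ∧
        ∃ b : Module.Basis (F1Rep.IsoClass.{u, v} I) ℂ (UNPlus I),
          (∀ M, ρ' (b M) = HallAlgebra.of M) ∧
          (∀ M N, ∃ c : F1Rep.IsoClass.{u, v} I →₀ ℕ, b M * b N = c.sum fun R m => m • b R) ∧
          AddSubgroup.closure (Set.range b) = (kostantForm (I := I)).toAddSubgroup := by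
  obtain ⟨σ, hσ⟩ := hQ
  let N : PathNumbering I n := ⟨σ, hσ⟩
  have hb := ExtHallAlgebra.unPlusEquiv_basis N
  refine ⟨ExtHallAlgebra.ubPrimeEquiv N, ExtHallAlgebra.ofUBPrime_e N, ExtHallAlgebra.ofUBPrime_h N,
    fun φ he hh => UBPrime.algHom_ext (fun i => (hh i).trans (ExtHallAlgebra.ofUBPrime_h N i).symm)
      fun i => (he i).trans (ExtHallAlgebra.ofUBPrime_e N i).symm,
    ExtHallAlgebra.comul_ofUBPrime N, ExtHallAlgebra.counit_ofUBPrime N,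
    ExtHallAlgebra.unPlusEquiv N, ExtHallAlgebra.ofUNPlus_e N, ExtHallAlgebra.ofHallHom_ofUNPlus N,
    ExtHallAlgebra.unPlusBasis N, hb, fun X Y => ?_, ?_⟩
  · obtain ⟨c, hc⟩ := HallAlgebra.of_mul_of X Y
    refine ⟨c, (ExtHallAlgebra.unPlusEquiv N).injective ?_⟩
    rw [map_mul, hb, hb, hc, Finsupp.sum, Finsupp.sum, map_sum]
    exact Finset.sum_congr rfl fun R _ => by rw [map_nsmul, hb]
  · let e : UNPlus I ≃+* HallAlgebra.{u, v} I := (ExtHallAlgebra.unPlusEquiv N).toRingEquiv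
    have h := HallAlgebra.closure_of_eq (I := I) N
    refine AddSubgroup.map_injective (f := (e : UNPlus I →+ HallAlgebra.{u, v} I)) e.injective ?_
    rw [AddMonoidHom.map_closure]
    have h1 : (e : UNPlus I →+ HallAlgebra.{u, v} I) '' Set.range (ExtHallAlgebra.unPlusBasis N) =
        Set.range HallAlgebra.of := by
      rw [← Set.range_comp]
      exact congrArg Set.range (funext hb)
    have h2 : (kostantForm (I := I)).map (e : UNPlus I →+* HallAlgebra.{u, v} I) =
        Subring.closure {x : HallAlgebra.{u, v} I | ∃ (i : I) (k : ℕ),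
          x = ((k.factorial : ℂ)⁻¹) • HallAlgebra.of (F1Rep.cls (F1Rep.simple i)) ^ k} := by
      rw [kostantForm, RingHom.map_closure]
      congr 1
      have hE : ∀ (i : I) (k : ℕ), e (((k.factorial : ℂ)⁻¹) • UNPlus.e i ^ k) =
          ((k.factorial : ℂ)⁻¹) • HallAlgebra.of (F1Rep.cls (F1Rep.simple i)) ^ k := by
        intro i k
        change ExtHallAlgebra.ofUNPlus N _ = _
        rw [map_smul, map_pow, ExtHallAlgebra.ofUNPlus_e]
      ext x
      constructor
      · rintro ⟨_, ⟨i, k, rfl⟩, rfl⟩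
        exact ⟨i, k, hE i k⟩
      · rintro ⟨i, k, rfl⟩
        exact ⟨_, ⟨i, k, rfl⟩, hE i k⟩
    rw [h1, h, ← h2]
    rfl
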